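/- Write $x=(x_1,x_2)=(z,r)\in\mathbb R^2$, $\Pi=\{x\in\mathbb R^2: x_2>0\}$, and let $H=(H_1,H_2)$ be the axisymmetric (swirl-free) Biot--Savart kernel $$H_1(x,y)=\frac1{2\pi}\int_0^\pi \frac{y_2(y_2-x_2\cos\theta)}{[|x-y|^2+2x_2y_2(1-\cos\theta)]^{3/2}}\,d\theta,\qquad H_2(x,y)=\frac1{2\pi}\int_0^\pi \frac{y_2(x_1-y_1)\cos\theta}{[|x-y|^2+2x_2y_2(1-\cos\theta)]^{3/2}}\,d\theta .$$ Let $\zeta^0=(z_0,r_0)\in\Pi$ and $M,C_F,L,T>0$. There is a constant $C>0$, depending only on $\zeta^0,M,C_F,L,T$, such that the following holds for every $\varepsilon\in(0,1)$ with $\varepsilon<r_0/2$. Let $F^\varepsilon:\mathbb R^2\times[0,\infty)\to\mathbb R^2$ be continuous, with $\partial_{x_1}(x_2F_1^\varepsilon)+\partial_{x_2}(x_2F_2^\varepsilon)=0$ in $\Pi$ (in the sense of distributions) at each time, and $$|F^\varepsilon(x,t)|\le \frac{C_F}{|\log\varepsilon|},\qquad |F^\varepsilon(x,t)-F^\varepsilon(y,t)|\le\frac{L}{|\log\varepsilon|}\,|x-y|\qquad\forall\,x,y\in\mathbb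 R^2,\ t\ge0 .$$ Let $\omega_\varepsilon$ be a solution on $[0,\infty)$ of the reduced system with external field $F^\varepsilon$, that is, $$u(x,t)=\int H(x,y)\,\omega_\varepsilon(y,t)\,dy,\qquad \dot x(t)=u(x(t),t)+F^\varepsilon(x(t),t),\qquad \omega_\varepsilon(x(t),t)=\frac{x_2(t)}{x_2(0)}\,\omega_\varepsilon(x(0),0),$$ where the trajectories $x(t)$ form a continuous flow of bijections of $\Pi$ and $\omega_\varepsilon(x,t)=0$ for $x_2\le0$. Suppose that the initial vorticity is measurable and satisfies $$0\le\omega_\varepsilon(x,0)\le\frac{M}{\varepsilon^2|\log\varepsilon|}\quad\forall\,x\in\mathbb R^2,\qquad |\log\varepsilon|\int\omega_\varepsilon(y,0)\,dy=1,\qquad \operatorname{supp}\omega_\varepsilon(\cdot,0)\subset\{x:|x-\zeta^0|<\varepsilon\}.$$ Put $$T^0_\varepsilon=\max\Big\{t\in[0,T]:\ \tfrac{r_0}2\le x_2\le\tfrac32r_0\ \ \forall\,x\in\operatorname{supp}\omega_\varepsilon(\cdot,s)\ \ \forall\,s\in[0,t]\Big\},$$ $$B_\varepsilon(t)=\frac{\int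 x\,\omega_\varepsilon(x,t)\,dx}{\int\omega_\varepsilon(x,t)\,dx},\qquad I_\varepsilon(t)=\int\big(x_2-B_{\varepsilon,2}(t)\big)^2\omega_\varepsilon(x,t)\,dx .$$ Then $$I_\varepsilon(t)\le\frac{C}{|\log\varepsilon|^2}\qquad\forall\,t\in[0,T^0_\varepsilon].$$ -/

import Mathlib

noncomputable section

open MeasureTheory Set Real

namespace VortexRing

/-- The plane of the points `x = (x₁, x₂) = (z, r)`; the axial coordinate `x₁` is `x 0`, the radial
coordinate `x₂` is `x 1`. -/
abbrev Plane : Type := EuclideanSpace ℝ (Fin 2)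

/-- The open half-plane `{x : x₂ > 0}`. -/
def halfPlane : Set Plane := {x | 0 < x 1}

/-- The bracket `|x - y|² + 2 x₂ y₂ (1 - cos θ)`. -/
def bracket (x y : Plane) (θ : ℝ) : ℝ :=
  ‖x - y‖ ^ 2 + 2 * x 1 * y 1 * (1 - cos θ)

/-- Axial component of the axisymmetric Biot–Savart kernel. -/
def H₁ (x y : Plane) : ℝ :=
  1 / (2 * π) * ∫ θ in (0 : ℝ)..π,
    y 1 * (y 1 - x 1 * cos θ) / (bracket x y θ) ^ (3 / 2 : ℝ)

/-- Radial component of the axisymmetric Biot–Savart kernel. -/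
def H₂ (x y : Plane) : ℝ :=
  1 / (2 * π) * ∫ θ in (0 : ℝ)..π,
    y 1 * (x 0 - y 0) * cos θ / (bracket x y θ) ^ (3 / 2 : ℝ)

/-- The velocity `u(x) = ∫ H(x, y) w(y) dy` generated by the vorticity `w`. -/
def velocity (w : Plane → ℝ) (x : Plane) : Plane :=
  !₂[∫ y, H₁ x y * w y, ∫ y, H₂ x y * w y]

/-- The hypotheses on the external field at the parameter `ε`, with constants `C_F` and `L`. -/
structure IsExternalField (ε C_F L : ℝ) (F : ℝ → Plane → Plane) : Prop where
  continuousOn : ContinuousOn (fun p : ℝ × Plane => F p.1 p.2) (Ici 0 ×ˢ univ)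
  /-- `∂₁(x₂ F₁) + ∂₂(x₂ F₂) = 0` on the half-plane. A Lipschitz field need not be differentiable
  everywhere, so the equation is read against test functions
  (`fderiv ℝ f x (F t x)` is `F · ∇f`). -/
  divergence_free : ∀ t, 0 ≤ t → ∀ f : Plane → ℝ, ContDiff ℝ ((⊤ : ℕ∞) : WithTop ℕ∞) f → HasCompactSupport f →
    tsupport f ⊆ halfPlane → ∫ x, x 1 * fderiv ℝ f x (F t x) = 0
  bound : ∀ t, 0 ≤ t → ∀ x, ‖F t x‖ ≤ C_F / |log ε|
  lipschitz : ∀ t, 0 ≤ t → ∀ x y, ‖F t x - F t y‖ ≤ L / |log ε| * ‖x - y‖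

/-- The hypotheses on the initial vorticity at the parameter `ε` (unit vortex intensity). -/
structure IsInitialDatum (ε M : ℝ) (ζ₀ : Plane) (w : Plane → ℝ) : Prop where
  measurable : Measurable w
  nonneg : ∀ x, 0 ≤ w x
  bound : ∀ x, w x ≤ M / (ε ^ 2 * |log ε|)
  intensity : |log ε| * ∫ y, w y = 1
  support : tsupport w ⊆ Metric.ball ζ₀ ε

/-- `φ` is the flow on the half-plane of `ẋ = u(x, t) + F(x, t)`, where `u(·, t)` is the velocity
generated by `ω(·, t)`, and `ω / x₂` is constant along this flow. The vorticity is extended by zero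
outside the half-plane. -/
structure IsReducedFlow (F : ℝ → Plane → Plane) (ω : ℝ → Plane → ℝ) (φ : ℝ → Plane → Plane) :
    Prop where
  continuousOn : ContinuousOn (fun p : ℝ × Plane => φ p.1 p.2) (Ici 0 ×ˢ halfPlane)
  bijOn : ∀ t, 0 ≤ t → BijOn (φ t) halfPlane halfPlane
  initial : ∀ x ∈ halfPlane, φ 0 x = x
  ode : ∀ x ∈ halfPlane, ∀ t, 0 ≤ t →
    HasDerivWithinAt (fun s => φ s x) (velocity (ω t) (φ t x) + F t (φ t x)) (Ici 0) t
  transport : ∀ x ∈ halfPlane, ∀ t, 0 ≤ t → ω t (φ t x) = φ t x 1 / x 1 * ω 0 x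
  extension : ∀ t, 0 ≤ t → ∀ x ∉ halfPlane, ω t x = 0

/-- `ω` solves the reduced system with external field `F` on `[0, ∞)`. -/
def IsReducedSolution (F : ℝ → Plane → Plane) (ω : ℝ → Plane → ℝ) : Prop :=
  ∃ φ : ℝ → Plane → Plane, IsReducedFlow F ω φ

/-- The times `t ∈ [0, T]` such that the vorticity stays in the strip `r₀ / 2 ≤ x₂ ≤ 3 r₀ / 2`
during `[0, t]`. -/
def confinedTimes (r₀ T : ℝ) (ω : ℝ → Plane → ℝ) : Set ℝ :=
  {t ∈ Icc 0 T | ∀ s ∈ Icc 0 t, ∀ x ∈ tsupport (ω s), r₀ / 2 ≤ x 1 ∧ x 1 ≤ 3 / 2 * r₀}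

/-- The largest time up to which the vorticity stays in the strip. -/
def confinementTime (r₀ T : ℝ) (ω : ℝ → Plane → ℝ) : ℝ :=
  sSup (confinedTimes r₀ T ω)

/-- The center of vorticity `∫ x w(x) dx / ∫ w(x) dx`. -/
def center (w : Plane → ℝ) : Plane :=
  (∫ x, w x)⁻¹ • ∫ x, w x • x

/-- The axial moment of inertia `∫ (x₂ - B₂)² w(x) dx`, with `B` the center of vorticity. -/
def axialMoment (w : Plane → ℝ) : ℝ :=
  ∫ x, (x 1 - center w 1) ^ 2 * w x

end VortexRing

end

noncomputable section

open MeasureTheory Set Filter Topology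

namespace VortexRing

/-! Let `A = 1/|log ε|` be the total vorticity. Expanding the square, the moment is `∫ x₂² ω - (∫ x₂
ω)² / A`, so its time derivative is `2 ∫ x₂ (u₂ + F₂) ω - 2 β ∫ (u₂ + F₂) ω`, with `β` the radial
coordinate of the center. Three facts bound it by a constant times `A²`.

The function `x₂ H₂(x, y)` is antisymmetric in `(x, y)`, so `∫ x₂ u₂ ω = 0`
(`integral_coord_mul_regVel`). Symmetrising `∫ u₂ ω` turns the factor `y₂` of `H₂` into `y₂ - x₂`.
This gain of one power of the distance makes the angular integral bounded, uniformly as `x` and `y`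
merge (`abs_radialKernel_add_le`), whence `|∫ u₂ ω| ≤ const · A²`. Finally the field enters only
through `∫ (x₂ - β) F₂ ω`, where `|x₂ - β| ≤ r₀`, `|F₂| ≤ C_F A` and the mass is `A`. All this is
`abs_momentRate_le`. The initial moment is at most `ε² A ≤ A²`, and integration over a time at most
`T` concludes.

Most of the work justifies the derivative, that is, the transport formula `∫ f ω_t = ∫ f(φ_t) ω_0`
(`integral_mul_vorticity`). Since `ω / x₂` is constant along trajectories, this amounts to
invariance of the measure `x₂ dx` under the flow (`ringVolume_image`). The flow is only assumed to
be a continuous bijection, and the estimates on the velocity are of log-Lipschitz type, so there is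
no Jacobian to compute. The kernel is therefore regularised at scale `δ`. The regularised velocity
is smooth, exactly weighted divergence free, `√δ`-close to the true one, and has Lipschitz constant
of order `log(1/δ)`. Over a short time interval Gronwall's factor is at most of order `δ^(-1/4)`, so
Euler polygons along such fields end close to the true trajectories. Each Euler step of length `h`
changes the weighted volume by a relative error `O(h²)`. This gives an inequality between the
volumes of the images at two times; exchanging the two times gives equality. -/

/-! ### Ring volume under Euler steps along weighted divergence-free fields -/

/-- The measure `x₂ dx` on the half-plane, that is, the volume of the rotated set up to `2π`. -/
def ringVolume : Measure Plane := volume.withDensity fun x => ENNReal.ofReal (x 1)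

lemma continuous_coord (i : Fin 2) : Continuous fun x : Plane => x i :=
  (EuclideanSpace.proj (𝕜 := ℝ) i).continuous

instance : IsFiniteMeasureOnCompacts ringVolume := by
  have : IsLocallyFiniteMeasure ringVolume :=
    IsLocallyFiniteMeasure.withDensity_ofReal (continuous_coord 1)
  infer_instance

lemma abs_coord_le (x : Plane) (i : Fin 2) : |x i| ≤ ‖x‖ := PiLp.norm_apply_le x i

/-- The `i`-th unit vector of the plane. -/
def unitVec (i : Fin 2) : Plane := EuclideanSpace.single i 1

lemma norm_unitVec (i : Fin 2) : ‖unitVec i‖ = 1 := by simp [unitVec]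

lemma abs_entry_le (B : Plane →L[ℝ] Plane) (i j : Fin 2) : |B (unitVec i) j| ≤ ‖B‖ :=
  (abs_coord_le _ _).trans ((B.le_opNorm _).trans (by rw [norm_unitVec, mul_one]))

lemma det_id_add_smul (B : Plane →L[ℝ] Plane) (h : ℝ) :
    (ContinuousLinearMap.id ℝ Plane + h • B).det =
      1 + h * (B (unitVec 0) 0 + B (unitVec 1) 1) +
        h ^ 2 * (B (unitVec 0) 0 * B (unitVec 1) 1 - B (unitVec 0) 1 * B (unitVec 1) 0) := by
  rw [ContinuousLinearMap.det,
    ← LinearMap.det_toMatrix (EuclideanSpace.basisFun (Fin 2) ℝ).toBasis, Matrix.det_fin_two]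
  simp [LinearMap.toMatrix_apply, unitVec]
  ring

/-- A field on `R` that is Lipschitz, bounded and almost everywhere weighted divergence free. -/
structure IsStepField (R : Set Plane) (Λ V : ℝ) (w : Plane → Plane) : Prop where
  lipschitz : ∀ x ∈ R, ∀ y ∈ R, ‖w x - w y‖ ≤ Λ * ‖x - y‖
  bound : ∀ x ∈ R, ‖w x‖ ≤ V
  div_free : ∀ᵐ x : Plane, x ∈ R → ∃ B : Plane →L[ℝ] Plane, HasFDerivAt w B x ∧
    x 1 * (B (unitVec 0) 0 + B (unitVec 1) 1) + w x 1 = 0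

/-- The coefficient of `h` is `x (p + s) + w`, which vanishes by `hdiv`, so only terms of order `h²`
survive. Dividing by the lower bound `a` of the weight turns them into a relative error. -/
lemma weighted_jacobian_ge {a b Λ V h x w p q r s : ℝ} (ha : 0 < a) (hax : a ≤ x) (hxb : x ≤ b)
    (hΛ : 0 ≤ Λ) (hw : |w| ≤ V) (hp : |p| ≤ Λ) (hq : |q| ≤ Λ) (hr : |r| ≤ Λ) (hs : |s| ≤ Λ)
    (hdiv : x * (p + s) + w = 0) (hh : |h| ≤ 1) :
    x * (1 - (2 * V * Λ + 2 * b * Λ ^ 2 + 2 * V * Λ ^ 2) / a * h ^ 2) ≤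
      (x + h * w) * (1 + h * (p + s) + h ^ 2 * (p * s - q * r)) := by
  have hV : 0 ≤ V := (abs_nonneg _).trans hw
  have hd : |p * s - q * r| ≤ 2 * Λ ^ 2 := by
    have h1 : |p * s| ≤ Λ * Λ := by rw [abs_mul]; gcongr
    have h2 : |q * r| ≤ Λ * Λ := by rw [abs_mul]; gcongr
    calc |p * s - q * r| ≤ |p * s| + |q * r| := abs_sub _ _
      _ ≤ _ := by nlinarith
  have ht : |p + s| ≤ 2 * Λ := (abs_add_le _ _).trans (by linarith)
  set d := p * s - q * r
  have e : (x + h * w) * (1 + h * (p + s) + h ^ 2 * d) =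
      x + h ^ 2 * (w * (p + s) + x * d + h * (w * d)) := by linear_combination h * hdiv
  have hb : |w * (p + s) + x * d + h * (w * d)| ≤
      2 * V * Λ + 2 * b * Λ ^ 2 + 2 * V * Λ ^ 2 := by
    have h1 : |w * (p + s)| ≤ V * (2 * Λ) := by rw [abs_mul]; gcongr
    have h2 : |x * d| ≤ b * (2 * Λ ^ 2) := by
      rw [abs_mul, abs_of_pos (ha.trans_le hax)]; gcongr; linarith
    have h3 : |h * (w * d)| ≤ 1 * (V * (2 * Λ ^ 2)) := by
      rw [abs_mul, abs_mul]; gcongr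
    calc _ ≤ |w * (p + s)| + |x * d| + |h * (w * d)| := abs_add_three _ _ _
      _ ≤ _ := by nlinarith
  set C := 2 * V * Λ + 2 * b * Λ ^ 2 + 2 * V * Λ ^ 2
  have hC : 0 ≤ C := (abs_nonneg _).trans hb
  have h1 : C ≤ x * (C / a) := by
    rw [mul_div_assoc', le_div_iff₀ ha]; nlinarith
  rw [e]
  nlinarith [(abs_le.1 hb).1, sq_nonneg h, mul_le_mul_of_nonneg_left h1 (sq_nonneg h),
    mul_le_mul_of_nonneg_left (abs_le.1 hb).1 (sq_nonneg h)]

/-- Change of variables for the Euler map, which is injective because `|h| Λ < 1`; the condition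
`|h| V ≤ a` keeps the weight nonnegative on the image. The step `h` may be negative, so one
inequality serves both directions of time. -/
lemma IsStepField.ringVolume_image_ge {R : Set Plane} {Λ V a b h : ℝ} {w : Plane → Plane}
    (hw : IsStepField R Λ V w) (hR : IsOpen R) (ha : 0 < a) (hRa : ∀ x ∈ R, a ≤ x 1)
    (hRb : ∀ x ∈ R, x 1 ≤ b) (hΛ : 0 ≤ Λ) (hh : |h| ≤ 1) (hhΛ : |h| * Λ < 1) (hhV : |h| * V ≤ a)
    {A : Set Plane} (hA : MeasurableSet A) (hAR : A ⊆ R) :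
    ENNReal.ofReal (1 - (2 * V * Λ + 2 * b * Λ ^ 2 + 2 * V * Λ ^ 2) / a * h ^ 2) * ringVolume A ≤
      ringVolume ((fun x => x + h • w x) '' A) := by
  set C := (2 * V * Λ + 2 * b * Λ ^ 2 + 2 * V * Λ ^ 2) / a
  set E : Plane → Plane := fun x => x + h • w x
  let bad : Set Plane := {x | ¬ (x ∈ R → ∃ B : Plane →L[ℝ] Plane, HasFDerivAt w B x ∧
    x 1 * (B (unitVec 0) 0 + B (unitVec 1) 1) + w x 1 = 0)}
  have hbad : volume (toMeasurable volume bad) = 0 := by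
    rw [measure_toMeasurable]; exact hw.div_free
  -- Points without the pointwise equation are removed through a measurable null hull: the volume of
  -- `A` is unchanged and the image can only shrink, which is harmless for a lower bound.
  let s := A \ toMeasurable volume bad
  have hs : MeasurableSet s := hA.diff (measurableSet_toMeasurable _ _)
  have hsR : s ⊆ R := sdiff_subset.trans hAR
  have hex : ∀ x ∈ s, ∃ B : Plane →L[ℝ] Plane, HasFDerivAt w B x ∧
      x 1 * (B (unitVec 0) 0 + B (unitVec 1) 1) + w x 1 = 0 := by
    intro x hx
    by_contra hcon
    exact hx.2 (subset_toMeasurable _ _ fun hall => hcon (hall (hsR hx)))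
  choose! B hB hdiv using hex
  have hBn : ∀ x ∈ s, ‖B x‖ ≤ Λ := fun x hx =>
    (hB x hx).le_of_lip' hΛ <| by
      filter_upwards [hR.mem_nhds (hsR hx)] with y hy using hw.lipschitz y hy x (hsR hx)
  have hderiv : ∀ x ∈ s, HasFDerivWithinAt E (ContinuousLinearMap.id ℝ Plane + h • B x) s x :=
    fun x hx => ((hasFDerivAt_id x).add ((hB x hx).const_smul h)).hasFDerivWithinAt
  have hinj : InjOn E s := by
    intro x hx y hy hxy
    have e1 : x - y = h • (w y - w x) := by
      have : x + h • w x = y + h • w y := hxy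
      rw [smul_sub, sub_eq_sub_iff_add_eq_add, this, add_comm]
    have e2 : ‖x - y‖ ≤ |h| * Λ * ‖x - y‖ := by
      calc ‖x - y‖ = |h| * ‖w y - w x‖ := by rw [e1, norm_smul, Real.norm_eq_abs]
        _ ≤ |h| * (Λ * ‖y - x‖) := by gcongr; exact hw.lipschitz _ (hsR hy) _ (hsR hx)
        _ = _ := by rw [norm_sub_rev]; ring
    have e3 : ‖x - y‖ = 0 := by nlinarith [norm_nonneg (x - y)]
    exact sub_eq_zero.1 (norm_eq_zero.1 e3)
  have hvol : ringVolume A = ∫⁻ x in s, ENNReal.ofReal (x 1) := by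
    rw [ringVolume, withDensity_apply _ hA]
    refine setLIntegral_congr ?_
    exact (sdiff_null_ae_eq_self hbad).symm
  calc ENNReal.ofReal (1 - C * h ^ 2) * ringVolume A
      = ∫⁻ x in s, ENNReal.ofReal (1 - C * h ^ 2) * ENNReal.ofReal (x 1) := by
        rw [hvol, lintegral_const_mul _ (continuous_coord 1).measurable.ennreal_ofReal]
    _ ≤ ∫⁻ x in s, ENNReal.ofReal |(ContinuousLinearMap.id ℝ Plane + h • B x).det| *
          ENNReal.ofReal (E x 1) := by
        refine setLIntegral_mono' hs fun x hx => ?_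
        have hx1 : 0 ≤ x 1 := ha.le.trans (hRa x (hsR hx))
        have hw1 : |w x 1| ≤ V := (abs_coord_le _ _).trans (hw.bound x (hsR hx))
        have hE : E x 1 = x 1 + h * w x 1 := by simp [E]
        have hE0 : 0 ≤ E x 1 := by
          have : |h * w x 1| ≤ a := by
            rw [abs_mul]; exact (mul_le_mul_of_nonneg_left hw1 (abs_nonneg h)).trans hhV
          rw [hE]; linarith [(abs_le.1 this).1, hRa x (hsR hx)]
        rw [← ENNReal.ofReal_mul' hx1, ← ENNReal.ofReal_mul' hE0]
        refine ENNReal.ofReal_le_ofReal ?_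
        have key := weighted_jacobian_ge (h := h) ha (hRa x (hsR hx)) (hRb x (hsR hx)) hΛ hw1
          ((abs_entry_le (B x) 0 0).trans (hBn x hx)) ((abs_entry_le (B x) 0 1).trans (hBn x hx))
          ((abs_entry_le (B x) 1 0).trans (hBn x hx)) ((abs_entry_le (B x) 1 1).trans (hBn x hx))
          (hdiv x hx) hh
        rw [← det_id_add_smul, ← hE] at key
        calc (1 - C * h ^ 2) * x 1 = x 1 * (1 - C * h ^ 2) := mul_comm _ _
          _ ≤ E x 1 * (ContinuousLinearMap.id ℝ Plane + h • B x).det := key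
          _ ≤ |(ContinuousLinearMap.id ℝ Plane + h • B x).det| * E x 1 := by
            rw [mul_comm]; gcongr; exact le_abs_self _
    _ = ∫⁻ x in E '' s, ENNReal.ofReal (x 1) :=
        (lintegral_image_eq_lintegral_abs_det_fderiv_mul volume hs hderiv hinj
          fun y => ENNReal.ofReal (y 1)).symm
    _ = ringVolume (E '' s) := by rw [ringVolume, withDensity_apply']
    _ ≤ ringVolume (E '' A) := measure_mono (image_mono sdiff_subset)

/-- `P` is the Euler polygon of the fields `w k`. The discrete Gronwall recursion `e_{k+1} ≤ (1 +
Λ|h|) e_k + |h| e` compares it with `X k`, and the margin `ρ` keeps it inside `R`, so the Jacobian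
factors of the successive steps multiply. -/
lemma exists_discrete_flow {R : Set Plane} {Λ V a b h e ρ : ℝ} (hR : IsOpen R) (ha : 0 < a)
    (hRa : ∀ x ∈ R, a ≤ x 1) (hRb : ∀ x ∈ R, x 1 ≤ b) (hΛ : 0 ≤ Λ) (he : 0 ≤ e) (hh : |h| ≤ 1)
    (hhΛ : |h| * Λ < 1) (hhV : |h| * V ≤ a) {A : Set Plane} (hA : IsCompact A)
    {X w : ℕ → Plane → Plane} {N : ℕ} (hX : ContinuousOn (X 0) A)
    (hw : ∀ k < N, IsStepField R Λ V (w k))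
    (hstep : ∀ k < N, ∀ x ∈ A, ‖X (k + 1) x - X k x - h • w k (X k x)‖ ≤ |h| * e)
    (hρ : ∀ k ≤ N, ∀ x ∈ A, Metric.closedBall (X k x) ρ ⊆ R)
    (hN : N * |h| * e * (1 + Λ * |h|) ^ N ≤ ρ) :
    ∀ k ≤ N, ∃ P : Plane → Plane, ContinuousOn P A ∧
      (∀ x ∈ A, ‖P x - X k x‖ ≤ k * |h| * e * (1 + Λ * |h|) ^ k) ∧
      ENNReal.ofReal (1 - (2 * V * Λ + 2 * b * Λ ^ 2 + 2 * V * Λ ^ 2) / a * h ^ 2) ^ k *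
        ringVolume (X 0 '' A) ≤ ringVolume (P '' A) := by
  have h1 : 1 ≤ 1 + Λ * |h| := by nlinarith [mul_nonneg hΛ (abs_nonneg h)]
  have hbd : ∀ k ≤ N, (k : ℝ) * |h| * e * (1 + Λ * |h|) ^ k ≤ ρ := fun k hk =>
    le_trans (by gcongr) hN
  intro k
  induction k with
  | zero => exact fun _ => ⟨X 0, hX, by simp, by simp⟩
  | succ k ih =>
    intro hk
    obtain ⟨P, hPc, hPX, hPv⟩ := ih (by omega)
    have hkN : k < N := hk
    have hPR : ∀ x ∈ A, P x ∈ R := fun x hx => hρ k hkN.le x hx <| by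
      rw [mem_closedBall_iff_norm]; exact (hPX x hx).trans (hbd k hkN.le)
    have hXR : ∀ x ∈ A, X k x ∈ R := fun x hx => hρ k hkN.le x hx <|
      Metric.mem_closedBall_self <| (by positivity : (0:ℝ) ≤ N * |h| * e * (1 + Λ * |h|) ^ N).trans hN
    have hwc : ContinuousOn (w k) R := by
      have : LipschitzOnWith ⟨Λ, hΛ⟩ (w k) R := LipschitzOnWith.of_dist_le_mul fun x hx y hy => by
        rw [dist_eq_norm, dist_eq_norm]; exact (hw k hkN).lipschitz x hx y hy
      exact this.continuousOn
    refine ⟨fun x => P x + h • w k (P x), ?_, ?_, ?_⟩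
    · exact hPc.add ((hwc.comp hPc hPR).const_smul h)
    · intro x hx
      have e1 : P x + h • w k (P x) - X (k + 1) x =
          (P x - X k x) + h • (w k (P x) - w k (X k x)) -
            (X (k + 1) x - X k x - h • w k (X k x)) := by
        rw [smul_sub]; abel
      have e2 := hstep k hkN x hx
      have e3 := (hw k hkN).lipschitz _ (hPR x hx) _ (hXR x hx)
      have e4 := hPX x hx
      have e5 : (1 : ℝ) ≤ (1 + Λ * |h|) ^ (k + 1) := one_le_pow₀ h1
      calc ‖P x + h • w k (P x) - X (k + 1) x‖
          ≤ ‖P x - X k x‖ + |h| * ‖w k (P x) - w k (X k x)‖ +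
              ‖X (k + 1) x - X k x - h • w k (X k x)‖ := by
            rw [e1, ← Real.norm_eq_abs, ← norm_smul]
            exact (norm_sub_le _ _).trans (by gcongr; exact norm_add_le _ _)
        _ ≤ ‖P x - X k x‖ + |h| * (Λ * ‖P x - X k x‖) + |h| * e := by gcongr
        _ = (1 + Λ * |h|) * ‖P x - X k x‖ + |h| * e := by ring
        _ ≤ (1 + Λ * |h|) * (k * |h| * e * (1 + Λ * |h|) ^ k) +
              |h| * e * (1 + Λ * |h|) ^ (k + 1) := by
            gcongr ?_ * ?_ + ?_
            exact le_mul_of_one_le_right (by positivity) e5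
        _ = _ := by push_cast; ring
    · have hPm : MeasurableSet (P '' A) := (hA.image_of_continuousOn hPc).measurableSet
      have := (hw k hkN).ringVolume_image_ge hR ha hRa hRb hΛ hh hhΛ hhV hPm
        (image_subset_iff.2 hPR)
      rw [image_image] at this
      refine le_trans ?_ this
      rw [pow_succ', mul_assoc]
      gcongr

/-- A family of trajectories which is well approximated, on short time steps, by Lipschitz weighted
divergence free fields does not decrease the ring volume of a compact set. -/
lemma ringVolume_image_le_of_approx {R : Set Plane} {a b ρ p q : ℝ} (hR : IsOpen R) (ha : 0 < a)
    (hRa : ∀ x ∈ R, a ≤ x 1) (hRb : ∀ x ∈ R, x 1 ≤ b) (hρ : 0 < ρ) {A : Set Plane}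
    (hA : IsCompact A) {X : ℝ → Plane → Plane} (hXp : ContinuousOn (X p) A)
    (hXq : ContinuousOn (X q) A)
    (hXR : ∀ s ∈ uIcc p q, ∀ x ∈ A, Metric.closedBall (X s x) ρ ⊆ R)
    (happ : ∀ η > 0, ∃ Λ V e h₀ : ℝ, 0 ≤ Λ ∧ 0 ≤ V ∧ 0 ≤ e ∧ 0 < h₀ ∧
      |q - p| * e * Real.exp (Λ * |q - p|) ≤ η ∧
      ∀ s ∈ uIcc p q, ∀ s' ∈ uIcc p q, |s' - s| ≤ h₀ → ∃ w, IsStepField R Λ V w ∧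
        ∀ x ∈ A, ‖X s' x - X s x - (s' - s) • w (X s x)‖ ≤ |s' - s| * e) :
    ringVolume (X p '' A) ≤ ringVolume (X q '' A) := by
  -- The polygons end within `η` of the true image, so only its thickening is controlled. The number
  -- of steps tends to infinity with `η` fixed, and `η → 0` comes last, using compactness of the
  -- image.
  have main : ∀ η ∈ Ioc 0 ρ,
      ringVolume (X p '' A) ≤ ringVolume (Metric.cthickening η (X q '' A)) := by
    rintro η ⟨hη, hηρ⟩
    obtain ⟨Λ, V, e, h₀, hΛ, hV, he, hh₀, hsmall, hst⟩ := happ η hη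
    set C := (2 * V * Λ + 2 * b * Λ ^ 2 + 2 * V * Λ ^ 2) / a
    set D := |q - p|
    have hlim : Tendsto (fun n : ℕ => D / (n : ℝ)) atTop (𝓝 0) :=
      tendsto_const_div_atTop_nhds_zero_nat D
    -- By Bernoulli's inequality, `n` steps of length `D / n` lose at most the relative volume `C D²
    -- / n`, which tends to `0`.
    have ev : ∀ᶠ n : ℕ in atTop,
        ENNReal.ofReal (1 + n * (-(C * (D / n) ^ 2))) * ringVolume (X p '' A) ≤
          ringVolume (Metric.cthickening η (X q '' A)) := by
      have hev : ∀ c : ℝ, 0 < c → ∀ᶠ n : ℕ in atTop, D / (n : ℝ) < c := fun c hc =>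
        hlim.eventually_lt_const hc
      have evC : ∀ᶠ n : ℕ in atTop, C * (D / (n : ℝ)) ^ 2 < 1 :=
        ((hlim.pow 2).const_mul C).eventually_lt_const (by simp)
      have evΛ : ∀ᶠ n : ℕ in atTop, D / (n : ℝ) * Λ < 1 :=
        (hlim.mul_const Λ).eventually_lt_const (by simp)
      have evV : ∀ᶠ n : ℕ in atTop, D / (n : ℝ) * V < a :=
        (hlim.mul_const V).eventually_lt_const (by simpa using ha)
      filter_upwards [hev 1 one_pos, hev h₀ hh₀, evC, evΛ, evV, eventually_gt_atTop 0] with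
        n h1 h2 h3 h4 h5 hn
      have hn0 : (0 : ℝ) < n := by exact_mod_cast hn
      set h := (q - p) / n
      have habs : |h| = D / n := by rw [abs_div, Nat.abs_cast]
      have hnh : (n : ℝ) * |h| = D := by rw [habs]; field_simp
      set tt : ℕ → ℝ := fun k => p + k * h
      have ht0 : tt 0 = p := by simp [tt]
      have htn : tt n = q := by simp only [tt, h]; field_simp; ring
      have htt : ∀ k ≤ n, tt k ∈ uIcc p q := by
        intro k hk
        have hseg : tt k = p + ((k : ℝ) / n) * (q - p) := by simp only [tt, h]; ring
        rw [← segment_eq_uIcc, segment_eq_image']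
        refine ⟨(k : ℝ) / n, ⟨by positivity, ?_⟩, hseg.symm⟩
        rw [div_le_one hn0]; exact_mod_cast hk
      have hdiff : ∀ k, tt (k + 1) - tt k = h := fun k => by simp only [tt]; push_cast; ring
      have hex : ∀ k < n, ∃ w, IsStepField R Λ V w ∧
          ∀ x ∈ A, ‖X (tt (k + 1)) x - X (tt k) x - h • w (X (tt k) x)‖ ≤ |h| * e := by
        intro k hk
        have := hst _ (htt k hk.le) _ (htt (k + 1) hk) (by rw [hdiff, habs]; exact h2.le)
        rwa [hdiff] at this
      choose! w hw hstep using hex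
      have hexp : (n : ℝ) * |h| * e * (1 + Λ * |h|) ^ n ≤ η := by
        refine le_trans ?_ hsmall
        rw [hnh]
        gcongr
        calc (1 + Λ * |h|) ^ n ≤ Real.exp (Λ * |h|) ^ n := by
              gcongr; rw [add_comm]; exact Real.add_one_le_exp _
          _ = Real.exp (Λ * D) := by rw [← Real.exp_nat_mul, ← hnh]; ring_nf
      obtain ⟨P, -, hPX, hPv⟩ := exists_discrete_flow (X := fun k => X (tt k)) hR ha hRa hRb hΛ he
        (habs ▸ h1.le) (habs ▸ h4) (habs ▸ h5.le) hA (by simpa only [ht0] using hXp) hw hstep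
        (fun k hk => hXR _ (htt k hk)) (hexp.trans hηρ) n le_rfl
      simp only [ht0, htn] at hPX hPv
      have hsq : h ^ 2 = (D / n) ^ 2 := by rw [← sq_abs, habs]
      rw [hsq] at hPv
      calc ENNReal.ofReal (1 + n * (-(C * (D / n) ^ 2))) * ringVolume (X p '' A)
          ≤ ENNReal.ofReal (1 - C * (D / n) ^ 2) ^ n * ringVolume (X p '' A) := by
            gcongr
            rw [← ENNReal.ofReal_pow (by linarith)]
            refine ENNReal.ofReal_le_ofReal ?_
            rw [sub_eq_add_neg]
            exact one_add_mul_le_pow (by linarith) n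
        _ ≤ ringVolume (P '' A) := hPv
        _ ≤ _ := by
            refine measure_mono ?_
            rintro _ ⟨x, hx, rfl⟩
            refine Metric.mem_cthickening_of_dist_le _ (X q x) _ _ (mem_image_of_mem _ hx) ?_
            rw [dist_eq_norm]
            exact (hPX x hx).trans hexp
    have hl : Tendsto (fun n : ℕ => ENNReal.ofReal (1 + n * (-(C * (D / n) ^ 2))) *
        ringVolume (X p '' A)) atTop (𝓝 (ENNReal.ofReal 1 * ringVolume (X p '' A))) := by
      refine ENNReal.Tendsto.mul_const (ENNReal.tendsto_ofReal ?_) (Or.inl (by simp))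
      have h0 : Tendsto (fun n : ℕ => 1 + -(C * D ^ 2) / (n : ℝ)) atTop (𝓝 (1 + 0)) :=
        (tendsto_const_div_atTop_nhds_zero_nat _).const_add 1
      rw [add_zero] at h0
      refine h0.congr' ?_
      filter_upwards [eventually_gt_atTop 0] with n hn
      have hn0 : (0 : ℝ) < n := by exact_mod_cast hn
      field_simp
    simpa using le_of_tendsto hl ev
  have hlim := tendsto_measure_cthickening_of_isCompact (μ := ringVolume)
    (hA.image_of_continuousOn hXq)
  refine ge_of_tendsto (hlim.mono_left (nhdsWithin_le_nhds (s := Ioi 0))) ?_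
  filter_upwards [Ioc_mem_nhdsGT hρ] with η hη using main η hη

/-! ### Pointwise bounds for the regularised Biot–Savart kernel -/

/-- The bounded open region `{x : a < x₂, |x| < b}`. -/
def box (a b : ℝ) : Set Plane := {x | a < x 1} ∩ Metric.ball 0 b

lemma isOpen_box (a b : ℝ) : IsOpen (box a b) :=
  (isOpen_lt continuous_const (continuous_coord 1)).inter Metric.isOpen_ball

lemma convex_box (a b : ℝ) : Convex ℝ (box a b) :=
  (convex_halfSpace_gt (f := fun x : Plane => x 1) ⟨fun _ _ => rfl, fun _ _ => rfl⟩ a).inter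
    (convex_ball 0 b)

lemma norm_lt_of_mem_box {a b : ℝ} {x : Plane} (hx : x ∈ box a b) : ‖x‖ < b :=
  mem_ball_zero_iff.1 hx.2

lemma coord_lt_of_mem_box {a b : ℝ} {x : Plane} (hx : x ∈ box a b) : x 1 < b :=
  (le_abs_self _).trans_lt ((abs_coord_le x 1).trans_lt (norm_lt_of_mem_box hx))

/-- Numerators of the two components of the Biot–Savart kernel. -/
def num (i : Fin 2) (x y : Plane) (θ : ℝ) : ℝ :=
  ![y 1 * (y 1 - x 1 * Real.cos θ), y 1 * (x 0 - y 0) * Real.cos θ] i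

/-- The regularised distance whose cube is the denominator of the regularised kernel. -/
def den (δ : ℝ) (x y : Plane) (θ : ℝ) : ℝ := √(bracket x y θ + δ ^ 2)

/-- Integrand of the regularised Biot–Savart kernel. -/
def kern (i : Fin 2) (δ : ℝ) (x y : Plane) (θ : ℝ) : ℝ := num i x y θ / den δ x y θ ^ 3

/-- Derivative in `x` of the numerators. -/
def numD (i : Fin 2) (y : Plane) (θ : ℝ) : Plane →L[ℝ] ℝ :=
  ![(-(y 1 * Real.cos θ)) • EuclideanSpace.proj (𝕜 := ℝ) (1 : Fin 2),
    (y 1 * Real.cos θ) • EuclideanSpace.proj (𝕜 := ℝ) (0 : Fin 2)] i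

/-- Derivative in `x` of the bracket. -/
def bracketD (x y : Plane) (θ : ℝ) : Plane →L[ℝ] ℝ :=
  (2 : ℝ) • innerSL ℝ (x - y) +
    (2 * y 1 * (1 - Real.cos θ)) • EuclideanSpace.proj (𝕜 := ℝ) (1 : Fin 2)

/-- Derivative in `x` of the regularised kernel. -/
def kernD (i : Fin 2) (δ : ℝ) (x y : Plane) (θ : ℝ) : Plane →L[ℝ] ℝ :=
  (den δ x y θ ^ 3)⁻¹ • numD i y θ -
    (3 / 2 * num i x y θ / den δ x y θ ^ 5) • bracketD x y θ

lemma norm_proj_le (i : Fin 2) : ‖(EuclideanSpace.proj i : Plane →L[ℝ] ℝ)‖ ≤ 1 :=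
  ContinuousLinearMap.opNorm_le_bound _ zero_le_one fun x => by
    rw [one_mul]; exact abs_coord_le x i

lemma bracket_nonneg {x y : Plane} (hx : 0 ≤ x 1) (hy : 0 ≤ y 1) (θ : ℝ) : 0 ≤ bracket x y θ := by
  have := sub_nonneg.2 (Real.cos_le_one θ)
  unfold bracket; positivity

section Bounds

variable {a b δ θ : ℝ} {x y : Plane}

lemma two_mul_sq_mul_le_bracket (ha : 0 < a) (hx : x ∈ box a b) (hy : y ∈ box a b) (θ : ℝ) :
    ‖x - y‖ ^ 2 + 2 * a ^ 2 * (1 - Real.cos θ) ≤ bracket x y θ := by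
  have h1 := sub_nonneg.2 (Real.cos_le_one θ)
  have hx1 : a < x 1 := hx.1
  have hy1 : a < y 1 := hy.1
  have h2 : a * a ≤ x 1 * y 1 := mul_le_mul hx1.le hy1.le ha.le (ha.trans hx1).le
  unfold bracket
  nlinarith [mul_le_mul_of_nonneg_right h2 h1]

lemma bracket_pos_of_sq_add (ha : 0 < a) (hδ : 0 < δ) (hx : x ∈ box a b) (hy : y ∈ box a b) :
    0 < bracket x y θ + δ ^ 2 := by
  have := bracket_nonneg (ha.le.trans (le_of_lt hx.1)) (ha.le.trans (le_of_lt hy.1)) θ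
  positivity

lemma norm_sub_le_den (ha : 0 < a) (hx : x ∈ box a b) (hy : y ∈ box a b) :
    ‖x - y‖ ≤ den δ x y θ := by
  refine Real.le_sqrt_of_sq_le ?_
  have := two_mul_sq_mul_le_bracket ha hx hy θ
  have h1 := sub_nonneg.2 (Real.cos_le_one θ)
  nlinarith [sq_nonneg δ, mul_nonneg (sq_nonneg a) h1]

lemma le_den (ha : 0 < a) (hx : x ∈ box a b) (hy : y ∈ box a b) :
    δ ≤ den δ x y θ := by
  refine Real.le_sqrt_of_sq_le ?_
  have := bracket_nonneg (ha.le.trans (le_of_lt hx.1)) (ha.le.trans (le_of_lt hy.1)) θ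
  linarith

/-- Since `1 - cos θ ≤ 2`, its square is at most `2 (1 - cos θ)`, which the bracket controls. -/
lemma one_sub_cos_le (ha : 0 < a) (hx : x ∈ box a b) (hy : y ∈ box a b) :
    a * (1 - Real.cos θ) ≤ den δ x y θ := by
  refine Real.le_sqrt_of_sq_le ?_
  have h0 := two_mul_sq_mul_le_bracket ha hx hy θ
  have h1 := sub_nonneg.2 (Real.cos_le_one θ)
  have h2 : 1 - Real.cos θ ≤ 2 := by linarith [Real.neg_one_le_cos θ]
  nlinarith [sq_nonneg δ, sq_nonneg ‖x - y‖,
    mul_nonneg (sq_nonneg a) (mul_nonneg h1 (sub_nonneg.2 h2))]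

lemma angle_le_den (ha : 0 < a) (hx : x ∈ box a b) (hy : y ∈ box a b) (hθ : |θ| ≤ Real.pi) :
    2 * a / Real.pi * |θ| ≤ den δ x y θ := by
  refine Real.le_sqrt_of_sq_le ?_
  have h0 := two_mul_sq_mul_le_bracket ha hx hy θ
  have h2 : Real.cos θ ≤ 1 - 2 / Real.pi ^ 2 * θ ^ 2 := Real.cos_le_one_sub_mul_cos_sq hθ
  have h3 : (2 * a / Real.pi * |θ|) ^ 2 = 2 * a ^ 2 * (2 / Real.pi ^ 2 * θ ^ 2) := by
    rw [mul_pow, sq_abs]; ring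
  rw [h3]
  nlinarith [sq_nonneg δ, sq_nonneg ‖x - y‖, mul_le_mul_of_nonneg_left
    (le_sub_comm.1 h2) (by positivity : (0:ℝ) ≤ 2 * a ^ 2)]

/-- The constant of comparison between the denominators and the distance in the variables
`(y, θ)`. -/
def lowerConst (a : ℝ) : ℝ := min 1 (2 * a / Real.pi)

lemma lowerConst_pos (ha : 0 < a) : 0 < lowerConst a :=
  lt_min one_pos (by have := Real.pi_pos; positivity)

/-- In the three variables `(y, θ)` the denominator dominates the distance to the singular point
`(x, 0)`. Kernel integrals thus reduce to radial integrals in dimension three. -/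
lemma lowerConst_mul_norm_le (ha : 0 < a) (hx : x ∈ box a b) (hy : y ∈ box a b)
    (hθ : |θ| ≤ Real.pi) : lowerConst a * ‖(y, θ) - (x, 0)‖ ≤ den δ x y θ := by
  have hc := lowerConst_pos ha
  rw [Prod.mk_sub_mk, sub_zero, Prod.norm_mk, mul_max_of_nonneg _ _ hc.le]
  refine max_le ?_ ?_
  · rw [norm_sub_rev]
    exact (mul_le_of_le_one_left (norm_nonneg _) (min_le_left _ _)).trans
      (norm_sub_le_den ha hx hy)
  · exact (mul_le_mul_of_nonneg_right (min_le_right _ _) (norm_nonneg _)).trans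
      (angle_le_den ha hx hy hθ)

/-- The numerators vanish to first order at the singularity, because `y₂ - x₂ cos θ = (y₂ - x₂) + x₂
(1 - cos θ)`. Hence the kernel has size `den⁻²`, and its gradient `den⁻³`. -/
lemma abs_num_le (ha : 0 < a) (hx : x ∈ box a b) (hy : y ∈ box a b) (i : Fin 2) :
    |num i x y θ| ≤ b * (1 + b / a) * den δ x y θ := by
  have hb : 0 < b := (norm_nonneg x).trans_lt (norm_lt_of_mem_box hx)
  have hx0 : 0 ≤ x 1 := ha.le.trans (le_of_lt hx.1)
  have hy0 : 0 ≤ y 1 := ha.le.trans (le_of_lt hy.1)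
  have hd := norm_sub_le_den (δ := δ) (θ := θ) ha hx hy
  have hs := one_sub_cos_le (δ := δ) (θ := θ) ha hx hy
  have hxb := (coord_lt_of_mem_box hx).le
  have hyb := (coord_lt_of_mem_box hy).le
  have hc0 := sub_nonneg.2 (Real.cos_le_one θ)
  have hba : 0 ≤ b / a := by positivity
  have hden : 0 ≤ den δ x y θ := Real.sqrt_nonneg _
  fin_cases i
  · have e : num 0 x y θ = y 1 * (y 1 - x 1 * Real.cos θ) := rfl
    have h1 : |y 1 - x 1 * Real.cos θ| ≤ den δ x y θ + b / a * den δ x y θ := by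
      have : y 1 - x 1 * Real.cos θ = -((x - y) 1) + x 1 * (1 - Real.cos θ) := by
        simp; ring
      rw [this]
      refine (abs_add_le _ _).trans (add_le_add ?_ ?_)
      · rw [abs_neg]; exact (abs_coord_le _ 1).trans hd
      · rw [abs_of_nonneg (mul_nonneg hx0 hc0)]
        calc x 1 * (1 - Real.cos θ) ≤ b * (1 - Real.cos θ) := by gcongr
          _ = b / a * (a * (1 - Real.cos θ)) := by field_simp
          _ ≤ _ := by gcongr
    show |num 0 x y θ| ≤ _
    rw [e, abs_mul, abs_of_nonneg hy0]
    calc y 1 * |y 1 - x 1 * Real.cos θ| ≤ b * (den δ x y θ + b / a * den δ x y θ) := by gcongr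
      _ = _ := by ring
  · have e : num 1 x y θ = y 1 * (x - y) 0 * Real.cos θ := rfl
    show |num 1 x y θ| ≤ _
    rw [e, abs_mul, abs_mul, abs_of_nonneg hy0]
    have h1 : |(x - y) 0| ≤ den δ x y θ := (abs_coord_le _ 0).trans hd
    calc y 1 * |(x - y) 0| * |Real.cos θ| ≤ b * den δ x y θ * 1 := by
          gcongr; exact Real.abs_cos_le_one θ
      _ ≤ _ := by nlinarith [mul_nonneg (mul_nonneg hb.le hba) hden]

lemma norm_numD_le (ha : 0 < a) (hy : y ∈ box a b) (i : Fin 2) : ‖numD i y θ‖ ≤ b := by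
  have hy0 : 0 ≤ y 1 := ha.le.trans (le_of_lt hy.1)
  have h : |y 1 * Real.cos θ| ≤ b := by
    rw [abs_mul, abs_of_nonneg hy0]
    exact (mul_le_of_le_one_right hy0 (Real.abs_cos_le_one θ)).trans (coord_lt_of_mem_box hy).le
  have hb : 0 ≤ b := (abs_nonneg _).trans h
  fin_cases i
  · show ‖(-(y 1 * Real.cos θ)) • (EuclideanSpace.proj (1 : Fin 2) : Plane →L[ℝ] ℝ)‖ ≤ b
    rw [norm_smul, norm_neg, Real.norm_eq_abs]
    exact (mul_le_mul h (norm_proj_le 1) (norm_nonneg _) hb).trans (mul_one b).le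
  · show ‖(y 1 * Real.cos θ) • (EuclideanSpace.proj (0 : Fin 2) : Plane →L[ℝ] ℝ)‖ ≤ b
    rw [norm_smul, Real.norm_eq_abs]
    exact (mul_le_mul h (norm_proj_le 0) (norm_nonneg _) hb).trans (mul_one b).le

lemma norm_bracketD_le (ha : 0 < a) (hx : x ∈ box a b) (hy : y ∈ box a b) :
    ‖bracketD x y θ‖ ≤ 2 * (1 + b / a) * den δ x y θ := by
  have hb : 0 < b := (norm_nonneg x).trans_lt (norm_lt_of_mem_box hx)
  have hy0 : 0 ≤ y 1 := ha.le.trans (le_of_lt hy.1)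
  have hc0 := sub_nonneg.2 (Real.cos_le_one θ)
  have hd := norm_sub_le_den (δ := δ) (θ := θ) ha hx hy
  have hs := one_sub_cos_le (δ := δ) (θ := θ) ha hx hy
  calc ‖bracketD x y θ‖ ≤ ‖(2 : ℝ) • innerSL ℝ (x - y)‖ + ‖(2 * y 1 * (1 - Real.cos θ)) •
        (EuclideanSpace.proj (1 : Fin 2) : Plane →L[ℝ] ℝ)‖ := norm_add_le _ _
    _ ≤ 2 * ‖x - y‖ + 2 * y 1 * (1 - Real.cos θ) * 1 := by
        rw [norm_smul, norm_smul, innerSL_apply_norm, Real.norm_eq_abs, Real.norm_eq_abs,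
          abs_of_nonneg (by positivity : 0 ≤ 2 * y 1 * (1 - Real.cos θ)), abs_two]
        gcongr
        exact norm_proj_le 1
    _ ≤ 2 * den δ x y θ + 2 * (b / a * (a * (1 - Real.cos θ))) := by
        have : 2 * y 1 * (1 - Real.cos θ) * 1 ≤ 2 * (b / a * (a * (1 - Real.cos θ))) := by
          have e : b / a * (a * (1 - Real.cos θ)) = b * (1 - Real.cos θ) := by field_simp
          rw [e]; nlinarith [coord_lt_of_mem_box hy]
        gcongr
    _ ≤ 2 * den δ x y θ + 2 * (b / a * den δ x y θ) := by gcongr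
    _ = _ := by ring

lemma hasFDerivAt_num (i : Fin 2) (x y : Plane) (θ : ℝ) :
    HasFDerivAt (fun x => num i x y θ) (numD i y θ) x := by
  have hp : ∀ j : Fin 2, HasFDerivAt (fun x : Plane => x j) (EuclideanSpace.proj (𝕜 := ℝ) j) x :=
    fun j => (EuclideanSpace.proj (𝕜 := ℝ) j : Plane →L[ℝ] ℝ).hasFDerivAt
  fin_cases i
  · have := ((hp 1).mul_const (Real.cos θ)).const_sub (y 1) |>.const_mul (y 1)
    refine this.congr_fderiv ?_
    ext v; simp [numD]; ring
  · have := ((hp 0).sub_const (y 0)).const_mul (y 1) |>.mul_const (Real.cos θ)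
    refine this.congr_fderiv ?_
    ext v; simp [numD]; ring

lemma hasFDerivAt_bracket (x y : Plane) (θ : ℝ) :
    HasFDerivAt (fun x => bracket x y θ) (bracketD x y θ) x := by
  have hp : HasFDerivAt (fun x : Plane => x 1) (EuclideanSpace.proj (𝕜 := ℝ) (1 : Fin 2)) x :=
    (EuclideanSpace.proj (𝕜 := ℝ) (1 : Fin 2) : Plane →L[ℝ] ℝ).hasFDerivAt
  have h1 := ((hasFDerivAt_id x).sub_const y).norm_sq
  have := h1.add (((hp.const_mul 2).mul_const (y 1)).mul_const (1 - Real.cos θ))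
  refine this.congr_fderiv ?_
  ext v; simp [bracketD]; ring

lemma hasFDerivAt_kern (i : Fin 2) (h : 0 < bracket x y θ + δ ^ 2) :
    HasFDerivAt (fun x => kern i δ x y θ) (kernD i δ x y θ) x := by
  have hd : 0 < den δ x y θ := Real.sqrt_pos.2 h
  have h1 : HasFDerivAt (fun x => den δ x y θ) _ x :=
    ((hasFDerivAt_bracket x y θ).add_const (δ ^ 2)).sqrt h.ne'
  have h2 := (hasFDerivAt_num i x y θ).mul
    ((hasDerivAt_inv (pow_pos hd 3).ne').comp_hasFDerivAt x (h1.pow 3))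
  refine h2.congr_fderiv ?_
  ext v
  have e : √(bracket x y θ + δ ^ 2) = den δ x y θ := rfl
  simp [kernD, e]
  field_simp
  ring

lemma norm_kernD_le (ha : 0 < a) (hδ : 0 < δ) (hx : x ∈ box a b) (hy : y ∈ box a b) (i : Fin 2) :
    ‖kernD i δ x y θ‖ ≤ (b + 3 * (b * (1 + b / a) * (1 + b / a))) / den δ x y θ ^ 3 := by
  have hb : 0 < b := (norm_nonneg x).trans_lt (norm_lt_of_mem_box hx)
  have hd : 0 < den δ x y θ := Real.sqrt_pos.2 (bracket_pos_of_sq_add ha hδ hx hy)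
  have h1 := abs_num_le (δ := δ) (θ := θ) ha hx hy i
  have h2 := norm_bracketD_le (δ := δ) (θ := θ) ha hx hy
  have h3 := norm_numD_le (θ := θ) ha hy i
  set d := den δ x y θ
  calc ‖kernD i δ x y θ‖ ≤ ‖(d ^ 3)⁻¹ • numD i y θ‖ +
        ‖(3 / 2 * num i x y θ / d ^ 5) • bracketD x y θ‖ := norm_sub_le _ _
    _ = (d ^ 3)⁻¹ * ‖numD i y θ‖ + 3 / 2 * |num i x y θ| / d ^ 5 * ‖bracketD x y θ‖ := by
        rw [norm_smul, norm_smul, Real.norm_eq_abs, Real.norm_eq_abs, abs_inv, abs_div, abs_mul,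
          abs_of_pos (pow_pos hd 3), abs_of_pos (pow_pos hd 5)]
        norm_num
    _ ≤ (d ^ 3)⁻¹ * b + 3 / 2 * (b * (1 + b / a) * d) / d ^ 5 * (2 * (1 + b / a) * d) := by
        gcongr
    _ = _ := by field_simp

lemma abs_kern_zero_le (ha : 0 < a) (hx : x ∈ box a b) (hy : y ∈ box a b) (i : Fin 2) :
    |kern i 0 x y θ| ≤ b * (1 + b / a) / den 0 x y θ ^ 2 := by
  have hd : 0 ≤ den 0 x y θ := Real.sqrt_nonneg _
  rcases hd.eq_or_lt with h | h
  -- At a zero of the denominator both sides are `0` by the convention on division.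
  · simp [kern, ← h]
  · rw [kern, abs_div, abs_of_pos (pow_pos h 3), div_le_div_iff₀ (by positivity) (by positivity)]
    have := abs_num_le (δ := 0) (θ := θ) ha hx hy i
    calc _ ≤ b * (1 + b / a) * den 0 x y θ * den 0 x y θ ^ 2 := by gcongr
      _ = _ := by ring

/-- With `d` and `e` the two denominators, `e - d` is at most both `δ` and `e`, hence at most `√δ
√e`. Taking only half a power of `δ` leaves the singularity `den^(-5/2)`, which is integrable in
dimension three, whereas a full power would leave `den⁻³`. -/
lemma abs_kern_sub_le (ha : 0 < a) (hδ : 0 < δ) (hx : x ∈ box a b) (hy : y ∈ box a b)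
    (i : Fin 2) (hpos : 0 < den 0 x y θ) :
    |kern i 0 x y θ - kern i δ x y θ| ≤
      3 * (b * (1 + b / a)) * √δ * (den 0 x y θ) ^ (-(5 / 2) : ℝ) := by
  have hb : 0 < b := (norm_nonneg x).trans_lt (norm_lt_of_mem_box hx)
  have hn := abs_num_le (δ := 0) (θ := θ) ha hx hy i
  set d := den 0 x y θ with hd
  set e := den δ x y θ with he
  have hbr := bracket_nonneg (ha.le.trans (le_of_lt hx.1)) (ha.le.trans (le_of_lt hy.1)) θ
  have hd2 : d ^ 2 = bracket x y θ := by
    rw [hd, den, Real.sq_sqrt (by positivity)]; ring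
  have he2 : e ^ 2 = bracket x y θ + δ ^ 2 := by rw [he, den, Real.sq_sqrt (by positivity)]
  have he0 : 0 ≤ e := Real.sqrt_nonneg _
  have hde : d ≤ e := by nlinarith [sq_nonneg δ]
  have hed : e ≤ d + δ := by nlinarith
  have hepos : 0 < e := hpos.trans_le hde
  have hsub : e - d ≤ √δ * √e := by
    rw [← Real.sqrt_mul hδ.le]
    refine Real.le_sqrt_of_sq_le ?_
    nlinarith
  have key : 1 / d ^ 3 - 1 / e ^ 3 ≤ 3 * √δ / (d ^ 3 * √d) := by
    have h1 : 1 / d ^ 3 - 1 / e ^ 3 = (e - d) * (e ^ 2 + e * d + d ^ 2) / (d ^ 3 * e ^ 3) := by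
      field_simp; ring
    have hse : √e * √e = e := Real.mul_self_sqrt he0
    have hsep : 0 < √e := Real.sqrt_pos.2 hepos
    have hsd : 0 < √d := Real.sqrt_pos.2 hpos
    have hsde : √d ≤ √e := Real.sqrt_le_sqrt hde
    have h2 : e ^ 2 + e * d + d ^ 2 ≤ 3 * e ^ 2 := by nlinarith
    calc 1 / d ^ 3 - 1 / e ^ 3 = (e - d) * (e ^ 2 + e * d + d ^ 2) / (d ^ 3 * e ^ 3) := h1
      _ ≤ (√δ * √e) * (3 * e ^ 2) / (d ^ 3 * e ^ 3) := by gcongr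
      _ = 3 * √δ / (d ^ 3 * √e) := by
          rw [div_eq_div_iff (by positivity) (by positivity)]
          linear_combination (3 * √δ * e ^ 2 * d ^ 3) * hse
      _ ≤ 3 * √δ / (d ^ 3 * √d) := by gcongr
  have key0 : 0 ≤ 1 / d ^ 3 - 1 / e ^ 3 := by
    rw [sub_nonneg]; gcongr
  have hrp : d ^ (-(5 / 2) : ℝ) = d / (d ^ 3 * √d) := by
    have hsd : 0 < √d := Real.sqrt_pos.2 hpos
    rw [Real.rpow_neg hpos.le, show (5 / 2 : ℝ) = 2 + 1 / 2 by norm_num, Real.rpow_add hpos,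
      ← Real.sqrt_eq_rpow]
    norm_cast
    field_simp
  have h1 : kern i 0 x y θ - kern i δ x y θ = num i x y θ * (1 / d ^ 3 - 1 / e ^ 3) := by
    simp only [kern, ← hd, ← he]; ring
  rw [h1, abs_mul, abs_of_nonneg key0]
  calc |num i x y θ| * (1 / d ^ 3 - 1 / e ^ 3)
      ≤ b * (1 + b / a) * d * (3 * √δ / (d ^ 3 * √d)) := by gcongr
    _ = _ := by rw [hrp]; ring

end Bounds

/-! ### Radial integrals in the three variables `(y, θ)` -/

/-- The measure `dy dθ` on the plane times `(0, π]`. -/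
def angleMeasure : Measure (Plane × ℝ) :=
  (volume : Measure Plane).prod (volume.restrict (Ioc 0 Real.pi))

lemma angleMeasure_le : angleMeasure ≤ (volume : Measure (Plane × ℝ)) := by
  rw [angleMeasure, Measure.volume_eq_prod]
  exact Measure.prod_mono le_rfl Measure.restrict_le_self

lemma angleMeasure_eq :
    angleMeasure = (volume : Measure (Plane × ℝ)).restrict (univ ×ˢ Ioc 0 Real.pi) := by
  rw [angleMeasure, Measure.volume_eq_prod, ← Measure.prod_restrict, Measure.restrict_univ]

lemma ae_angleMeasure : ∀ᵐ z ∂angleMeasure, z.2 ∈ Ioc 0 Real.pi := by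
  rw [angleMeasure_eq]
  filter_upwards [ae_restrict_mem (MeasurableSet.univ.prod measurableSet_Ioc)] with z hz using hz.2

instance : (volume : Measure (Plane × ℝ)).IsAddHaarMeasure := by
  rw [Measure.volume_eq_prod]; infer_instance

lemma finrank_plane_prod : Module.finrank ℝ (Plane × ℝ) = 3 := by simp

/-- Domination by a radial function around `(x, 0)`. -/
lemma norm_integral_le_of_radial {E : Type*} [NormedAddCommGroup E] [NormedSpace ℝ E]
    {K : Plane × ℝ → E} {G : ℝ → ℝ} {r : ℝ} (x : Plane) (hG0 : ∀ t, 0 ≤ t → 0 ≤ G t)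
    (hG : IntegrableOn (fun z : Plane × ℝ => G ‖z‖) (Metric.ball 0 r))
    (hK : AEStronglyMeasurable K angleMeasure)
    (hKG : ∀ᵐ z ∂angleMeasure, z - (x, 0) ∈ Metric.ball 0 r ∧ ‖K z‖ ≤ G ‖z - (x, 0)‖ ∨ K z = 0) :
    Integrable K angleMeasure ∧ ‖∫ z, K z ∂angleMeasure‖ ≤
      ∫ z in Metric.ball (0 : Plane × ℝ) r, G ‖z‖ := by
  set Φ : Plane × ℝ → ℝ := (Metric.ball 0 r).indicator fun z => G ‖z‖
  have hΦ : Integrable Φ := (integrable_indicator_iff Metric.isOpen_ball.measurableSet).2 hG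
  have hΦ0 : ∀ z, 0 ≤ Φ z := fun z => indicator_nonneg (fun _ _ => hG0 _ (norm_nonneg _)) z
  have hΦx : Integrable (fun z : Plane × ℝ => Φ (z - (x, 0))) := hΦ.comp_sub_right _
  have hΦa : Integrable (fun z : Plane × ℝ => Φ (z - (x, 0))) angleMeasure :=
    hΦx.mono_measure angleMeasure_le
  have hb : ∀ᵐ z ∂angleMeasure, ‖K z‖ ≤ Φ (z - (x, 0)) := by
    filter_upwards [hKG] with z hz
    rcases hz with ⟨h1, h2⟩ | h
    · simpa only [Φ, indicator_of_mem h1] using h2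
    · rw [h, norm_zero]; exact hΦ0 _
  refine ⟨hΦa.mono' hK hb, (norm_integral_le_of_norm_le hΦa hb).trans ?_⟩
  calc ∫ z, Φ (z - (x, 0)) ∂angleMeasure ≤ ∫ z : Plane × ℝ, Φ (z - (x, 0)) :=
        integral_mono_measure angleMeasure_le (Eventually.of_forall fun z => hΦ0 _) hΦx
    _ = ∫ z, Φ z := integral_sub_right_eq_self Φ _
    _ = _ := integral_indicator Metric.isOpen_ball.measurableSet

lemma integrableOn_norm_rpow (r : ℝ) :
    IntegrableOn (fun z : Plane × ℝ => ‖z‖ ^ (-(5 / 2) : ℝ)) (Metric.ball 0 r) := by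
  rw [integrableOn_fun_norm_addHaar (μ := volume) (f := fun t : ℝ => t ^ (-(5 / 2) : ℝ)),
    finrank_plane_prod]
  have h : IntegrableOn (fun t : ℝ => t ^ (-(1 / 2) : ℝ)) (Ioo 0 r) := by
    rcases le_total r 0 with hr | hr
    · simp [Ioo_eq_empty_of_le hr]
    · have := (intervalIntegral.intervalIntegrable_rpow' (a := 0) (b := r) (r := -(1/2))
        (by norm_num)).1
      exact this.mono_set Ioo_subset_Ioc_self
  refine h.congr_fun (fun t ht => ?_) measurableSet_Ioo
  have ht0 : 0 < t := ht.1
  show t ^ (-(1 / 2) : ℝ) = t ^ (3 - 1) * t ^ (-(5 / 2) : ℝ)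
  rw [← Real.rpow_natCast, ← Real.rpow_add ht0]
  norm_num

/-- The volume of the unit ball of the sup norm of the plane times the line. -/
def ballVolume : ℝ := (volume : Measure (Plane × ℝ)).real (Metric.ball 0 1)

/-- In polar coordinates the integrand is `t² / (t + δ)³ ≤ 1 / (t + δ)`, and `3 * ballVolume` is the
polar factor of dimension three. This logarithm is the one in the Lipschitz constant of the
regularised velocity. -/
lemma integral_cube_le {r δ : ℝ} (hr : 0 < r) (hδ : 0 < δ) :
    IntegrableOn (fun z : Plane × ℝ => 1 / (‖z‖ + δ) ^ 3) (Metric.ball 0 r) ∧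
    ∫ z in Metric.ball (0 : Plane × ℝ) r, 1 / (‖z‖ + δ) ^ 3 ≤
      3 * ballVolume * Real.log ((r + δ) / δ) := by
  have hcont : Continuous fun z : Plane × ℝ => 1 / (‖z‖ + δ) ^ 3 := by
    refine continuous_const.div (by fun_prop) fun z => ?_
    positivity
  have hint : IntegrableOn (fun z : Plane × ℝ => 1 / (‖z‖ + δ) ^ 3) (Metric.ball 0 r) :=
    (hcont.continuousOn.integrableOn_compact (isCompact_closedBall 0 r)).mono_set
      Metric.ball_subset_closedBall
  refine ⟨hint, ?_⟩
  have e1 : ∫ z in Metric.ball (0 : Plane × ℝ) r, 1 / (‖z‖ + δ) ^ 3 =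
      ∫ z : Plane × ℝ, (Iio r).indicator (fun t : ℝ => 1 / (t + δ) ^ 3) ‖z‖ := by
    rw [← integral_indicator Metric.isOpen_ball.measurableSet]
    refine integral_congr_ae (Eventually.of_forall fun z => ?_)
    simp [indicator]
  rw [e1, integral_fun_norm_addHaar volume ((Iio r).indicator fun t : ℝ => 1 / (t + δ) ^ 3),
    finrank_plane_prod]
  have e2 : ∫ t in Ioi (0:ℝ), t ^ (3 - 1) • (Iio r).indicator (fun t : ℝ => 1 / (t + δ) ^ 3) t =
      ∫ t in Ioo (0:ℝ) r, t ^ 2 / (t + δ) ^ 3 := by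
    have : ∀ t : ℝ, t ^ (3 - 1) • (Iio r).indicator (fun t : ℝ => 1 / (t + δ) ^ 3) t =
        (Iio r).indicator (fun t : ℝ => t ^ 2 / (t + δ) ^ 3) t := by
      intro t; by_cases ht : t < r <;> simp [indicator, ht, div_eq_mul_inv]
    simp_rw [this]
    rw [setIntegral_indicator measurableSet_Iio]
    rfl
  have e3 : ∫ t in Ioo (0:ℝ) r, t ^ 2 / (t + δ) ^ 3 ≤ Real.log ((r + δ) / δ) := by
    have hlog : ∫ t in (0:ℝ)..r, (t + δ)⁻¹ = Real.log ((r + δ) / δ) := by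
      rw [intervalIntegral.integral_comp_add_right (fun t => t⁻¹) δ, zero_add,
        integral_inv_of_pos hδ (by positivity)]
    have hc : ContinuousOn (fun t : ℝ => (t + δ)⁻¹) (Icc 0 r) :=
      ContinuousOn.inv₀ (by fun_prop) fun t ht => by have := ht.1; positivity
    have hc2 : ContinuousOn (fun t : ℝ => t ^ 2 / (t + δ) ^ 3) (Icc 0 r) :=
      ContinuousOn.div (by fun_prop) (by fun_prop) fun t ht => by have := ht.1; positivity
    rw [← hlog, intervalIntegral.integral_of_le hr.le, integral_Ioc_eq_integral_Ioo]
    refine setIntegral_mono_on (hc2.integrableOn_Icc.mono_set Ioo_subset_Icc_self)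
      (hc.integrableOn_Icc.mono_set Ioo_subset_Icc_self) measurableSet_Ioo fun t ht => ?_
    have ht0 : 0 < t := ht.1
    rw [inv_eq_one_div, div_le_div_iff₀ (by positivity) (by positivity)]
    have : t ^ 2 ≤ (t + δ) ^ 2 := by gcongr; linarith
    nlinarith [this, mul_le_mul_of_nonneg_right this (by positivity : (0:ℝ) ≤ t + δ)]
  rw [e2]
  show (3 : ℕ) • (ballVolume • _) ≤ _
  rw [nsmul_eq_mul, smul_eq_mul, ← mul_assoc]
  have : 0 ≤ ballVolume := measureReal_nonneg
  push_cast
  gcongr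

/-! ### Bounds, regularity and weighted divergence of the regularised velocity -/

/-- A measurable function on the plane, bounded by `m` and supported in `box a b`. -/
structure IsVorticity (a b m : ℝ) (w : Plane → ℝ) : Prop where
  measurable : Measurable w
  bound : ∀ y, |w y| ≤ m
  support : ∀ y ∉ box a b, w y = 0

/-- The components of the velocity generated by the regularised kernel. -/
def regVel (i : Fin 2) (δ : ℝ) (w : Plane → ℝ) (x : Plane) : ℝ :=
  1 / (2 * Real.pi) * ∫ z, kern i δ x z.1 z.2 * w z.1 ∂angleMeasure

lemma IsVorticity.integrable {a b m : ℝ} {w : Plane → ℝ} (hw : IsVorticity a b m w) :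
    Integrable w := by
  have h1 : IntegrableOn w (box a b) := by
    refine Measure.integrableOn_of_bounded (M := m) ?_ hw.measurable.aestronglyMeasurable
      (Eventually.of_forall hw.bound)
    exact ((measure_mono inter_subset_right).trans_lt measure_ball_lt_top).ne
  exact (integrableOn_iff_integrable_of_support_subset fun y hy => by
    by_contra h; exact hy (hw.support y h)).1 h1

instance : IsFiniteMeasure (volume.restrict (Ioc 0 Real.pi) : Measure ℝ) :=
  ⟨by simp⟩

lemma continuous_num (i : Fin 2) (x : Plane) : Continuous fun z : Plane × ℝ => num i x z.1 z.2 := by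
  have h := continuous_coord 1
  have h0 := continuous_coord 0
  fin_cases i
  · show Continuous fun z : Plane × ℝ => z.1 1 * (z.1 1 - x 1 * Real.cos z.2); fun_prop
  · show Continuous fun z : Plane × ℝ => z.1 1 * (x 0 - z.1 0) * Real.cos z.2; fun_prop

lemma continuous_den (δ : ℝ) (x : Plane) : Continuous fun z : Plane × ℝ => den δ x z.1 z.2 := by
  have h := continuous_coord 1
  unfold den bracket; fun_prop

lemma measurable_kern (i : Fin 2) (δ : ℝ) (x : Plane) :
    Measurable fun z : Plane × ℝ => kern i δ x z.1 z.2 :=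
  (continuous_num i x).measurable.div ((continuous_den δ x).measurable.pow_const 3)

lemma stronglyMeasurable_kernD (i : Fin 2) (δ : ℝ) (x : Plane) :
    StronglyMeasurable fun z : Plane × ℝ => kernD i δ x z.1 z.2 := by
  have h := continuous_coord 1
  have hd := (continuous_den δ x).measurable
  have h1 : Continuous fun z : Plane × ℝ => numD i z.1 z.2 := by
    fin_cases i
    · show Continuous fun z : Plane × ℝ => (-(z.1 1 * Real.cos z.2)) •
        (EuclideanSpace.proj (1 : Fin 2) : Plane →L[ℝ] ℝ)
      fun_prop
    · show Continuous fun z : Plane × ℝ => (z.1 1 * Real.cos z.2) •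
        (EuclideanSpace.proj (0 : Fin 2) : Plane →L[ℝ] ℝ)
      fun_prop
  have h2 : Continuous fun z : Plane × ℝ => bracketD x z.1 z.2 := by
    unfold bracketD; fun_prop
  exact ((hd.pow_const 3).inv.stronglyMeasurable.smul h1.stronglyMeasurable).sub
    ((((continuous_num i x).measurable.const_mul (3 / 2)).div
      (hd.pow_const 5)).stronglyMeasurable.smul h2.stronglyMeasurable)

section Estimates

variable {a b m δ : ℝ} {w : Plane → ℝ} {x : Plane}

lemma mem_ball_of_mem_box {z : Plane × ℝ} (hx : x ∈ box a b) (hz : z.1 ∈ box a b)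
    (hθ : z.2 ∈ Ioc 0 Real.pi) : z - (x, 0) ∈ Metric.ball (0 : Plane × ℝ) (2 * b + 4) := by
  rw [mem_ball_zero_iff, Prod.norm_def]
  have h1 := norm_lt_of_mem_box hx
  have h2 := norm_lt_of_mem_box hz
  have hb : 0 < b := (norm_nonneg x).trans_lt h1
  refine max_lt ?_ ?_
  · exact (norm_sub_le _ _).trans_lt (by linarith)
  · simp only [Prod.snd_sub, sub_zero, Real.norm_eq_abs, abs_of_pos hθ.1]
    linarith [hθ.2, Real.pi_lt_four]

lemma norm_sub_pos {z : Plane × ℝ} (hθ : z.2 ∈ Ioc 0 Real.pi) : 0 < ‖z - (x, 0)‖ := by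
  have : |z.2| ≤ ‖z - (x, 0)‖ := by
    rw [Prod.norm_def]
    exact (by simp : |z.2| ≤ ‖(z - (x, 0)).2‖).trans (le_max_right _ _)
  exact (abs_pos.2 hθ.1.ne').trans_le this

lemma lower_bound_den {z : Plane × ℝ} (δ : ℝ) (ha : 0 < a) (hx : x ∈ box a b) (hz : z.1 ∈ box a b)
    (hθ : z.2 ∈ Ioc 0 Real.pi) : lowerConst a * ‖z - (x, 0)‖ ≤ den δ x z.1 z.2 :=
  lowerConst_mul_norm_le ha hx hz (by rw [abs_of_pos hθ.1]; exact hθ.2)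

/-- The integral over the largest ball that occurs of the majorant `‖z‖ ^ (-5/2)`. -/
def powerIntegral (b : ℝ) : ℝ :=
  ∫ z in Metric.ball (0 : Plane × ℝ) (2 * b + 4), ‖z‖ ^ (-(5 / 2) : ℝ)

lemma powerIntegral_nonneg (b : ℝ) : 0 ≤ powerIntegral b :=
  integral_nonneg fun z => by positivity

lemma integral_le_of_power_bound {K : Plane × ℝ → ℝ} {c : ℝ} (hc : 0 ≤ c)
    (hK : AEStronglyMeasurable K angleMeasure) (hx : x ∈ box a b)
    (hz : ∀ z : Plane × ℝ, z.1 ∉ box a b → K z = 0)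
    (hKc : ∀ z : Plane × ℝ, z.1 ∈ box a b → z.2 ∈ Ioc 0 Real.pi →
      |K z| ≤ c * ‖z - (x, 0)‖ ^ (-(5 / 2) : ℝ)) :
    Integrable K angleMeasure ∧ ∫ z, |K z| ∂angleMeasure ≤ c * powerIntegral b := by
  have := norm_integral_le_of_radial (K := fun z => |K z|) (G := fun t => c * t ^ (-(5 / 2) : ℝ)) x
    (fun t ht => by positivity) ((integrableOn_norm_rpow (2 * b + 4)).const_mul c) hK.norm (by
      filter_upwards [ae_angleMeasure] with z hθ
      by_cases h : z.1 ∈ box a b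
      · exact Or.inl ⟨mem_ball_of_mem_box hx h hθ, by
          rw [Real.norm_eq_abs, abs_abs]; exact hKc z h hθ⟩
      · exact Or.inr (by simp [hz z h]))
  rw [integral_const_mul] at this
  exact ⟨(integrable_norm_iff hK).1 this.1, (le_abs_self _).trans this.2⟩

lemma integrable_kern_zero (ha : 0 < a) (hw : IsVorticity a b m w) (hx : x ∈ box a b)
    (i : Fin 2) :
    Integrable (fun z => kern i 0 x z.1 z.2 * w z.1) angleMeasure ∧
      ∫ z, |kern i 0 x z.1 z.2 * w z.1| ∂angleMeasure ≤
        m * (b * (1 + b / a) / lowerConst a ^ 2 * √(2 * b + 4)) * powerIntegral b := by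
  have hb : 0 < b := (norm_nonneg x).trans_lt (norm_lt_of_mem_box hx)
  have hm : 0 ≤ m := (abs_nonneg _).trans (hw.bound x)
  have hc := lowerConst_pos ha
  refine integral_le_of_power_bound (by positivity)
    ((measurable_kern i 0 x).mul (hw.measurable.comp measurable_fst)).aestronglyMeasurable hx
    (fun z hz => by rw [hw.support _ hz, mul_zero]) fun z hz hθ => ?_
  have hρ : 0 < ‖z - (x, 0)‖ := norm_sub_pos hθ
  have hl := lower_bound_den 0 ha hx hz hθ
  have hk := abs_kern_zero_le (θ := z.2) ha hx hz i
  have hr := (mem_ball_zero_iff.1 (mem_ball_of_mem_box hx hz hθ)).le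
  set ρ := ‖z - (x, 0)‖
  -- The singularity `ρ⁻²` is weakened to `ρ^(-5/2)` so that `powerIntegral` also serves for the
  -- regularisation error.
  have hrp : 1 / ρ ^ 2 ≤ √(2 * b + 4) * ρ ^ (-(5 / 2) : ℝ) := by
    have : 1 / ρ ^ 2 = √ρ * ρ ^ (-(5 / 2) : ℝ) := by
      rw [Real.sqrt_eq_rpow, ← Real.rpow_add hρ, ← Real.rpow_natCast, one_div,
        ← Real.rpow_neg hρ.le]
      norm_num
    rw [this]; gcongr
  calc |kern i 0 x z.1 z.2 * w z.1| = |kern i 0 x z.1 z.2| * |w z.1| := abs_mul _ _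
    _ ≤ b * (1 + b / a) / (lowerConst a * ρ) ^ 2 * m := by
        gcongr
        · exact hk.trans (by gcongr)
        · exact hw.bound _
    _ = m * (b * (1 + b / a) / lowerConst a ^ 2) * (1 / ρ ^ 2) := by field_simp
    _ ≤ m * (b * (1 + b / a) / lowerConst a ^ 2) * (√(2 * b + 4) * ρ ^ (-(5 / 2) : ℝ)) := by
        gcongr
    _ = _ := by ring

lemma den_pos (ha : 0 < a) (hδ : 0 < δ) {y : Plane} (hx : x ∈ box a b) (hy : y ∈ box a b) (θ : ℝ) :
    0 < den δ x y θ := Real.sqrt_pos.2 (bracket_pos_of_sq_add ha hδ hx hy)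

lemma integrable_kern (ha : 0 < a) (hδ : 0 < δ) (hw : IsVorticity a b m w) (hx : x ∈ box a b)
    (i : Fin 2) : Integrable (fun z => kern i δ x z.1 z.2 * w z.1) angleMeasure := by
  have hb : 0 < b := (norm_nonneg x).trans_lt (norm_lt_of_mem_box hx)
  have hi : Integrable (fun z : Plane × ℝ => b * (1 + b / a) / δ ^ 2 * |w z.1|) angleMeasure :=
    (hw.integrable.abs.comp_fst _).const_mul _
  refine hi.mono' ((measurable_kern i δ x).mul
    (hw.measurable.comp measurable_fst)).aestronglyMeasurable (Eventually.of_forall fun z => ?_)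
  by_cases hz : z.1 ∈ box a b
  · rw [norm_mul]
    refine mul_le_mul_of_nonneg_right ?_ (abs_nonneg _)
    have hd := den_pos ha hδ hx hz z.2
    have hn := abs_num_le (δ := δ) (θ := z.2) ha hx hz i
    have hl := le_den (δ := δ) (θ := z.2) ha hx hz
    rw [kern, norm_div, Real.norm_eq_abs, Real.norm_eq_abs, abs_of_pos (pow_pos hd 3)]
    calc |num i x z.1 z.2| / den δ x z.1 z.2 ^ 3
        ≤ b * (1 + b / a) * den δ x z.1 z.2 / den δ x z.1 z.2 ^ 3 := by gcongr
      _ = b * (1 + b / a) / den δ x z.1 z.2 ^ 2 := by field_simp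
      _ ≤ _ := by gcongr
  · simp [hw.support _ hz]

lemma abs_regVel_zero_le (ha : 0 < a) (hw : IsVorticity a b m w) (hx : x ∈ box a b)
    (i : Fin 2) : |regVel i 0 w x| ≤
      m * (b * (1 + b / a) / lowerConst a ^ 2 * √(2 * b + 4)) * powerIntegral b := by
  have h := (integrable_kern_zero ha hw hx i).2
  have hpi := Real.pi_gt_three
  rw [regVel, abs_mul, abs_of_pos (by positivity)]
  refine le_trans (mul_le_of_le_one_left (abs_nonneg _) ?_) (abs_integral_le_integral_abs.trans h)
  rw [div_le_one (by positivity)]; linarith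

lemma abs_regVel_sub_le (ha : 0 < a) (hδ : 0 < δ) (hw : IsVorticity a b m w) (hx : x ∈ box a b)
    (i : Fin 2) : |regVel i 0 w x - regVel i δ w x| ≤
      m * (3 * (b * (1 + b / a))) * lowerConst a ^ (-(5 / 2) : ℝ) * powerIntegral b * √δ := by
  have hb : 0 < b := (norm_nonneg x).trans_lt (norm_lt_of_mem_box hx)
  have hm : 0 ≤ m := (abs_nonneg _).trans (hw.bound x)
  have hc := lowerConst_pos ha
  have hpi := Real.pi_gt_three
  have h := integral_le_of_power_bound
    (K := fun z => kern i 0 x z.1 z.2 * w z.1 - kern i δ x z.1 z.2 * w z.1)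
    (c := m * (3 * (b * (1 + b / a))) * √δ * lowerConst a ^ (-(5 / 2) : ℝ)) (by positivity)
    ((((measurable_kern i 0 x).mul (hw.measurable.comp measurable_fst)).sub
      ((measurable_kern i δ x).mul (hw.measurable.comp measurable_fst))).aestronglyMeasurable) hx
    (fun z hz => by rw [hw.support _ hz]; ring) fun z hz hθ => by
      have hρ : 0 < ‖z - (x, 0)‖ := norm_sub_pos hθ
      have hl := lower_bound_den 0 ha hx hz hθ
      have hdp : 0 < den 0 x z.1 z.2 := (mul_pos hc hρ).trans_le hl
      have hk := abs_kern_sub_le ha hδ hx hz i hdp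
      rw [← sub_mul, abs_mul]
      calc |kern i 0 x z.1 z.2 - kern i δ x z.1 z.2| * |w z.1|
          ≤ 3 * (b * (1 + b / a)) * √δ * (lowerConst a * ‖z - (x, 0)‖) ^ (-(5 / 2) : ℝ) * m := by
            gcongr
            · refine hk.trans ?_
              gcongr ?_ * ?_
              exact Real.rpow_le_rpow_of_nonpos (by positivity) hl (by norm_num)
            · exact hw.bound _
        _ = _ := by rw [Real.mul_rpow hc.le hρ.le]; ring
  have h2 := abs_integral_le_integral_abs.trans h.2
  rw [integral_sub (integrable_kern_zero ha hw hx i).1 (integrable_kern ha hδ hw hx i)] at h2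
  rw [regVel, regVel, ← mul_sub, abs_mul, abs_of_pos (by positivity)]
  refine (mul_le_of_le_one_left (abs_nonneg _) ?_).trans (h2.trans_eq (by ring))
  rw [div_le_one (by positivity)]; linarith

lemma hasFDerivAt_regVel (ha : 0 < a) (hδ : 0 < δ) (hw : IsVorticity a b m w) (hx : x ∈ box a b)
    (i : Fin 2) :
    Integrable (fun z => w z.1 • kernD i δ x z.1 z.2) angleMeasure ∧
    HasFDerivAt (regVel i δ w)
      ((1 / (2 * Real.pi)) • ∫ z, w z.1 • kernD i δ x z.1 z.2 ∂angleMeasure) x := by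
  have hb : 0 < b := (norm_nonneg x).trans_lt (norm_lt_of_mem_box hx)
  have hwm : Measurable fun z : Plane × ℝ => w z.1 := hw.measurable.comp measurable_fst
  have hF' : AEStronglyMeasurable (fun z => w z.1 • kernD i δ x z.1 z.2) angleMeasure :=
    (hwm.stronglyMeasurable.smul (stronglyMeasurable_kernD i δ x)).aestronglyMeasurable
  have hbi : Integrable (fun z : Plane × ℝ =>
      |w z.1| * ((b + 3 * (b * (1 + b / a) * (1 + b / a))) / δ ^ 3)) angleMeasure :=
    (hw.integrable.abs.comp_fst _).mul_const _
  have hbound : ∀ z : Plane × ℝ, ∀ x' ∈ box a b, ‖w z.1 • kernD i δ x' z.1 z.2‖ ≤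
      |w z.1| * ((b + 3 * (b * (1 + b / a) * (1 + b / a))) / δ ^ 3) := by
    intro z x' hx'
    by_cases hz : z.1 ∈ box a b
    · rw [norm_smul, Real.norm_eq_abs]
      gcongr
      refine (norm_kernD_le ha hδ hx' hz i).trans ?_
      have := le_den (δ := δ) (θ := z.2) ha hx' hz
      gcongr
    · simp [hw.support _ hz]
  refine ⟨hbi.mono' hF' (Eventually.of_forall fun z => hbound z x hx), ?_⟩
  have := hasFDerivAt_integral_of_dominated_of_fderiv_le (𝕜 := ℝ) (μ := angleMeasure)
    (F := fun x z => kern i δ x z.1 z.2 * w z.1) (F' := fun x z => w z.1 • kernD i δ x z.1 z.2)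
    (x₀ := x) ((isOpen_box a b).mem_nhds hx)
    (Eventually.of_forall fun x' => ((measurable_kern i δ x').mul hwm).aestronglyMeasurable)
    (integrable_kern ha hδ hw hx i) hF' (Eventually.of_forall hbound) hbi
    (Eventually.of_forall fun z x' hx' => by
      by_cases hz : z.1 ∈ box a b
      · exact (hasFDerivAt_kern i (bracket_pos_of_sq_add ha hδ hx' hz)).mul_const (w z.1)
      · simpa [hw.support _ hz] using hasFDerivAt_const (0 : ℝ) x')
  exact this.const_mul (1 / (2 * Real.pi))

lemma norm_fderiv_regVel_le (ha : 0 < a) (hδ : 0 < δ) (hw : IsVorticity a b m w)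
    (hx : x ∈ box a b) (i : Fin 2) :
    ‖(1 / (2 * Real.pi)) • ∫ z, w z.1 • kernD i δ x z.1 z.2 ∂angleMeasure‖ ≤
      m * ((b + 3 * (b * (1 + b / a) * (1 + b / a))) * (2 / lowerConst a) ^ 3) *
        (3 * ballVolume) * Real.log ((2 * b + 4 + δ) / δ) := by
  have hb : 0 < b := (norm_nonneg x).trans_lt (norm_lt_of_mem_box hx)
  have hm : 0 ≤ m := (abs_nonneg _).trans (hw.bound x)
  have hc := lowerConst_pos ha
  have hpi := Real.pi_gt_three
  have hcube := integral_cube_le (r := 2 * b + 4) (δ := δ) (by positivity) hδ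
  set B := b + 3 * (b * (1 + b / a) * (1 + b / a))
  have hB : 0 ≤ B := by positivity
  have h := (norm_integral_le_of_radial (K := fun z => w z.1 • kernD i δ x z.1 z.2)
    (G := fun t => m * (B * (2 / lowerConst a) ^ 3) * (1 / (t + δ) ^ 3)) (r := 2 * b + 4) x
    (fun t ht => by positivity) (Integrable.const_mul hcube.1 (m * (B * (2 / lowerConst a) ^ 3)))
    (hasFDerivAt_regVel ha hδ hw hx i).1.aestronglyMeasurable (by
      filter_upwards [ae_angleMeasure] with z hθ
      by_cases hz : z.1 ∈ box a b
      · refine Or.inl ⟨mem_ball_of_mem_box hx hz hθ, ?_⟩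
        have hl := lower_bound_den δ ha hx hz hθ
        have hl2 := le_den (δ := δ) (θ := z.2) ha hx hz
        have hc1 : lowerConst a ≤ 1 := min_le_left _ _
        -- Average of the two lower bounds, by the distance and by `δ`, using `lowerConst a ≤ 1`.
        have hl3 : lowerConst a / 2 * (‖z - (x, 0)‖ + δ) ≤ den δ x z.1 z.2 := by nlinarith
        rw [norm_smul, Real.norm_eq_abs]
        calc |w z.1| * ‖kernD i δ x z.1 z.2‖
            ≤ m * (B / (lowerConst a / 2 * (‖z - (x, 0)‖ + δ)) ^ 3) := by
              gcongr
              · exact hw.bound _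
              · refine (norm_kernD_le ha hδ hx hz i).trans ?_
                gcongr
          _ = _ := by rw [mul_pow, div_pow, div_pow]; field_simp
      · exact Or.inr (by simp [hw.support _ hz]))).2
  rw [integral_const_mul] at h
  rw [norm_smul, Real.norm_eq_abs, abs_of_pos (by positivity : 0 < 1 / (2 * Real.pi))]
  refine (mul_le_of_le_one_left (norm_nonneg _) ?_).trans (h.trans ?_)
  · rw [div_le_one (by positivity)]; linarith
  · calc _ ≤ m * (B * (2 / lowerConst a) ^ 3) *
          (3 * ballVolume * Real.log ((2 * b + 4 + δ) / δ)) := by gcongr; exact hcube.2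
      _ = _ := by ring

/-- The weighted divergence of the integrand is the exact `θ`-derivative of `y₂ (x₁ - y₁) sin θ /
den³`, and the sine vanishes at both endpoints. Adding `δ²` to the bracket preserves this identity,
which is why the regularisation is made there. -/
lemma integral_div_kern (ha : 0 < a) (hδ : 0 < δ) {y : Plane} (hx : x ∈ box a b)
    (hy : y ∈ box a b) :
    ∫ θ in (0:ℝ)..Real.pi, (x 1 * (kernD 0 δ x y θ (unitVec 0) + kernD 1 δ x y θ (unitVec 1)) +
      kern 1 δ x y θ) = 0 := by
  have hd0 : ∀ θ, den δ x y θ ≠ 0 := fun θ => (den_pos ha hδ hx hy θ).ne'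
  have hder : ∀ θ, HasDerivAt (fun θ => y 1 * (x 0 - y 0) * (Real.sin θ / den δ x y θ ^ 3))
      (x 1 * (kernD 0 δ x y θ (unitVec 0) + kernD 1 δ x y θ (unitVec 1)) + kern 1 δ x y θ) θ := by
    intro θ
    have hpos := bracket_pos_of_sq_add (θ := θ) ha hδ hx hy
    have hbr : HasDerivAt (fun θ => bracket x y θ + δ ^ 2) (2 * x 1 * y 1 * Real.sin θ) θ := by
      have := ((((Real.hasDerivAt_cos θ).const_sub 1).const_mul (2 * x 1 * y 1)).const_add
        (‖x - y‖ ^ 2)).add_const (δ ^ 2)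
      simpa [bracket] using this
    have hdn : HasDerivAt (fun θ => den δ x y θ) _ θ := hbr.sqrt hpos.ne'
    have h1 := (((Real.hasDerivAt_sin θ).div (hdn.pow 3) (pow_ne_zero 3 (hd0 θ))).const_mul
      (y 1 * (x 0 - y 0)))
    refine h1.congr_deriv ?_
    have e : √(bracket x y θ + δ ^ 2) = den δ x y θ := rfl
    have hd := hd0 θ
    rw [e]
    simp [kernD, kern, numD, num, bracketD, unitVec,
      EuclideanSpace.inner_single_right]
    field_simp
    rw [Real.sin_sq]
    ring
  have hcont : Continuous fun θ => x 1 * (kernD 0 δ x y θ (unitVec 0) +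
      kernD 1 δ x y θ (unitVec 1)) + kern 1 δ x y θ := by
    have hdc : Continuous fun θ => den δ x y θ := by unfold den bracket; fun_prop
    have hd3 : ∀ θ, den δ x y θ ^ 3 ≠ 0 := fun θ => pow_ne_zero 3 (hd0 θ)
    have hd5 : ∀ θ, den δ x y θ ^ 5 ≠ 0 := fun θ => pow_ne_zero 5 (hd0 θ)
    simp only [kernD, kern, numD, num, bracketD]
    simp
    fun_prop (disch := assumption)
  rw [intervalIntegral.integral_eq_sub_of_hasDerivAt (fun θ _ => hder θ)
    (hcont.intervalIntegrable _ _)]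
  simp

lemma div_regVel (ha : 0 < a) (hδ : 0 < δ) (hw : IsVorticity a b m w) (hx : x ∈ box a b) :
    x 1 * (((1 / (2 * Real.pi)) • ∫ z, w z.1 • kernD 0 δ x z.1 z.2 ∂angleMeasure) (unitVec 0) +
      ((1 / (2 * Real.pi)) • ∫ z, w z.1 • kernD 1 δ x z.1 z.2 ∂angleMeasure) (unitVec 1)) +
      regVel 1 δ w x = 0 := by
  have h0 := (hasFDerivAt_regVel ha hδ hw hx 0).1
  have h1 := (hasFDerivAt_regVel ha hδ hw hx 1).1
  have hk := integrable_kern ha hδ hw hx 1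
  have e0 := ContinuousLinearMap.integral_apply h0 (unitVec 0)
  have e1 := ContinuousLinearMap.integral_apply h1 (unitVec 1)
  have i0 := h0.apply_continuousLinearMap (unitVec 0)
  have i1 := h1.apply_continuousLinearMap (unitVec 1)
  have i01 : Integrable (fun z => x 1 * ((w z.1 • kernD 0 δ x z.1 z.2) (unitVec 0) +
      (w z.1 • kernD 1 δ x z.1 z.2) (unitVec 1))) angleMeasure := (i0.add i1).const_mul _
  have iall : Integrable (fun z => x 1 * ((w z.1 • kernD 0 δ x z.1 z.2) (unitVec 0) +
      (w z.1 • kernD 1 δ x z.1 z.2) (unitVec 1)) + kern 1 δ x z.1 z.2 * w z.1)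
      (volume.prod (volume.restrict (Ioc 0 Real.pi))) := i01.add hk
  rw [regVel, smul_apply, smul_apply, e0, e1, smul_eq_mul,
    smul_eq_mul]
  have : x 1 * (1 / (2 * Real.pi) * ∫ z, (w z.1 • kernD 0 δ x z.1 z.2) (unitVec 0) ∂angleMeasure +
      1 / (2 * Real.pi) * ∫ z, (w z.1 • kernD 1 δ x z.1 z.2) (unitVec 1) ∂angleMeasure) +
      1 / (2 * Real.pi) * ∫ z, kern 1 δ x z.1 z.2 * w z.1 ∂angleMeasure =
      1 / (2 * Real.pi) * ∫ z, (x 1 * ((w z.1 • kernD 0 δ x z.1 z.2) (unitVec 0) +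
        (w z.1 • kernD 1 δ x z.1 z.2) (unitVec 1)) + kern 1 δ x z.1 z.2 * w z.1)
        ∂angleMeasure := by
    rw [integral_add i01 hk, integral_const_mul, integral_add i0 i1]
    ring
  rw [this, angleMeasure, integral_prod _ iall]
  refine mul_eq_zero_of_right _ (integral_eq_zero_of_ae (Eventually.of_forall fun y => ?_))
  by_cases hy : y ∈ box a b
  · have := integral_div_kern ha hδ hx hy
    rw [intervalIntegral.integral_of_le Real.pi_pos.le] at this
    have e : ∀ θ, x 1 * ((w y • kernD 0 δ x y θ) (unitVec 0) +
        (w y • kernD 1 δ x y θ) (unitVec 1)) + kern 1 δ x y θ * w y =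
        w y * (x 1 * (kernD 0 δ x y θ (unitVec 0) + kernD 1 δ x y θ (unitVec 1)) +
          kern 1 δ x y θ) := fun θ => by simp; ring
    simp only [e, integral_const_mul, this, mul_zero, Pi.zero_apply]
  · simp [hw.support _ hy]

lemma velocity_apply (ha : 0 < a) (hw : IsVorticity a b m w) (hx : x ∈ box a b) (i : Fin 2) :
    velocity w x i = regVel i 0 w x := by
  have hint := (integrable_kern_zero ha hw hx i).1
  -- The real power agrees with the cube of a square root where the bracket is nonnegative, hence
  -- the restriction to the support of `w`.
  have key : ∀ y, w y ≠ 0 → ∀ θ, num i x y θ / bracket x y θ ^ (3 / 2 : ℝ) = kern i 0 x y θ := by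
    intro y hy θ
    have hyb : y ∈ box a b := by by_contra h; exact hy (hw.support y h)
    have hbr := bracket_nonneg (ha.le.trans (le_of_lt hx.1)) (ha.le.trans (le_of_lt hyb.1)) θ
    rw [kern, den, zero_pow two_ne_zero, add_zero, Real.sqrt_eq_rpow, ← Real.rpow_natCast,
      ← Real.rpow_mul hbr]
    norm_num
  have e : regVel i 0 w x = ∫ y, (1 / (2 * Real.pi) * ∫ θ in (0:ℝ)..Real.pi,
      num i x y θ / bracket x y θ ^ (3 / 2 : ℝ)) * w y := by
    rw [regVel, angleMeasure, integral_prod _ hint, ← integral_const_mul]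
    refine integral_congr_ae (Eventually.of_forall fun y => ?_)
    by_cases hy : w y = 0
    · simp [hy]
    · simp only [key y hy, integral_mul_const, intervalIntegral.integral_of_le Real.pi_pos.le,
        mul_assoc]
  rw [e]
  fin_cases i <;> rfl

end Estimates

lemma norm_coord_sum_le (x : Plane) : ‖x‖ ≤ |x 0| + |x 1| := by
  rw [EuclideanSpace.norm_eq]
  simp only [Fin.sum_univ_two, Real.norm_eq_abs, sq_abs]
  refine Real.sqrt_le_iff.2 ⟨by positivity, ?_⟩
  nlinarith [sq_abs (x 0), sq_abs (x 1), mul_nonneg (abs_nonneg (x 0)) (abs_nonneg (x 1))]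

lemma eq_sum_unitVec (v : Plane) : v = v 0 • unitVec 0 + v 1 • unitVec 1 := by
  ext i; fin_cases i <;> simp [unitVec]

/-- The velocity generated by the regularised kernel. -/
def regField (δ : ℝ) (w : Plane → ℝ) (x : Plane) : Plane :=
  regVel 0 δ w x • unitVec 0 + regVel 1 δ w x • unitVec 1

lemma regField_apply (δ : ℝ) (w : Plane → ℝ) (x : Plane) (i : Fin 2) :
    regField δ w x i = regVel i δ w x := by
  fin_cases i <;> simp [regField, unitVec]

/-- Bound of the components of the velocity on `box a b`. -/
def velBound (a b m : ℝ) : ℝ :=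
  m * (b * (1 + b / a) / lowerConst a ^ 2 * √(2 * b + 4)) * powerIntegral b

/-- Bound of the error of the regularised velocity on `box a b`, up to the factor `√δ`. -/
def regErr (a b m : ℝ) : ℝ :=
  m * (3 * (b * (1 + b / a))) * lowerConst a ^ (-(5 / 2) : ℝ) * powerIntegral b

/-- The factor in front of the logarithm in the Lipschitz constant of the regularised velocity. -/
def regLip (a b m : ℝ) : ℝ :=
  m * ((b + 3 * (b * (1 + b / a) * (1 + b / a))) * (2 / lowerConst a) ^ 3) * (3 * ballVolume)

section

variable {a b m δ : ℝ} {w : Plane → ℝ} {x y : Plane}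

lemma norm_regField_sub_velocity_le (ha : 0 < a) (hδ : 0 < δ) (hw : IsVorticity a b m w)
    (hx : x ∈ box a b) : ‖velocity w x - regField δ w x‖ ≤ 2 * (regErr a b m * √δ) := by
  refine (norm_coord_sum_le _).trans ?_
  have h : ∀ i, |(velocity w x - regField δ w x) i| ≤ regErr a b m * √δ := fun i => by
    rw [PiLp.sub_apply, velocity_apply ha hw hx, regField_apply]
    exact abs_regVel_sub_le ha hδ hw hx i
  linarith [h 0, h 1]

lemma norm_velocity_le (ha : 0 < a) (hw : IsVorticity a b m w) (hx : x ∈ box a b) :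
    ‖velocity w x‖ ≤ 2 * velBound a b m := by
  refine (norm_coord_sum_le _).trans ?_
  have h : ∀ i, |velocity w x i| ≤ velBound a b m := fun i => by
    rw [velocity_apply ha hw hx]; exact abs_regVel_zero_le ha hw hx i
  linarith [h 0, h 1]

lemma norm_regField_sub_le (ha : 0 < a) (hδ : 0 < δ) (hw : IsVorticity a b m w)
    (hx : x ∈ box a b) (hy : y ∈ box a b) : ‖regField δ w x - regField δ w y‖ ≤
      2 * (regLip a b m * Real.log ((2 * b + 4 + δ) / δ)) * ‖x - y‖ := by
  refine (norm_coord_sum_le _).trans ?_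
  have h : ∀ i, |(regField δ w x - regField δ w y) i| ≤
      regLip a b m * Real.log ((2 * b + 4 + δ) / δ) * ‖x - y‖ := fun i => by
    rw [PiLp.sub_apply, regField_apply, regField_apply]
    exact (convex_box a b).norm_image_sub_le_of_norm_hasFDerivWithin_le (𝕜 := ℝ)
      (fun z hz => (hasFDerivAt_regVel ha hδ hw hz i).2.hasFDerivWithinAt)
      (fun z hz => norm_fderiv_regVel_le ha hδ hw hz i) hy hx
  linarith [h 0, h 1]

lemma regField_div_free (ha : 0 < a) (hδ : 0 < δ) (hw : IsVorticity a b m w) (hx : x ∈ box a b) :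
    ∃ B : Plane →L[ℝ] Plane, HasFDerivAt (regField δ w) B x ∧
      x 1 * (B (unitVec 0) 0 + B (unitVec 1) 1) + regField δ w x 1 = 0 := by
  refine ⟨_, ((hasFDerivAt_regVel ha hδ hw hx 0).2.smul_const (unitVec 0)).add
    ((hasFDerivAt_regVel ha hδ hw hx 1).2.smul_const (unitVec 1)), ?_⟩
  rw [regField_apply, ← div_regVel ha hδ hw hx]
  simp [unitVec]

end

/-! ### The external field: from the weak to the pointwise divergence equation -/

lemma IsExternalField.lipschitzWith {ε C_F L : ℝ} {F : ℝ → Plane → Plane}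
    (hF : IsExternalField ε C_F L F) {t : ℝ} (ht : 0 ≤ t) :
    LipschitzWith (L / |Real.log ε|).toNNReal (F t) :=
  LipschitzWith.of_dist_le_mul fun x y => by
    rw [dist_eq_norm, dist_eq_norm]
    exact (hF.lipschitz t ht x y).trans (by gcongr; exact Real.le_coe_toNNReal _)

/-- By Rademacher's theorem, a Lipschitz field which is weakly weighted divergence free is weighted
divergence free almost everywhere. -/
lemma ae_div_free_of_weak {G : Plane → Plane} {K : NNReal} (hlip : LipschitzWith K G)
    (hweak : ∀ f : Plane → ℝ, ContDiff ℝ ((⊤ : ℕ∞) : WithTop ℕ∞) f → HasCompactSupport f →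
      tsupport f ⊆ halfPlane → ∫ x, x 1 * fderiv ℝ f x (G x) = 0) :
    ∀ᵐ x : Plane, x ∈ halfPlane → ∃ B : Plane →L[ℝ] Plane, HasFDerivAt G B x ∧
      x 1 * (B (unitVec 0) 0 + B (unitVec 1) 1) + G x 1 = 0 := by
  have hlipi : ∀ i : Fin 2, LipschitzWith K fun x => G x i := fun i =>
    LipschitzWith.of_dist_le_mul fun x y => by
      rw [Real.dist_eq]
      exact (abs_coord_le (G x - G y) i).trans (by
        rw [← dist_eq_norm]; exact hlip.dist_le_mul x y)
  have hcont : ∀ i : Fin 2, Continuous fun x => G x i := fun i => (hlipi i).continuous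
  let p : Fin 2 → Plane → ℝ := fun i x => lineDeriv ℝ (fun x => G x i) x (unitVec i)
  have hpm : ∀ i, Measurable (p i) := fun i => measurable_lineDeriv (hcont i)
  have hpb : ∀ i x, |p i x| ≤ K := fun i x => by
    have := norm_lineDeriv_le_of_lipschitz ℝ (hlipi i) (x₀ := x) (v := unitVec i)
    rwa [norm_unitVec, mul_one] at this
  -- `g` is the pointwise weighted divergence. Integrating by parts against `f(x) x₂`, legitimate
  -- for Lipschitz functions, converts the weak equation tested on `f` into `∫ f g = 0`.
  let g : Plane → ℝ := fun x => x 1 * (p 0 x + p 1 x) + G x 1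
  have hgm : Measurable g :=
    ((continuous_coord 1).measurable.mul ((hpm 0).add (hpm 1))).add (hcont 1).measurable
  have hgl : LocallyIntegrable g := by
    have hc : Continuous fun x : Plane => |x 1| * (K + K) + |G x 1| := by
      exact ((continuous_coord 1).abs.mul continuous_const).add (hcont 1).abs
    refine hc.locallyIntegrable.mono hgm.aestronglyMeasurable (Eventually.of_forall fun x => ?_)
    rw [Real.norm_eq_abs, Real.norm_eq_abs, abs_of_nonneg (a := |x 1| * (K + K) + |G x 1|)
      (by positivity)]
    refine (abs_add_le _ _).trans ?_
    rw [abs_mul]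
    gcongr
    exact (abs_add_le _ _).trans (add_le_add (hpb 0 x) (hpb 1 x))
  have hopen : IsOpen halfPlane := isOpen_lt continuous_const (continuous_coord 1)
  have hzero : ∀ᵐ x : Plane, x ∈ halfPlane → g x = 0 := by
    refine hopen.ae_eq_zero_of_integral_contDiff_smul_eq_zero (hgl.locallyIntegrableOn _) ?_
    intro f hf hfc hfs
    have hweak := hweak f hf hfc hfs
    have hfd : Differentiable ℝ f := hf.differentiable (by simp)
    have hproj : ContDiff ℝ ((⊤ : ℕ∞) : WithTop ℕ∞) fun x : Plane => x 1 :=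
      (EuclideanSpace.proj (𝕜 := ℝ) (1 : Fin 2) : Plane →L[ℝ] ℝ).contDiff
    have hproj' : ∀ x, HasFDerivAt (fun x : Plane => x 1)
        (EuclideanSpace.proj (𝕜 := ℝ) (1 : Fin 2)) x := fun x =>
      (EuclideanSpace.proj (𝕜 := ℝ) (1 : Fin 2) : Plane →L[ℝ] ℝ).hasFDerivAt
    have hq : ContDiff ℝ ((⊤ : ℕ∞) : WithTop ℕ∞) fun x => f x * x 1 := hf.mul hproj
    have hqc : HasCompactSupport fun x => f x * x 1 := hfc.mul_right
    obtain ⟨D, hD⟩ := ContDiff.lipschitzWith_of_hasCompactSupport hqc hq (by simp)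
    have hline : ∀ x v, lineDeriv ℝ (fun x => f x * x 1) x (-v) =
        -(f x * v 1 + x 1 * fderiv ℝ f x v) := by
      intro x v
      have := ((hfd x).hasFDerivAt.mul (hproj' x)).hasLineDerivAt (-v)
      refine this.lineDeriv.trans ?_
      simp; ring
    have hparts : ∀ i, ∫ x, p i x * (f x * x 1) =
        ∫ x, -(f x * unitVec i 1 + x 1 * fderiv ℝ f x (unitVec i)) * G x i := fun i => by
      rw [(hlipi i).integral_lineDeriv_mul_eq (μ := volume) hD hqc (unitVec i)]
      simp_rw [hline]
    have hf'c : Continuous (fderiv ℝ f) := hf.continuous_fderiv (by simp)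
    have int1 : ∀ i, Integrable fun x => p i x * (f x * x 1) := fun i =>
      (hq.continuous.integrable_of_hasCompactSupport hqc).bdd_mul
        (hpm i).aestronglyMeasurable (Eventually.of_forall fun x => hpb i x)
    have hcf : Continuous f := hf.continuous
    have int2 : Integrable fun x => f x * G x 1 :=
      (hcf.mul (hcont 1)).integrable_of_hasCompactSupport hfc.mul_right
    have int3 : ∀ i, Integrable fun x => x 1 * fderiv ℝ f x (unitVec i) * G x i := by
      intro i
      refine Continuous.integrable_of_hasCompactSupport ?_ ?_
      · exact ((continuous_coord 1).mul (hf'c.clm_apply continuous_const)).mul (hcont i)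
      · have : HasCompactSupport fun x => fderiv ℝ f x (unitVec i) :=
          (hfc.fderiv ℝ).comp_left (g := fun B : Plane →L[ℝ] ℝ => B (unitVec i)) (by simp)
        exact (this.mul_left).mul_right
    have hp0 := hparts 0
    have hp1 := hparts 1
    have e0 : (unitVec 0) 1 = 0 := by simp [unitVec]
    have e1 : (unitVec 1) 1 = 1 := by simp [unitVec]
    have h0 : ∫ x, p 0 x * (f x * x 1) = -∫ x, x 1 * fderiv ℝ f x (unitVec 0) * G x 0 := by
      rw [hp0, ← integral_neg]; congr 1; ext x; rw [e0]; ring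
    have h1 : ∫ x, p 1 x * (f x * x 1) =
        -(∫ x, f x * G x 1) - ∫ x, x 1 * fderiv ℝ f x (unitVec 1) * G x 1 := by
      rw [hp1, ← integral_neg, ← integral_sub (Integrable.fun_neg int2) (int3 1)]; congr 1; ext x; rw [e1]; ring
    have h2 : (∫ x, x 1 * fderiv ℝ f x (unitVec 0) * G x 0) +
        ∫ x, x 1 * fderiv ℝ f x (unitVec 1) * G x 1 = 0 := by
      rw [← integral_add (int3 0) (int3 1), ← hweak]
      congr 1; ext x
      conv_rhs => rw [eq_sum_unitVec (G x), map_add, map_smul, map_smul, smul_eq_mul, smul_eq_mul]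
      ring
    have h3 : ∫ x, f x • g x = (∫ x, p 0 x * (f x * x 1)) + (∫ x, p 1 x * (f x * x 1)) +
        ∫ x, f x * G x 1 := by
      rw [← integral_add (int1 0) (int1 1), ← integral_add _ int2]
      · congr 1; ext x; simp only [g, smul_eq_mul]; ring
      · exact (int1 0).add (int1 1)
    rw [h3, h0, h1]
    linarith
  filter_upwards [hzero, hlip.ae_differentiableAt (μ := volume)] with x hx hd hxh
  refine ⟨fderiv ℝ G x, hd.hasFDerivAt, ?_⟩
  have hpi : ∀ i, p i x = fderiv ℝ G x (unitVec i) i := fun i => by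
    have : HasFDerivAt (fun x => G x i) ((EuclideanSpace.proj (𝕜 := ℝ) i).comp
        (fderiv ℝ G x)) x :=
      (EuclideanSpace.proj (𝕜 := ℝ) i : Plane →L[ℝ] ℝ).hasFDerivAt.comp x hd.hasFDerivAt
    exact (this.hasLineDerivAt (unitVec i)).lineDeriv
  rw [← hpi, ← hpi]
  exact hx hxh

lemma isStepField_regField_add {a b m δ ε C_F L t : ℝ} {w : Plane → ℝ} {F : ℝ → Plane → Plane}
    (ha : 0 < a) (hδ : 0 < δ) (hw : IsVorticity a b m w) (hF : IsExternalField ε C_F L F)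
    (ht : 0 ≤ t) :
    IsStepField (box a b)
      (2 * (regLip a b m * Real.log ((2 * b + 4 + δ) / δ)) + L / |Real.log ε|)
      (2 * velBound a b m + 2 * (regErr a b m * √δ) + C_F / |Real.log ε|)
      (fun x => regField δ w x + F t x) where
  lipschitz x hx y hy := by
    have h1 := norm_regField_sub_le ha hδ hw hx hy
    have h2 := hF.lipschitz t ht x y
    rw [add_sub_add_comm, add_mul]
    exact (norm_add_le _ _).trans (add_le_add h1 h2)
  bound x hx := by
    have h1 := norm_regField_sub_velocity_le ha hδ hw hx
    have h2 := norm_velocity_le ha hw hx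
    have h3 := hF.bound t ht x
    have h4 : ‖regField δ w x‖ ≤ ‖velocity w x‖ + ‖velocity w x - regField δ w x‖ := by
      have := norm_sub_le (velocity w x) (velocity w x - regField δ w x)
      rwa [sub_sub_cancel] at this
    exact (norm_add_le _ _).trans (by linarith)
  div_free := by
    filter_upwards [ae_div_free_of_weak (hF.lipschitzWith ht) (hF.divergence_free t ht)] with x hx hxb
    obtain ⟨B₁, hB₁, hd₁⟩ := regField_div_free ha hδ hw hxb
    obtain ⟨B₂, hB₂, hd₂⟩ := hx (ha.trans hxb.1)
    refine ⟨B₁ + B₂, hB₁.add hB₂, ?_⟩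
    simp only [add_apply, PiLp.add_apply]
    linarith

/-! ### Time averages of the vorticity -/

/-- The average over the times between `s` and `s'`. -/
def timeAvg (W : ℝ → Plane → ℝ) (s s' : ℝ) (y : Plane) : ℝ := (s' - s)⁻¹ * ∫ τ in s..s', W τ y

instance : SFinite angleMeasure := by unfold angleMeasure; infer_instance

section Average

variable {a b m δ s s' : ℝ} {W : ℝ → Plane → ℝ} {x : Plane}

/-- No continuity of the vorticity in time is assumed, so the field of an Euler step is not obtained
by freezing the time. Averaging the vorticity keeps its bounds and, the velocity being linear in it,
reproduces the time integral of the velocity exactly. -/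
lemma isVorticity_timeAvg (hW : Measurable (Function.uncurry W))
    (hv : ∀ τ ∈ uIoc s s', IsVorticity a b m (W τ)) (hm : 0 ≤ m) :
    IsVorticity a b m (timeAvg W s s') where
  measurable := by
    have h : StronglyMeasurable fun y => ∫ τ in uIoc s s', W τ y :=
      hW.stronglyMeasurable.integral_prod_left
    have e : timeAvg W s s' =
        fun y => (s' - s)⁻¹ * ((if s ≤ s' then (1 : ℝ) else -1) * ∫ τ in uIoc s s', W τ y) := by
      ext y; rw [timeAvg, intervalIntegral.intervalIntegral_eq_integral_uIoc]; rfl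
    rw [e]
    exact (h.measurable.const_mul _).const_mul _
  bound y := by
    have h := intervalIntegral.norm_integral_le_of_norm_le_const (f := fun τ => W τ y)
      fun τ hτ => (hv τ hτ).bound y
    rw [timeAvg, abs_mul, abs_inv]
    rcases eq_or_ne (s' - s) 0 with h0 | h0
    · simpa [h0] using hm
    · rw [inv_mul_le_iff₀ (abs_pos.2 h0), mul_comm]; exact h
  support y hy := by
    have : ∫ τ in s..s', W τ y = ∫ τ in s..s', (0 : ℝ) :=
      intervalIntegral.integral_congr_ae
        (Eventually.of_forall fun τ hτ => (hv τ hτ).support y hy)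
    rw [timeAvg, this]; simp

lemma regVel_timeAvg (ha : 0 < a) (hδ : 0 < δ) (hW : Measurable (Function.uncurry W))
    (hv : ∀ τ ∈ uIoc s s', IsVorticity a b m (W τ)) (hx : x ∈ box a b) (i : Fin 2) (hs : s ≠ s') :
    IntervalIntegrable (fun τ => regVel i δ (W τ) x) volume s s' ∧
      (s' - s) * regVel i δ (timeAvg W s s') x = ∫ τ in s..s', regVel i δ (W τ) x := by
  set σ : Measure ℝ := volume.restrict (uIoc s s')
  have : IsFiniteMeasure σ := ⟨by simp [σ, uIoc]⟩
  have hbox : MeasurableSet (box a b) := (isOpen_box a b).measurableSet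
  -- The indicator of the box, multiplied by `m`, dominates every `W τ`, and so supplies the
  -- time-independent majorant for Fubini.
  have hw0 : IsVorticity a b 1 ((box a b).indicator fun _ => 1) :=
    ⟨measurable_const.indicator hbox, fun y => by
      by_cases h : y ∈ box a b <;> simp [h], fun y hy => indicator_of_notMem hy _⟩
  have hint : Integrable (fun p : ℝ × (Plane × ℝ) => kern i δ x p.2.1 p.2.2 * W p.1 p.2.1)
      (σ.prod angleMeasure) := by
    have h1 := ((integrable_kern ha hδ hw0 hx i).norm.const_mul m).comp_snd σ
    refine h1.mono' ?_ ?_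
    · exact (((measurable_kern i δ x).comp measurable_snd).mul
        (hW.comp (measurable_fst.prodMk (measurable_fst.comp measurable_snd)))).aestronglyMeasurable
    · have hae : ∀ᵐ p ∂(σ.prod angleMeasure), p.1 ∈ uIoc s s' :=
        Measure.quasiMeasurePreserving_fst.ae (ae_restrict_mem measurableSet_uIoc)
      filter_upwards [hae] with p hp
      by_cases hy : p.2.1 ∈ box a b
      · have := (hv p.1 hp).bound p.2.1
        rw [norm_mul, norm_mul, indicator_of_mem hy, norm_one, mul_one, mul_comm]
        gcongr
        exact this
      · simp [(hv p.1 hp).support _ hy, indicator_of_notMem hy]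
  have hsm : s' - s ≠ 0 := sub_ne_zero.2 hs.symm
  constructor
  · rw [intervalIntegrable_iff]
    exact hint.integral_prod_left.const_mul _
  · rw [intervalIntegral.intervalIntegral_eq_integral_uIoc]
    simp only [regVel, timeAvg, intervalIntegral.intervalIntegral_eq_integral_uIoc, smul_eq_mul]
    rw [integral_const_mul, integral_integral_swap hint]
    have e : ∀ z : Plane × ℝ, kern i δ x z.1 z.2 * ((s' - s)⁻¹ * ((if s ≤ s' then 1 else -1) *
        ∫ τ in uIoc s s', W τ z.1)) = ((s' - s)⁻¹ * (if s ≤ s' then 1 else -1)) *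
        ∫ τ in uIoc s s', kern i δ x z.1 z.2 * W τ z.1 := fun z => by
      rw [integral_const_mul]; ring
    simp_rw [e]
    rw [integral_const_mul]
    field_simp

lemma regField_timeAvg (ha : 0 < a) (hδ : 0 < δ) (hW : Measurable (Function.uncurry W))
    (hv : ∀ τ ∈ uIoc s s', IsVorticity a b m (W τ)) (hx : x ∈ box a b) (hs : s ≠ s') :
    IntervalIntegrable (fun τ => regField δ (W τ) x) volume s s' ∧
      (s' - s) • regField δ (timeAvg W s s') x = ∫ τ in s..s', regField δ (W τ) x := by
  have h0 := regVel_timeAvg ha hδ hW hv hx 0 hs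
  have h1 := regVel_timeAvg ha hδ hW hv hx 1 hs
  have i0 : IntervalIntegrable (fun τ => regVel 0 δ (W τ) x • unitVec 0) volume s s' :=
    ⟨h0.1.1.smul_const _, h0.1.2.smul_const _⟩
  have i1 : IntervalIntegrable (fun τ => regVel 1 δ (W τ) x • unitVec 1) volume s s' :=
    ⟨h1.1.1.smul_const _, h1.1.2.smul_const _⟩
  refine ⟨i0.add i1, ?_⟩
  simp only [regField]
  rw [intervalIntegral.integral_add i0 i1, intervalIntegral.integral_smul_const,
    intervalIntegral.integral_smul_const, ← h0.2, ← h1.2, smul_add, smul_smul, smul_smul]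

end Average

/-! ### Confined flows and their approximation by step fields -/

/-- A compact set `K` of particles which the reduced flow keeps, up to the time `S`, at distance at
least `ρ` from the boundary of `box a b`, and which carries the vorticity. -/
structure IsConfinedFlow (ε C_F L S a b m ρ : ℝ) (K : Set Plane) (F : ℝ → Plane → Plane)
    (ω : ℝ → Plane → ℝ) (φ : ℝ → Plane → Plane) : Prop where
  field : IsExternalField ε C_F L F
  flow : IsReducedFlow F ω φ
  lower_pos : 0 < a
  margin_pos : 0 < ρ
  bound_nonneg : 0 ≤ m
  compact : IsCompact K
  subset : K ⊆ halfPlane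
  tube : ∀ s ∈ Icc 0 S, ∀ x ∈ K, Metric.closedBall (φ s x) ρ ⊆ box a b
  vorticity : ∀ s ∈ Icc 0 S, IsVorticity a b m (ω s)
  zero_off : ∀ x ∉ K, ω 0 x = 0
  measurable : ∃ W : ℝ → Plane → ℝ, Measurable (Function.uncurry W) ∧ ∀ s, 0 ≤ s → W s = ω s

/-- The map `(t, x) ↦ (t, φ_t x)` is a continuous injection on a Borel set, hence a measurable
embedding (Lusin–Souslin); the transported initial datum then extends measurably by zero. -/
lemma IsReducedFlow.exists_measurable {F : ℝ → Plane → Plane} {ω : ℝ → Plane → ℝ}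
    {φ : ℝ → Plane → Plane} (h : IsReducedFlow F ω φ) (h0 : Measurable (ω 0)) :
    ∃ W : ℝ → Plane → ℝ, Measurable (Function.uncurry W) ∧ ∀ s, 0 ≤ s → W s = ω s := by
  have hopen : MeasurableSet halfPlane :=
    (isOpen_lt continuous_const (continuous_coord 1)).measurableSet
  set D : Set (ℝ × Plane) := Ici 0 ×ˢ halfPlane
  have hD : MeasurableSet D := measurableSet_Ici.prod hopen
  let Θ : ℝ × Plane → ℝ × Plane := fun p => (p.1, φ p.1 p.2)
  have hΘ : MeasurableEmbedding (D.domRestrict Θ) := by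
    refine ContinuousOn.measurableEmbedding hD (continuousOn_fst.prodMk h.continuousOn) ?_
    rintro ⟨t, x⟩ ⟨ht, hx⟩ ⟨t', x'⟩ ⟨ht', hx'⟩ he
    obtain ⟨rfl, he2⟩ := Prod.mk.inj he
    exact Prod.ext rfl ((h.bijOn t ht).injOn hx hx' he2)
  let g : D → ℝ := fun p => φ p.1.1 p.1.2 1 / p.1.2 1 * ω 0 p.1.2
  have hg : Measurable g := by
    have h1 : Measurable fun p : D => φ p.1.1 p.1.2 :=
      (continuousOn_iff_continuous_domRestrict.1 h.continuousOn).measurable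
    have h2 : Measurable fun p : D => p.1.2 := measurable_snd.comp measurable_subtype_coe
    exact (((continuous_coord 1).measurable.comp h1).div
      ((continuous_coord 1).measurable.comp h2)).mul (h0.comp h2)
  refine ⟨fun s y => Function.extend (D.domRestrict Θ) g 0 (s, y),
    hΘ.measurable_extend hg measurable_const, fun s hs => ?_⟩
  ext y
  by_cases hy : y ∈ halfPlane
  · obtain ⟨x, hx, rfl⟩ := (h.bijOn s hs).surjOn hy
    have := hΘ.injective.extend_apply g 0 ⟨(s, x), hs, hx⟩
    exact this.trans (h.transport x hx s hs).symm
  · rw [h.extension s hs y hy]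
    refine (Function.extend_apply' _ _ _ ?_).trans rfl
    rintro ⟨⟨⟨t, x⟩, ht, hx⟩, he⟩
    obtain ⟨rfl, rfl⟩ := Prod.mk.inj he
    exact hy ((h.bijOn t ht).mapsTo hx)

/-- Compactness of `[0, S] × K` bounds the trajectories and keeps them off the axis. The constants
found here depend on the flow; they serve only to justify the transport formula and do not enter the
final estimate. -/
lemma IsReducedFlow.exists_isConfinedFlow {ε C_F L S m₀ : ℝ} {K : Set Plane}
    {F : ℝ → Plane → Plane} {ω : ℝ → Plane → ℝ} {φ : ℝ → Plane → Plane}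
    (h : IsReducedFlow F ω φ) (hF : IsExternalField ε C_F L F) (hK : IsCompact K)
    (hKne : K.Nonempty) (hS : 0 ≤ S)
    (hKh : K ⊆ halfPlane) (h0 : Measurable (ω 0)) (hbd : ∀ x, |ω 0 x| ≤ m₀)
    (hoff : ∀ x ∉ K, ω 0 x = 0) :
    ∃ a b m ρ, IsConfinedFlow ε C_F L S a b m ρ K F ω φ := by
  have hm₀ : 0 ≤ m₀ := (abs_nonneg _).trans (hbd 0)
  have hC : IsCompact (Icc 0 S ×ˢ K) := isCompact_Icc.prod hK
  have hsub : Icc 0 S ×ˢ K ⊆ Ici 0 ×ˢ halfPlane := prod_mono Icc_subset_Ici_self hKh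
  have hcont := h.continuousOn.mono hsub
  have hne : (Icc 0 S ×ˢ K).Nonempty := (nonempty_Icc.2 hS).prod hKne
  obtain ⟨p, hp, hpmin⟩ := hC.exists_isMinOn hne
    ((continuous_coord 1).comp_continuousOn hcont)
  obtain ⟨q, hq, hqmax⟩ := hC.exists_isMaxOn hne hcont.norm
  obtain ⟨k, hk, hkmin⟩ := hK.exists_isMinOn hKne (continuous_coord 1).continuousOn
  set c := φ p.1 p.2 1
  have hc : 0 < c := (h.bijOn p.1 (hsub hp).1).mapsTo (hsub hp).2
  set B := ‖φ q.1 q.2‖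
  have hk0 : 0 < k 1 := hKh hk
  have hlow : ∀ s ∈ Icc 0 S, ∀ x ∈ K, c ≤ φ s x 1 := fun s hs x hx => isMinOn_iff.1 hpmin (s, x) ⟨hs, hx⟩
  have hup : ∀ s ∈ Icc 0 S, ∀ x ∈ K, ‖φ s x‖ ≤ B := fun s hs x hx => isMaxOn_iff.1 hqmax (s, x) ⟨hs, hx⟩
  have hB : 0 ≤ B := norm_nonneg _
  have htube : ∀ s ∈ Icc 0 S, ∀ x ∈ K,
      Metric.closedBall (φ s x) (c / 4) ⊆ box (c / 2) (B + c) := by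
    intro s hs x hx y hy
    rw [mem_closedBall_iff_norm] at hy
    have h1 := hlow s hs x hx
    have h2 := hup s hs x hx
    have h3 := abs_le.1 (abs_coord_le (y - φ s x) 1)
    rw [PiLp.sub_apply] at h3
    refine ⟨show c / 2 < y 1 by linarith [h3.1], mem_ball_zero_iff.2 ?_⟩
    calc ‖y‖ = ‖φ s x + (y - φ s x)‖ := by rw [add_sub_cancel]
      _ ≤ ‖φ s x‖ + ‖y - φ s x‖ := norm_add_le _ _
      _ < B + c := by linarith
  obtain ⟨W, hW, hWω⟩ := h.exists_measurable h0
  refine ⟨c / 2, B + c, B / k 1 * m₀, c / 4, hF, h, by positivity, by positivity, by positivity, hK,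
    hKh, htube, fun s hs => ⟨?_, ?_, ?_⟩, hoff, W, hW, hWω⟩
  · rw [← hWω s hs.1]; exact hW.comp measurable_prodMk_left
  · intro y
    by_cases hy : y ∈ halfPlane
    · obtain ⟨x, hx, rfl⟩ := (h.bijOn s hs.1).surjOn hy
      rw [h.transport x hx s hs.1]
      by_cases hxK : x ∈ K
      · have hx0 : 0 < x 1 := hx
        have h1 : k 1 ≤ x 1 := hkmin hxK
        have h2 : |φ s x 1| ≤ B := (abs_coord_le _ 1).trans (hup s hs x hxK)
        rw [abs_mul, abs_div, abs_of_pos hx0]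
        gcongr
        exact hbd x
      · rw [hoff x hxK]; simp; positivity
    · rw [h.extension s hs.1 y hy]; simp; positivity
  · intro y hy
    by_cases hyh : y ∈ halfPlane
    · obtain ⟨x, hx, rfl⟩ := (h.bijOn s hs.1).surjOn hyh
      rw [h.transport x hx s hs.1, hoff x fun hxK => hy (htube s hs x hxK
        (Metric.mem_closedBall_self (by positivity))), mul_zero]
    · exact h.extension s hs.1 y hyh

/-- For a time span with `2 A D ≤ 1/4`, the Gronwall factor with Lipschitz constant `2 A log((B +
δ)/δ) + L'` grows at most like `δ^(-1/4)`, so the error `√δ` wins. -/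
lemma exists_reg_param (A B D L' E η : ℝ) (hA : 0 ≤ A) (hB : 0 ≤ B) (hD : 0 ≤ D)
    (hE : 0 ≤ E) (hAD : 2 * A * D ≤ 1 / 4) (hη : 0 < η) :
    ∃ δ : ℝ, 0 < δ ∧ δ < 1 ∧
      D * (E * √δ) * Real.exp ((2 * (A * Real.log ((B + δ) / δ)) + L') * D) ≤ η := by
  set c := D * E * Real.exp (2 * A * D * Real.log (B + 1) + L' * D)
  have hlim : Tendsto (fun δ : ℝ => c * δ ^ (1 / 4 : ℝ)) (𝓝 0) (𝓝 (c * 0 ^ (1 / 4 : ℝ))) :=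
    (Real.continuousAt_rpow_const 0 (1 / 4) (Or.inr (by norm_num))).tendsto.const_mul c
  rw [Real.zero_rpow (by norm_num), mul_zero] at hlim
  have hev : ∀ᶠ δ : ℝ in 𝓝[>] 0, c * δ ^ (1 / 4 : ℝ) < η :=
    (hlim.mono_left nhdsWithin_le_nhds).eventually_lt_const hη
  obtain ⟨δ, hδη, hδ, hδ1⟩ := (hev.and (Ioo_mem_nhdsGT (zero_lt_one (α := ℝ)))).exists
  refine ⟨δ, hδ, hδ1, le_trans ?_ hδη.le⟩
  have hlog : Real.log ((B + δ) / δ) ≤ Real.log (B + 1) - Real.log δ := by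
    rw [Real.log_div (by positivity) hδ.ne']
    gcongr
  have hlogδ : Real.log δ ≤ 0 := Real.log_nonpos hδ.le hδ1.le
  have hexp : Real.exp ((2 * (A * Real.log ((B + δ) / δ)) + L') * D) ≤
      Real.exp (2 * A * D * Real.log (B + 1) + L' * D) * δ ^ (-(1 / 4) : ℝ) := by
    rw [Real.rpow_def_of_pos hδ, ← Real.exp_add]
    refine Real.exp_le_exp.2 ?_
    have h1 := mul_le_mul_of_nonneg_left hlog (by positivity : 0 ≤ 2 * A * D)
    nlinarith
  calc D * (E * √δ) * Real.exp ((2 * (A * Real.log ((B + δ) / δ)) + L') * D)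
      ≤ D * (E * √δ) * (Real.exp (2 * A * D * Real.log (B + 1) + L' * D) * δ ^ (-(1 / 4) : ℝ)) := by
        gcongr
    _ = c * (√δ * δ ^ (-(1 / 4) : ℝ)) := by simp only [c]; ring
    _ = c * δ ^ (1 / 4 : ℝ) := by
        rw [Real.sqrt_eq_rpow, ← Real.rpow_add hδ]; norm_num

namespace IsConfinedFlow

variable {ε C_F L S a b m ρ : ℝ} {K : Set Plane} {F : ℝ → Plane → Plane} {ω : ℝ → Plane → ℝ}
  {φ : ℝ → Plane → Plane}

lemma mem_box (h : IsConfinedFlow ε C_F L S a b m ρ K F ω φ)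
    {s : ℝ} (hs : s ∈ Icc 0 S) {x : Plane} (hx : x ∈ K) : φ s x ∈ box a b :=
  h.tube s hs x hx (Metric.mem_closedBall_self h.margin_pos.le)

lemma continuousOn_flow (h : IsConfinedFlow ε C_F L S a b m ρ K F ω φ) :
    ContinuousOn (fun p : ℝ × Plane => φ p.1 p.2) (Icc 0 S ×ˢ K) :=
  h.flow.continuousOn.mono (prod_mono Icc_subset_Ici_self h.subset)

lemma continuousOn_time (h : IsConfinedFlow ε C_F L S a b m ρ K F ω φ)
    {s : ℝ} (hs : s ∈ Icc 0 S) : ContinuousOn (φ s) K :=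
  h.continuousOn_flow.comp (continuousOn_const.prodMk continuousOn_id) fun _ hx => ⟨hs, hx⟩

lemma norm_field_le (h : IsConfinedFlow ε C_F L S a b m ρ K F ω φ)
    {s : ℝ} (hs : s ∈ Icc 0 S) {x : Plane} (hx : x ∈ K) :
    ‖velocity (ω s) (φ s x) + F s (φ s x)‖ ≤ 2 * velBound a b m + C_F / |Real.log ε| :=
  (norm_add_le _ _).trans (add_le_add (norm_velocity_le h.lower_pos (h.vorticity s hs)
    (h.mem_box hs hx)) (h.field.bound s hs.1 _))

lemma norm_flow_sub_le (h : IsConfinedFlow ε C_F L S a b m ρ K F ω φ)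
    {s s' : ℝ} (hs : s ∈ Icc 0 S) (hs' : s' ∈ Icc 0 S) {x : Plane}
    (hx : x ∈ K) : ‖φ s' x - φ s x‖ ≤ (2 * velBound a b m + C_F / |Real.log ε|) * |s' - s| :=
  (convex_Icc 0 S).norm_image_sub_le_of_norm_hasDerivWithin_le (f := fun t => φ t x)
    (fun t ht => (h.flow.ode x (h.subset hx) t ht.1).mono Icc_subset_Ici_self)
    (fun _ ht => h.norm_field_le ht hx) hs hs'

lemma hasDerivAt_flow (h : IsConfinedFlow ε C_F L S a b m ρ K F ω φ)
    {s : ℝ} (hs : 0 < s) {x : Plane} (hx : x ∈ K) :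
    HasDerivAt (fun t => φ t x) (velocity (ω s) (φ s x) + F s (φ s x)) s :=
  (h.flow.ode x (h.subset hx) s hs.le).hasDerivAt (Ici_mem_nhds hs)

/-- The velocity along a trajectory is measurable because it is a derivative, and it is bounded, so
the fundamental theorem applies without continuity in time. -/
lemma integral_field (h : IsConfinedFlow ε C_F L S a b m ρ K F ω φ)
    {s s' : ℝ} (hs : s ∈ Icc 0 S) (hs' : s' ∈ Icc 0 S) {x : Plane}
    (hx : x ∈ K) :
    IntervalIntegrable (fun τ => velocity (ω τ) (φ τ x) + F τ (φ τ x)) volume s s' ∧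
    ∫ τ in s..s', (velocity (ω τ) (φ τ x) + F τ (φ τ x)) = φ s' x - φ s x := by
  have hsub : uIcc s s' ⊆ Icc 0 S := uIcc_subset_Icc hs hs'
  have hpos : ∀ τ ∈ Ioo (min s s') (max s s'), 0 < τ := fun τ hτ =>
    (le_min hs.1 hs'.1).trans_lt hτ.1
  have hint : IntervalIntegrable (fun τ => velocity (ω τ) (φ τ x) + F τ (φ τ x)) volume s s' := by
    rw [intervalIntegrable_iff, uIoc, integrableOn_Ioc_iff_integrableOn_Ioo]
    have h1 : IntegrableOn (deriv fun t => φ t x) (Ioo (min s s') (max s s')) := by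
      refine Measure.integrableOn_of_bounded (M := 2 * velBound a b m + C_F / |Real.log ε|)
        measure_Ioo_lt_top.ne (measurable_deriv _).aestronglyMeasurable ?_
      filter_upwards [ae_restrict_mem measurableSet_Ioo] with τ hτ
      rw [(h.hasDerivAt_flow (hpos τ hτ) hx).deriv]
      exact h.norm_field_le (hsub (Ioo_subset_Icc_self hτ)) hx
    exact h1.congr_fun (fun τ hτ => (h.hasDerivAt_flow (hpos τ hτ) hx).deriv) measurableSet_Ioo
  refine ⟨hint, intervalIntegral.integral_eq_sub_of_hasDeriv_right (f := fun t => φ t x) ?_ ?_ hint⟩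
  · intro τ hτ
    exact ((h.flow.ode x (h.subset hx) τ (hsub hτ).1).continuousWithinAt).mono
      (hsub.trans Icc_subset_Ici_self)
  · exact fun τ hτ => (h.hasDerivAt_flow (hpos τ hτ) hx).hasDerivWithinAt

/-- On short time steps the flow is close to a step along a weighted divergence free field. -/
lemma exists_isStepField (h : IsConfinedFlow ε C_F L S a b m ρ K F ω φ)
    {δ : ℝ} (hδ : 0 < δ) :
    ∃ h₀ > 0, ∀ s ∈ Icc 0 S, ∀ s' ∈ Icc 0 S, |s' - s| ≤ h₀ → ∃ w,
      IsStepField (box a b)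
        (2 * (regLip a b m * Real.log ((2 * b + 4 + δ) / δ)) + L / |Real.log ε|)
        (2 * velBound a b m + 2 * (regErr a b m * √δ) + C_F / |Real.log ε|) w ∧
      ∀ x ∈ K, ‖φ s' x - φ s x - (s' - s) • w (φ s x)‖ ≤
        |s' - s| * ((2 * regErr a b m + 2) * √δ) := by
  set Λ := 2 * (regLip a b m * Real.log ((2 * b + 4 + δ) / δ))
  set V := 2 * velBound a b m + C_F / |Real.log ε|
  have hsδ : 0 < √δ := Real.sqrt_pos.2 hδ
  have hFc : ContinuousOn (fun p : ℝ × Plane => F p.1 (φ p.1 p.2)) (Icc 0 S ×ˢ K) :=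
    h.field.continuousOn.comp (continuousOn_fst.prodMk h.continuousOn_flow)
      fun p hp => ⟨hp.1.1, mem_univ _⟩
  have huc := (isCompact_Icc.prod h.compact).uniformContinuousOn_of_continuous hFc
  obtain ⟨h₁, hh₁, huc1⟩ := Metric.uniformContinuousOn_iff.1 huc (√δ) hsδ
  have hFosc : ∀ s ∈ Icc 0 S, ∀ s' ∈ Icc 0 S, ∀ x ∈ K, |s' - s| < h₁ →
      ‖F s' (φ s' x) - F s (φ s x)‖ ≤ √δ := by
    intro s hs s' hs' x hx hss
    have := huc1 (s', x) ⟨hs', hx⟩ (s, x) ⟨hs, hx⟩ (by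
      rw [Prod.dist_eq, dist_self, Real.dist_eq]; exact max_lt hss hh₁)
    rw [dist_eq_norm] at this
    exact this.le
  obtain ⟨W, hW, hWω⟩ := h.measurable
  -- The first bound keeps the oscillation of `F` along trajectories below `√δ`; the second keeps
  -- `Λ` times the displacement of a particle below `√δ`.
  refine ⟨min (h₁ / 2) (√δ / (|Λ| * |V| + 1)), lt_min (by positivity) (by positivity),
    fun s hs s' hs' hss => ?_⟩
  have hsub : uIcc s s' ⊆ Icc 0 S := uIcc_subset_Icc hs hs'
  have hsub' : uIoc s s' ⊆ Icc 0 S := uIoc_subset_uIcc.trans hsub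
  have hv : ∀ τ ∈ uIoc s s', IsVorticity a b m (W τ) := fun τ hτ => by
    rw [hWω τ (hsub' hτ).1]; exact h.vorticity τ (hsub' hτ)
  refine ⟨fun y => regField δ (timeAvg W s s') y + F s y, isStepField_regField_add h.lower_pos hδ
    (isVorticity_timeAvg hW hv h.bound_nonneg) h.field hs.1, fun x hx => ?_⟩
  rcases eq_or_ne s s' with rfl | hne
  · simp
  obtain ⟨i1, e1⟩ := h.integral_field hs hs' hx
  obtain ⟨i2, e2⟩ := regField_timeAvg h.lower_pos hδ hW hv (h.mem_box hs hx) hne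
  have i3 : IntervalIntegrable (fun _ : ℝ => F s (φ s x)) volume s s' := intervalIntegrable_const
  have e3 : φ s' x - φ s x - (s' - s) • (regField δ (timeAvg W s s') (φ s x) + F s (φ s x)) =
      ∫ τ in s..s', ((velocity (ω τ) (φ τ x) + F τ (φ τ x)) -
        (regField δ (W τ) (φ s x) + F s (φ s x))) := by
    rw [intervalIntegral.integral_sub i1 (i2.add i3), intervalIntegral.integral_add i2 i3, e1,
      ← e2, intervalIntegral.integral_const, smul_add]
  show ‖φ s' x - φ s x - (s' - s) • (regField δ (timeAvg W s s') (φ s x) + F s (φ s x))‖ ≤ _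
  rw [e3, mul_comm]
  refine intervalIntegral.norm_integral_le_of_norm_le_const fun τ hτ => ?_
  have hτS := hsub' hτ
  have hτs : |τ - s| ≤ |s' - s| := by
    have := uIoc_subset_uIcc hτ
    exact abs_sub_left_of_mem_uIcc this
  have hτ0 : |τ - s| ≤ min (h₁ / 2) (√δ / (|Λ| * |V| + 1)) := hτs.trans hss
  rw [hWω τ hτS.1]
  have t1 := norm_regField_sub_velocity_le h.lower_pos hδ (h.vorticity τ hτS) (h.mem_box hτS hx)
  have t2 := norm_regField_sub_le h.lower_pos hδ (h.vorticity τ hτS) (h.mem_box hτS hx)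
    (h.mem_box hs hx)
  have t3 := hFosc s hs τ hτS x hx (hτ0.trans_lt ((min_le_left _ _).trans_lt (by linarith)))
  have t4 := h.norm_flow_sub_le hs hτS hx
  have t5 : Λ * ‖φ τ x - φ s x‖ ≤ √δ := by
    calc Λ * ‖φ τ x - φ s x‖ ≤ |Λ| * (|V| * |τ - s|) := by
          gcongr
          · exact le_abs_self _
          · exact t4.trans (by gcongr; exact le_abs_self _)
      _ ≤ |Λ| * (|V| * (√δ / (|Λ| * |V| + 1))) := by
          gcongr; exact hτ0.trans (min_le_right _ _)
      _ = √δ * (|Λ| * |V| / (|Λ| * |V| + 1)) := by ring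
      _ ≤ √δ * 1 := by
          gcongr
          rw [div_le_one (by positivity)]; linarith
      _ = √δ := mul_one _
  -- Three errors: regularisation of the kernel, displacement of the particle, oscillation of the
  -- external field.
  calc _ = ‖(velocity (ω τ) (φ τ x) - regField δ (ω τ) (φ τ x)) +
        (regField δ (ω τ) (φ τ x) - regField δ (ω τ) (φ s x)) +
        (F τ (φ τ x) - F s (φ s x))‖ := by congr 1; abel
    _ ≤ 2 * (regErr a b m * √δ) + Λ * ‖φ τ x - φ s x‖ + √δ :=
        (norm_add_le _ _).trans (add_le_add ((norm_add_le _ _).trans (add_le_add t1 t2)) t3)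
    _ ≤ _ := by linarith

end IsConfinedFlow

/-! ### Symmetries of the radial kernel -/

/-- Angular integral of the radial component of the Biot–Savart kernel. -/
def radialKernel (x y : Plane) : ℝ := ∫ θ in Ioc 0 Real.pi, kern 1 0 x y θ

lemma den_comm (δ : ℝ) (x y : Plane) (θ : ℝ) : den δ x y θ = den δ y x θ := by
  unfold den bracket
  rw [norm_sub_rev]; ring_nf

lemma measurable_kern_joint (i : Fin 2) (δ : ℝ) :
    Measurable fun p : Plane × (Plane × ℝ) => kern i δ p.1 p.2.1 p.2.2 := by
  have h1 := continuous_coord 1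
  have h0 := continuous_coord 0
  have hn : Continuous fun p : Plane × (Plane × ℝ) => num i p.1 p.2.1 p.2.2 := by
    fin_cases i
    · show Continuous fun p : Plane × (Plane × ℝ) =>
        p.2.1 1 * (p.2.1 1 - p.1 1 * Real.cos p.2.2)
      fun_prop
    · show Continuous fun p : Plane × (Plane × ℝ) =>
        p.2.1 1 * (p.1 0 - p.2.1 0) * Real.cos p.2.2
      fun_prop
  have hd : Continuous fun p : Plane × (Plane × ℝ) => den δ p.1 p.2.1 p.2.2 := by
    unfold den bracket; fun_prop
  exact hn.measurable.div (hd.measurable.pow_const 3)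

lemma measurable_regVel (i : Fin 2) (δ : ℝ) {w : Plane → ℝ} (hw : Measurable w) :
    Measurable (regVel i δ w) := by
  have h : StronglyMeasurable fun x => ∫ z, kern i δ x z.1 z.2 * w z.1 ∂angleMeasure :=
    StronglyMeasurable.integral_prod_right (((measurable_kern_joint i δ).mul
      (hw.comp (measurable_fst.comp measurable_snd))).stronglyMeasurable)
  exact h.measurable.const_mul _

section

variable {a b m m₁ m₂ : ℝ} {w w₁ w₂ : Plane → ℝ}

lemma integral_regVel_mul (ha : 0 < a) (h₁ : IsVorticity a b m₁ w₁) (h₂ : IsVorticity a b m₂ w₂) :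
    Integrable (fun p : Plane × Plane => radialKernel p.1 p.2 * w₂ p.2 * w₁ p.1)
      (volume.prod volume) ∧
    ∫ x, regVel 1 0 w₂ x * w₁ x = 1 / (2 * Real.pi) *
      ∫ p : Plane × Plane, radialKernel p.1 p.2 * w₂ p.2 * w₁ p.1 ∂(volume.prod volume) := by
  have hmeas : Measurable fun p : Plane × (Plane × ℝ) =>
      kern 1 0 p.1 p.2.1 p.2.2 * w₂ p.2.1 * w₁ p.1 :=
    ((measurable_kern_joint 1 0).mul (h₂.measurable.comp
      (measurable_fst.comp measurable_snd))).mul (h₁.measurable.comp measurable_fst)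
  have hint : Integrable (fun p : Plane × (Plane × ℝ) =>
      kern 1 0 p.1 p.2.1 p.2.2 * w₂ p.2.1 * w₁ p.1) (volume.prod angleMeasure) := by
    refine (integrable_prod_iff hmeas.aestronglyMeasurable).2 ⟨Eventually.of_forall fun x => ?_, ?_⟩
    · by_cases hx : x ∈ box a b
      · exact Integrable.mul_const (integrable_kern_zero ha h₂ hx 1).1 (w₁ x)
      · simp [h₁.support x hx]
    · refine (h₁.integrable.abs.const_mul (velBound a b m₂)).mono'
        hmeas.norm.stronglyMeasurable.integral_prod_right'.aestronglyMeasurable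
        (Eventually.of_forall fun x => ?_)
      by_cases hx : x ∈ box a b
      · have := (integrable_kern_zero ha h₂ hx 1).2
        simp only [norm_mul, integral_mul_const]
        rw [norm_norm, Real.norm_eq_abs (w₁ x)]
        refine mul_le_mul_of_nonneg_right ?_ (abs_nonneg _)
        rw [Real.norm_of_nonneg (integral_nonneg fun z => by positivity)]
        simpa only [Real.norm_eq_abs, abs_mul, velBound] using this
      · simp [h₁.support x hx]
  have hassoc : Integrable (fun q : (Plane × Plane) × ℝ =>
      kern 1 0 q.1.1 q.1.2 q.2 * w₂ q.1.2 * w₁ q.1.1)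
      ((volume.prod volume).prod (volume.restrict (Ioc 0 Real.pi))) :=
    (measurePreserving_prodAssoc volume volume
      (volume.restrict (Ioc 0 Real.pi))).integrable_comp_of_integrable hint
  have hpair : Integrable (fun p : Plane × Plane => radialKernel p.1 p.2 * w₂ p.2 * w₁ p.1)
      (volume.prod volume) := by
    refine hassoc.integral_prod_left.congr (Eventually.of_forall fun p => ?_)
    simp only [integral_mul_const, radialKernel]
  refine ⟨hpair, ?_⟩
  rw [integral_prod _ hpair, ← integral_const_mul]
  refine integral_congr_ae (Eventually.of_forall fun x => ?_)
  show regVel 1 0 w₂ x * w₁ x = 1 / (2 * Real.pi) * ∫ y, radialKernel x y * w₂ y * w₁ x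
  by_cases hx : x ∈ box a b
  · rw [regVel, angleMeasure, integral_prod _ (integrable_kern_zero ha h₂ hx 1).1,
      integral_mul_const, mul_assoc]
    simp only [integral_mul_const, radialKernel]
  · simp [h₁.support x hx]

/-- Conservation of the second radial moment by the self-induced velocity. -/
lemma integral_coord_mul_regVel (ha : 0 < a) (hw : IsVorticity a b m w) :
    ∫ x, x 1 * regVel 1 0 w x * w x = 0 := by
  have h₁ : IsVorticity a b (|b| * m) fun x => x 1 * w x := by
    refine ⟨(continuous_coord 1).measurable.mul hw.measurable, fun y => ?_, fun y hy => by
      rw [hw.support y hy, mul_zero]⟩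
    have hm : 0 ≤ m := (abs_nonneg _).trans (hw.bound y)
    by_cases hy : y ∈ box a b
    · rw [abs_mul]
      refine mul_le_mul ?_ (hw.bound y) (abs_nonneg _) (abs_nonneg _)
      · exact ((abs_coord_le y 1).trans (norm_lt_of_mem_box hy).le).trans (le_abs_self b)
    · rw [hw.support y hy, mul_zero, abs_zero]; positivity
  obtain ⟨hi, he⟩ := integral_regVel_mul ha h₁ hw
  have e : ∀ x, x 1 * regVel 1 0 w x * w x = regVel 1 0 w x * (x 1 * w x) := fun x => by ring
  simp_rw [e]
  rw [he]
  set g : Plane × Plane → ℝ := fun p => radialKernel p.1 p.2 * w p.2 * (p.1 1 * w p.1)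
  have hanti : ∀ p : Plane × Plane, g p.swap = -g p := by
    rintro ⟨x, y⟩
    -- The product of `x₂` with the kernel is the angular integral of `x₂ y₂ (x₁ - y₁) cos θ /
    -- den³`, where only `x₁ - y₁` changes sign under exchange.
    have : radialKernel y x * y 1 = -(radialKernel x y * x 1) := by
      rw [radialKernel, radialKernel, ← integral_mul_const, ← integral_mul_const, ← integral_neg]
      congr 1; ext θ
      simp only [kern, den_comm 0 y x]
      simp [num]
      ring
    simp only [g, Prod.fst_swap, Prod.snd_swap]
    linear_combination w x * w y * this
  have hswap : ∫ p, g p.swap ∂((volume : Measure Plane).prod volume) =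
      ∫ p, g p ∂((volume : Measure Plane).prod volume) := integral_prod_swap g
  simp_rw [hanti] at hswap
  rw [integral_neg] at hswap
  have : ∫ p, g p ∂((volume : Measure Plane).prod volume) = 0 := by linarith
  rw [this, mul_zero]

/-- The integrand has the primitive `θ / √(r² + β² θ²)`, which is at most `1 / β` whatever `r` is.
-/
lemma integral_sq_div_cube_le {r β : ℝ} (hr : 0 < r) (hβ : 0 < β) (c : ℝ) :
    ∫ θ in (0:ℝ)..c, r ^ 2 / √(r ^ 2 + β ^ 2 * θ ^ 2) ^ 3 ≤ 1 / β := by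
  have hpos : ∀ θ : ℝ, 0 < r ^ 2 + β ^ 2 * θ ^ 2 := fun θ => by positivity
  have hspos : ∀ θ : ℝ, 0 < √(r ^ 2 + β ^ 2 * θ ^ 2) := fun θ => Real.sqrt_pos.2 (hpos θ)
  have hder : ∀ θ : ℝ, HasDerivAt (fun θ => θ / √(r ^ 2 + β ^ 2 * θ ^ 2))
      (r ^ 2 / √(r ^ 2 + β ^ 2 * θ ^ 2) ^ 3) θ := by
    intro θ
    have h1 : HasDerivAt (fun θ => r ^ 2 + β ^ 2 * θ ^ 2) (β ^ 2 * (2 * θ)) θ := by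
      simpa using ((hasDerivAt_pow 2 θ).const_mul (β ^ 2)).const_add (r ^ 2)
    refine ((hasDerivAt_id θ).div (h1.sqrt (hpos θ).ne') (hspos θ).ne').congr_deriv ?_
    have hs := Real.sq_sqrt (hpos θ).le
    have := (hspos θ).ne'
    set s := √(r ^ 2 + β ^ 2 * θ ^ 2)
    simp only [id]
    field_simp
    linear_combination hs
  have hc : Continuous fun θ : ℝ => r ^ 2 / √(r ^ 2 + β ^ 2 * θ ^ 2) ^ 3 :=
    continuous_const.div (by fun_prop) fun θ => (pow_pos (hspos θ) 3).ne'
  rw [intervalIntegral.integral_eq_sub_of_hasDerivAt (fun θ _ => hder θ)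
    (hc.intervalIntegrable _ _), zero_div, sub_zero, div_le_div_iff₀ (hspos c) hβ, one_mul]
  refine Real.le_sqrt_of_sq_le ?_
  nlinarith [sq_nonneg r]

/-- The sum has numerator `(x₁ - y₁)(y₂ - x₂) cos θ`, quadratic in the distance, and the cubic
denominator costs exactly two powers of the distance after the angular integration. Hence the bound
is uniform up to the diagonal. -/
lemma abs_radialKernel_add_le (ha : 0 < a) {x y : Plane} (hx : x ∈ box a b) (hy : y ∈ box a b) :
    |radialKernel x y + radialKernel y x| ≤ Real.pi / (2 * a) := by
  have hpi := Real.pi_pos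
  rcases eq_or_ne x y with rfl | hne
  · have : radialKernel x x = 0 := by simp [radialKernel, kern, num]
    rw [this]; simp; positivity
  set r := ‖x - y‖
  have hr : 0 < r := norm_pos_iff.2 (sub_ne_zero.2 hne)
  set β := 2 * a / Real.pi
  have hβ : 0 < β := by positivity
  have hdlow : ∀ θ ∈ Ioc 0 Real.pi, √(r ^ 2 + β ^ 2 * θ ^ 2) ≤ den 0 x y θ := by
    intro θ hθ
    refine Real.sqrt_le_sqrt ?_
    have h0 := two_mul_sq_mul_le_bracket ha hx hy θ
    have h2 : Real.cos θ ≤ 1 - 2 / Real.pi ^ 2 * θ ^ 2 :=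
      Real.cos_le_one_sub_mul_cos_sq (by rw [abs_of_pos hθ.1]; exact hθ.2)
    have h3 : β ^ 2 * θ ^ 2 = 2 * a ^ 2 * (2 / Real.pi ^ 2 * θ ^ 2) := by simp only [β]; ring
    rw [h3]
    nlinarith [mul_le_mul_of_nonneg_left (le_sub_comm.1 h2) (by positivity : (0:ℝ) ≤ 2 * a ^ 2)]
  have hdpos : ∀ θ, 0 < den 0 x y θ := fun θ => hr.trans_le (norm_sub_le_den ha hx hy)
  have hdc : Continuous fun θ => den 0 x y θ := by unfold den bracket; fun_prop
  have hk : ∀ x' y', (∀ θ, den 0 x' y' θ = den 0 x y θ) → Continuous fun θ => kern 1 0 x' y' θ := by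
    intro x' y' he
    have : Continuous fun θ => num 1 x' y' θ := by
      show Continuous fun θ => y' 1 * (x' 0 - y' 0) * Real.cos θ
      fun_prop
    simp only [kern, he]
    exact this.div (hdc.pow 3) fun θ => (pow_pos (hdpos θ) 3).ne'
  have i1 : IntegrableOn (fun θ => kern 1 0 x y θ) (Ioc 0 Real.pi) :=
    (hk x y fun _ => rfl).integrableOn_Ioc
  have i2 : IntegrableOn (fun θ => kern 1 0 y x θ) (Ioc 0 Real.pi) :=
    (hk y x fun θ => den_comm 0 y x θ).integrableOn_Ioc
  rw [radialKernel, radialKernel, ← integral_add i1 i2]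
  have hmaj : Continuous fun θ : ℝ => r ^ 2 / √(r ^ 2 + β ^ 2 * θ ^ 2) ^ 3 :=
    continuous_const.div (by fun_prop) fun θ => by positivity
  calc |∫ θ in Ioc 0 Real.pi, (kern 1 0 x y θ + kern 1 0 y x θ)|
      ≤ ∫ θ in Ioc 0 Real.pi, r ^ 2 / √(r ^ 2 + β ^ 2 * θ ^ 2) ^ 3 := by
        rw [← Real.norm_eq_abs]
        refine norm_integral_le_of_norm_le (μ := volume.restrict (Ioc 0 Real.pi))
          hmaj.integrableOn_Ioc ?_
        filter_upwards [ae_restrict_mem measurableSet_Ioc] with θ hθ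
        have e : kern 1 0 x y θ + kern 1 0 y x θ =
            (x - y) 0 * (-(x - y) 1) * Real.cos θ / den 0 x y θ ^ 3 := by
          simp only [kern, den_comm 0 y x]
          simp [num]
          ring
        have hs : 0 < √(r ^ 2 + β ^ 2 * θ ^ 2) := Real.sqrt_pos.2 (by positivity)
        rw [e, Real.norm_eq_abs, abs_div, abs_of_pos (pow_pos (hdpos θ) 3), abs_mul, abs_mul]
        have n0 : |(x - y) 0| ≤ r := abs_coord_le _ 0
        have n1 : |-(x - y) 1| ≤ r := by rw [abs_neg]; exact abs_coord_le _ 1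
        have nc := Real.abs_cos_le_one θ
        calc |(x - y) 0| * |-(x - y) 1| * |Real.cos θ| / den 0 x y θ ^ 3
            ≤ r * r * 1 / √(r ^ 2 + β ^ 2 * θ ^ 2) ^ 3 := by
              gcongr
              exact hdlow θ hθ
          _ = _ := by ring
    _ = ∫ θ in (0:ℝ)..Real.pi, r ^ 2 / √(r ^ 2 + β ^ 2 * θ ^ 2) ^ 3 :=
        (intervalIntegral.integral_of_le hpi.le).symm
    _ ≤ 1 / β := integral_sq_div_cube_le hr hβ _
    _ = Real.pi / (2 * a) := by simp only [β]; field_simp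

/-- Averaging the double integral with its swap brings in the bounded symmetrised kernel, and the
square of the mass follows. The bound uses the radial distance `α` of the actual support instead of
`a`, so that it depends only on the strip. -/
lemma abs_integral_regVel_le {α : ℝ} (ha : 0 < a) (hα : 0 < α) (hw : IsVorticity a b m w)
    (hw0 : ∀ x, 0 ≤ w x) (hsupp : ∀ x, w x ≠ 0 → α < x 1) :
    |∫ x, regVel 1 0 w x * w x| ≤ Real.pi / (2 * α) * (∫ x, w x) ^ 2 := by
  have hpi := Real.pi_gt_three
  obtain ⟨hi, he⟩ := integral_regVel_mul ha hw hw
  set g : Plane × Plane → ℝ := fun p => radialKernel p.1 p.2 * w p.2 * w p.1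
  have hswap : ∫ p, g p.swap ∂((volume : Measure Plane).prod volume) =
      ∫ p, g p ∂((volume : Measure Plane).prod volume) := integral_prod_swap g
  have hsum : ∫ p, (g p + g p.swap) ∂((volume : Measure Plane).prod volume) =
      2 * ∫ p, g p ∂((volume : Measure Plane).prod volume) := by
    rw [integral_add hi (show Integrable (fun p => g p.swap) _ from hi.swap), hswap]; ring
  have hbox : ∀ x, w x ≠ 0 → x ∈ box α b := fun x hx =>
    ⟨hsupp x hx, by by_contra h; exact hx (hw.support x fun hb => h hb.2)⟩
  have hmul : ∫ p : Plane × Plane, Real.pi / (2 * α) * (w p.1 * w p.2)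
      ∂((volume : Measure Plane).prod volume) = Real.pi / (2 * α) * (∫ x, w x) ^ 2 := by
    rw [integral_const_mul, integral_prod_mul w w, sq]
  have hle : |∫ p, (g p + g p.swap) ∂((volume : Measure Plane).prod volume)| ≤
      Real.pi / (2 * α) * (∫ x, w x) ^ 2 := by
    rw [← hmul, ← Real.norm_eq_abs]
    refine norm_integral_le_of_norm_le
      (Integrable.const_mul (hw.integrable.mul_prod hw.integrable) (Real.pi / (2 * α)))
      (Eventually.of_forall ?_)
    rintro ⟨x, y⟩
    have e : g (x, y) + g (x, y).swap = (radialKernel x y + radialKernel y x) * (w x * w y) := by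
      simp only [g, Prod.swap_prod_mk]; ring
    rw [e, Real.norm_eq_abs, abs_mul, abs_of_nonneg (mul_nonneg (hw0 x) (hw0 y))]
    by_cases hxy : w x * w y = 0
    · simp [hxy]
    · exact mul_le_mul_of_nonneg_right (abs_radialKernel_add_le hα
        (hbox x (left_ne_zero_of_mul hxy)) (hbox y (right_ne_zero_of_mul hxy)))
        (mul_nonneg (hw0 x) (hw0 y))
  rw [hsum, abs_mul, abs_two] at hle
  rw [he, abs_mul, abs_of_pos (by positivity)]
  refine le_trans (mul_le_of_le_one_left (abs_nonneg _) ?_) ?_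
  · rw [div_le_one (by positivity)]; linarith
  · linarith [abs_nonneg (∫ p, g p ∂((volume : Measure Plane).prod volume))]

end

/-! ### Invariance of the ring volume and transport of the vorticity -/

namespace IsConfinedFlow

variable {ε C_F L S a b m ρ : ℝ} {K : Set Plane} {F : ℝ → Plane → Plane} {ω : ℝ → Plane → ℝ}
  {φ : ℝ → Plane → Plane}

lemma upper_pos (h : IsConfinedFlow ε C_F L S a b m ρ K F ω φ) {s : ℝ} (hs : s ∈ Icc 0 S)
    {x : Plane} (hx : x ∈ K) : 0 < b :=
  (norm_nonneg _).trans_lt (norm_lt_of_mem_box (h.mem_box hs hx))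

lemma lip_nonneg (h : IsConfinedFlow ε C_F L S a b m ρ K F ω φ) : 0 ≤ L / |Real.log ε| := by
  have h1 := (norm_nonneg _).trans (h.field.lipschitz 0 le_rfl (unitVec 0) 0)
  rwa [sub_zero, norm_unitVec, mul_one] at h1

/-- The admissible time span is the one that `exists_reg_param` requires. It is uniform over `[0,
S]`, and `p` and `q` come in either order. -/
lemma ringVolume_image_le (h : IsConfinedFlow ε C_F L S a b m ρ K F ω φ) {p q : ℝ}
    (hp : p ∈ Icc 0 S) (hq : q ∈ Icc 0 S) (hpq : |q - p| ≤ 1 / (8 * (regLip a b m + 1)))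
    {A : Set Plane} (hA : IsCompact A) (hAK : A ⊆ K) :
    ringVolume (φ p '' A) ≤ ringVolume (φ q '' A) := by
  rcases A.eq_empty_or_nonempty with rfl | ⟨x₀, hx₀⟩
  · simp
  have hb := h.upper_pos hp (hAK hx₀)
  have ha := h.lower_pos
  have hm := h.bound_nonneg
  have hc := lowerConst_pos ha
  have hP := powerIntegral_nonneg b
  have hbv : 0 ≤ ballVolume := measureReal_nonneg
  have hA0 : 0 ≤ regLip a b m := by unfold regLip; positivity
  have hE0 : 0 ≤ regErr a b m := by unfold regErr; positivity
  have hV0 : 0 ≤ velBound a b m := by unfold velBound; positivity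
  have hL0 := h.lip_nonneg
  have hC0 : 0 ≤ C_F / |Real.log ε| := (norm_nonneg _).trans (h.field.bound 0 le_rfl 0)
  have hsub : uIcc p q ⊆ Icc 0 S := uIcc_subset_Icc hp hq
  refine ringVolume_image_le_of_approx (X := φ) (isOpen_box a b) ha
    (fun x hx => le_of_lt hx.1) (fun x hx => (coord_lt_of_mem_box hx).le) h.margin_pos hA
    ((h.continuousOn_time hp).mono hAK) ((h.continuousOn_time hq).mono hAK)
    (fun s hs x hx => h.tube s (hsub hs) x (hAK hx)) fun η hη => ?_
  have hAD : 2 * regLip a b m * |q - p| ≤ 1 / 4 := by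
    calc 2 * regLip a b m * |q - p| ≤ 2 * (regLip a b m + 1) * (1 / (8 * (regLip a b m + 1))) := by
          gcongr; linarith
      _ = 1 / 4 := by field_simp; norm_num
  obtain ⟨δ, hδ, hδ1, hsmall⟩ := exists_reg_param (regLip a b m) (2 * b + 4) |q - p|
    (L / |Real.log ε|) (2 * regErr a b m + 2) η hA0 (by positivity) (abs_nonneg _) (by positivity)
    hAD hη
  obtain ⟨h₀, hh₀, hstep⟩ := h.exists_isStepField hδ
  have hlog : 0 ≤ Real.log ((2 * b + 4 + δ) / δ) :=
    Real.log_nonneg (by rw [le_div_iff₀ hδ]; linarith)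
  refine ⟨_, 2 * velBound a b m + 2 * (regErr a b m * √δ) + C_F / |Real.log ε|,
    (2 * regErr a b m + 2) * √δ, h₀, by positivity, by positivity, by positivity, hh₀,
    hsmall, fun s hs s' hs' hss => ?_⟩
  obtain ⟨w, hw, hwx⟩ := hstep s (hsub hs) s' (hsub hs') hss
  exact ⟨w, hw, fun x hx => hwx x (hAK hx)⟩

/-- The flow preserves the ring volume. -/
lemma ringVolume_image (h : IsConfinedFlow ε C_F L S a b m ρ K F ω φ) {A : Set Plane}
    (hA : IsCompact A) (hAK : A ⊆ K) {t : ℝ} (ht : t ∈ Icc 0 S) :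
    ringVolume (φ t '' A) = ringVolume A := by
  rcases A.eq_empty_or_nonempty with rfl | ⟨x₀, hx₀⟩
  · simp
  have hb := h.upper_pos ht (hAK hx₀)
  have ha := h.lower_pos
  have hm := h.bound_nonneg
  have hc := lowerConst_pos ha
  have hbv : 0 ≤ ballVolume := measureReal_nonneg
  have hA0 : 0 ≤ regLip a b m := by unfold regLip; positivity
  set τ := 1 / (8 * (regLip a b m + 1))
  have hτ : 0 < τ := by positivity
  have hind : ∀ n : ℕ, ∀ t ∈ Icc 0 S, t ≤ n * τ → ringVolume (φ t '' A) = ringVolume A := by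
    intro n
    induction n with
    | zero =>
      intro t ht htn
      have ht0 : t = 0 := le_antisymm (by simpa using htn) ht.1
      have : φ t '' A = id '' A := image_congr fun x hx => by
        rw [ht0]; exact h.flow.initial x (h.subset (hAK hx))
      rw [this, image_id]
    | succ n ih =>
      intro t ht htn
      push_cast at htn
      have hs : max 0 (t - τ) ∈ Icc 0 S :=
        ⟨le_max_left _ _, max_le (ht.1.trans ht.2) (by linarith [ht.2])⟩
      have hts : |t - max 0 (t - τ)| ≤ τ := by
        rw [abs_of_nonneg (sub_nonneg.2 (max_le ht.1 (by linarith)))]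
        linarith [le_max_right 0 (t - τ)]
      rw [← ih _ hs (max_le (by positivity) (by linarith))]
      -- The same inequality, run backward and forward in time, gives equality.
      refine le_antisymm (h.ringVolume_image_le ht hs ?_ hA hAK)
        (h.ringVolume_image_le hs ht hts hA hAK)
      rwa [abs_sub_comm]
  obtain ⟨n, hn⟩ := exists_nat_ge (t / τ)
  exact hind n t ht ((div_le_iff₀ hτ).1 hn)

/-- Closed sets form a generating π-system, and the preimage in `K` of a closed set is compact, so
invariance on compact sets suffices. -/
lemma map_restrict_ringVolume (h : IsConfinedFlow ε C_F L S a b m ρ K F ω φ) {t : ℝ}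
    (ht : t ∈ Icc 0 S) :
    (ringVolume.restrict K).map (φ t) = ringVolume.restrict (φ t '' K) := by
  have hcont := h.continuousOn_time ht
  have hKm := h.compact.measurableSet
  have himc := h.compact.image_of_continuousOn hcont
  have hφ : AEMeasurable (φ t) (ringVolume.restrict K) := hcont.aemeasurable hKm
  have hcl : ∀ C : Set Plane, IsClosed C →
      (ringVolume.restrict K).map (φ t) C = ringVolume.restrict (φ t '' K) C := by
    intro C hC
    have hA : IsCompact (K ∩ φ t ⁻¹' C) := by
      obtain ⟨U, hU, hUe⟩ := continuousOn_iff_isClosed.1 hcont C hC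
      have e : K ∩ φ t ⁻¹' C = K ∩ U := by rw [inter_comm, hUe, inter_comm]
      rw [e]; exact h.compact.inter_right hU
    rw [Measure.map_apply_of_aemeasurable hφ hC.measurableSet, Measure.restrict_apply' hKm,
      Measure.restrict_apply hC.measurableSet, inter_comm, ← h.ringVolume_image hA inter_subset_left
      ht, image_inter_preimage, inter_comm]
  have : IsFiniteMeasure (ringVolume.restrict K) :=
    ⟨by rw [Measure.restrict_apply_univ]; exact h.compact.measure_lt_top⟩
  refine ext_of_generate_finite _ (BorelSpace.measurable_eq.trans borel_eq_generateFrom_isClosed)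
    isPiSystem_isClosed (fun C hC => hcl C hC) (hcl univ isClosed_univ)

lemma integral_ringVolume (A : Set Plane) (hA : MeasurableSet A) (hA0 : ∀ x ∈ A, 0 < x 1)
    (f : Plane → ℝ) : ∫ x in A, f x / x 1 ∂ringVolume = ∫ x in A, f x := by
  rw [ringVolume, restrict_withDensity hA, integral_withDensity_eq_integral_toReal_smul]
  · refine setIntegral_congr_fun hA fun x hx => ?_
    have := hA0 x hx
    simp only [ENNReal.toReal_ofReal this.le, smul_eq_mul]
    field_simp
  · exact (continuous_coord 1).measurable.ennreal_ofReal
  · exact Eventually.of_forall fun x => ENNReal.ofReal_lt_top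

lemma vorticity_eq_zero (h : IsConfinedFlow ε C_F L S a b m ρ K F ω φ) {t : ℝ} (ht : t ∈ Icc 0 S)
    {y : Plane} (hy : y ∉ φ t '' K) : ω t y = 0 := by
  by_cases hyh : y ∈ halfPlane
  · obtain ⟨x, hx, rfl⟩ := (h.flow.bijOn t ht.1).surjOn hyh
    rw [h.flow.transport x hx t ht.1, h.zero_off x fun hxK => hy ⟨x, hxK, rfl⟩, mul_zero]
  · exact h.flow.extension t ht.1 y hyh

/-- The vorticity is transported by the flow. -/
lemma integral_mul_vorticity (h : IsConfinedFlow ε C_F L S a b m ρ K F ω φ) {t : ℝ}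
    (ht : t ∈ Icc 0 S) {f : Plane → ℝ} (hf : Measurable f) :
    ∫ x, f x * ω t x = ∫ x, f (φ t x) * ω 0 x := by
  have hcont := h.continuousOn_time ht
  have hKm := h.compact.measurableSet
  have himm := (h.compact.image_of_continuousOn hcont).measurableSet
  have hpos : ∀ x ∈ φ t '' K, 0 < x 1 := by
    rintro _ ⟨x, hx, rfl⟩; exact h.lower_pos.trans (h.mem_box ht hx).1
  have h1 : ∫ x, f x * ω t x = ∫ x in φ t '' K, f x * ω t x :=
    (setIntegral_eq_integral_of_forall_compl_eq_zero fun x hx => by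
      rw [h.vorticity_eq_zero ht hx, mul_zero]).symm
  have h2 : ∫ x, f (φ t x) * ω 0 x = ∫ x in K, f (φ t x) * ω 0 x :=
    (setIntegral_eq_integral_of_forall_compl_eq_zero fun x hx => by
      rw [h.zero_off x hx, mul_zero]).symm
  have hg : Measurable fun x => f x * ω t x / x 1 :=
    (hf.mul (h.vorticity t ht).measurable).div (continuous_coord 1).measurable
  -- Against `x₂ dx` the density is `ω / x₂`, which trajectories conserve, while the measure itself
  -- is invariant.
  rw [h1, h2, ← integral_ringVolume _ himm hpos, ← h.map_restrict_ringVolume ht,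
    integral_map (hcont.aemeasurable hKm) hg.aestronglyMeasurable,
    ← integral_ringVolume _ hKm h.subset]
  refine setIntegral_congr_fun hKm fun x hx => ?_
  have hx0 : 0 < x 1 := h.subset hx
  have hφ0 := hpos _ (mem_image_of_mem _ hx)
  simp only [h.flow.transport x (h.subset hx) t ht.1]
  field_simp

end IsConfinedFlow

/-! ### Time regularity of the radial moments -/

namespace IsConfinedFlow

variable {ε C_F L S a b m ρ : ℝ} {K : Set Plane} {F : ℝ → Plane → Plane} {ω : ℝ → Plane → ℝ}
  {φ : ℝ → Plane → Plane}

lemma integrable_mul_initial (h : IsConfinedFlow ε C_F L S a b m ρ K F ω φ) (hS : 0 ≤ S)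
    {G : Plane → ℝ} {c : ℝ} (hG : AEMeasurable G (volume.restrict K))
    (hc : ∀ x ∈ K, |G x| ≤ c) : Integrable fun x => G x * ω 0 x := by
  have hi : IntegrableOn (fun x => G x * ω 0 x) K :=
    ((h.vorticity 0 ⟨le_rfl, hS⟩).integrable.integrableOn (s := K)).bdd_mul
      hG.aestronglyMeasurable (by
        filter_upwards [ae_restrict_mem h.compact.measurableSet] with x hx using hc x hx)
  exact (integrableOn_iff_integrable_of_support_subset fun x hx => by
    by_contra hxK; exact hx (by simp [h.zero_off x hxK])).1 hi

lemma abs_radial_le (h : IsConfinedFlow ε C_F L S a b m ρ K F ω φ) {s : ℝ} (hs : s ∈ Icc 0 S)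
    {x : Plane} (hx : x ∈ K) : φ s x 1 ∈ Icc (-b) b :=
  abs_le.1 ((abs_coord_le _ 1).trans (norm_lt_of_mem_box (h.mem_box hs hx)).le)

lemma exists_abs_le {g : ℝ → ℝ} (hg : Continuous g) (b : ℝ) :
    ∃ c, ∀ r ∈ Icc (-b) b, |g r| ≤ c := by
  obtain ⟨c, hc⟩ := (isCompact_Icc (a := -b) (b := b)).exists_bound_of_continuousOn hg.continuousOn
  exact ⟨c, hc⟩

lemma continuousOn_radial (h : IsConfinedFlow ε C_F L S a b m ρ K F ω φ) {s : ℝ}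
    (hs : s ∈ Icc 0 S) : ContinuousOn (fun x => φ s x 1) K :=
  (continuous_coord 1).comp_continuousOn (h.continuousOn_time hs)

lemma continuousOn_moment (h : IsConfinedFlow ε C_F L S a b m ρ K F ω φ) {f : ℝ → ℝ}
    (hf : Continuous f) : ContinuousOn (fun s => ∫ x, f (x 1) * ω s x) (Icc 0 S) := by
  rcases lt_or_ge S 0 with hS | hS
  · simp [Icc_eq_empty_of_lt hS]
  obtain ⟨c, hc⟩ := exists_abs_le hf b
  have hc1 : ContinuousOn (fun s => ∫ x, f (φ s x 1) * ω 0 x) (Icc 0 S) := by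
    refine continuousOn_of_dominated (bound := fun x => c * |ω 0 x|) (fun s hs => ?_)
      (fun s hs => Eventually.of_forall fun x => ?_)
      ((h.vorticity 0 ⟨le_rfl, hS⟩).integrable.abs.const_mul c)
      (Eventually.of_forall fun x => ?_)
    · exact (h.integrable_mul_initial hS ((hf.comp_continuousOn
        (h.continuousOn_radial hs)).aemeasurable h.compact.measurableSet)
        fun x hx => hc _ (h.abs_radial_le hs hx)).aestronglyMeasurable
    · by_cases hx : x ∈ K
      · rw [norm_mul]
        exact mul_le_mul_of_nonneg_right (hc _ (h.abs_radial_le hs hx)) (abs_nonneg _)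
      · simp [h.zero_off x hx]
    · by_cases hx : x ∈ K
      · refine (hf.comp_continuousOn ((continuous_coord 1).comp_continuousOn ?_)).mul
          continuousOn_const
        exact fun s hs => ((h.flow.ode x (h.subset hx) s hs.1).continuousWithinAt).mono
          Icc_subset_Ici_self
      · simpa [h.zero_off x hx] using continuousOn_const
  exact hc1.congr fun s hs =>
    h.integral_mul_vorticity hs (hf.measurable.comp (continuous_coord 1).measurable)

lemma continuous_field_coord (h : IsConfinedFlow ε C_F L S a b m ρ K F ω φ) {t : ℝ}
    (ht : 0 ≤ t) : Continuous fun x => F t x 1 :=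
  (continuous_coord 1).comp (h.field.lipschitzWith ht).continuous

/-- In Lagrangian variables the density `ω 0` is fixed and only `f(φ_s x)` depends on time, so
differentiation under the integral needs no derivative of the vorticity; the result is then
transported back. -/
lemma hasDerivAt_moment (h : IsConfinedFlow ε C_F L S a b m ρ K F ω φ) {t : ℝ}
    (ht : t ∈ Ioo 0 S) {f f' : ℝ → ℝ} (hf : ∀ r, HasDerivAt f (f' r) r) (hf' : Continuous f') :
    HasDerivAt (fun s => ∫ x, f (x 1) * ω s x)
      (∫ x, f' (x 1) * (regVel 1 0 (ω t) x + F t x 1) * ω t x) t := by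
  have hS : 0 ≤ S := (ht.1.trans ht.2).le
  have htc : t ∈ Icc 0 S := Ioo_subset_Icc_self ht
  have hfc : Continuous f := continuous_iff_continuousAt.2 fun r => (hf r).continuousAt
  obtain ⟨c, hc⟩ := exists_abs_le hf' b
  obtain ⟨c₀, hc₀⟩ := exists_abs_le hfc b
  set V := 2 * velBound a b m + C_F / |Real.log ε|
  let v : ℝ → Plane → ℝ := fun s x => regVel 1 0 (ω s) (φ s x) + F s (φ s x) 1
  have hve : ∀ s ∈ Icc 0 S, ∀ x ∈ K, v s x = (velocity (ω s) (φ s x) + F s (φ s x)) 1 :=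
    fun s hs x hx => by
      rw [PiLp.add_apply, velocity_apply h.lower_pos (h.vorticity s hs) (h.mem_box hs hx)]
  have hvb : ∀ s ∈ Icc 0 S, ∀ x ∈ K, |v s x| ≤ V := fun s hs x hx => by
    rw [hve s hs x hx]; exact (abs_coord_le _ 1).trans (h.norm_field_le hs hx)
  have hbd : ∀ s ∈ Icc 0 S, ∀ x ∈ K, |f' (φ s x 1) * v s x| ≤ c * V := fun s hs x hx => by
    have h1 := hc _ (h.abs_radial_le hs hx)
    rw [abs_mul]
    exact mul_le_mul h1 (hvb s hs x hx) (abs_nonneg _) ((abs_nonneg _).trans h1)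
  have hmeas : Measurable fun x => f' (x 1) * (regVel 1 0 (ω t) x + F t x 1) :=
    (hf'.measurable.comp (continuous_coord 1).measurable).mul
      ((measurable_regVel 1 0 (h.vorticity t htc).measurable).add
        (h.continuous_field_coord htc.1).measurable)
  have hφm : AEMeasurable (φ t) (volume.restrict K) :=
    (h.continuousOn_time htc).aemeasurable h.compact.measurableSet
  have hint : ∀ s ∈ Icc 0 S, Integrable fun x => f (φ s x 1) * ω 0 x := fun s hs =>
    h.integrable_mul_initial hS ((hfc.comp_continuousOn
      (h.continuousOn_radial hs)).aemeasurable h.compact.measurableSet)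
      fun x hx => hc₀ _ (h.abs_radial_le hs hx)
  have hint' : Integrable fun x => f' (φ t x 1) * v t x * ω 0 x :=
    h.integrable_mul_initial hS (hmeas.comp_aemeasurable hφm) (hbd t htc)
  have hnhds : Ioo 0 S ∈ 𝓝 t := isOpen_Ioo.mem_nhds ht
  have key := (hasDerivAt_integral_of_dominated_loc_of_deriv_le (μ := volume)
    (F := fun s x => f (φ s x 1) * ω 0 x) (F' := fun s x => f' (φ s x 1) * v s x * ω 0 x)
    (bound := fun x => c * V * |ω 0 x|) hnhds
    (by filter_upwards [hnhds] with s hs using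
      (hint s (Ioo_subset_Icc_self hs)).aestronglyMeasurable)
    (hint t htc) hint'.aestronglyMeasurable
    (Eventually.of_forall fun x s hs => by
      by_cases hx : x ∈ K
      · rw [norm_mul]
        exact mul_le_mul_of_nonneg_right (hbd s (Ioo_subset_Icc_self hs) x hx) (abs_nonneg _)
      · simp [h.zero_off x hx])
    ((h.vorticity 0 ⟨le_rfl, hS⟩).integrable.abs.const_mul _)
    (Eventually.of_forall fun x s hs => by
      by_cases hx : x ∈ K
      · have h1 := h.hasDerivAt_flow hs.1 hx
        have h2 : HasDerivAt (fun s => φ s x 1) (v s x) s := by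
          rw [hve s (Ioo_subset_Icc_self hs) x hx]
          exact (EuclideanSpace.proj (𝕜 := ℝ) (1 : Fin 2) :
            Plane →L[ℝ] ℝ).hasFDerivAt.comp_hasDerivAt s h1
        exact ((hf _).comp s h2).mul_const _
      · simpa [h.zero_off x hx] using hasDerivAt_const s (0 : ℝ))).2
  rw [h.integral_mul_vorticity htc hmeas]
  refine key.congr_of_eventuallyEq ?_
  filter_upwards [hnhds] with s hs using h.integral_mul_vorticity (Ioo_subset_Icc_self hs)
    (hfc.measurable.comp (continuous_coord 1).measurable)

lemma vorticity_nonneg (h : IsConfinedFlow ε C_F L S a b m ρ K F ω φ) {t : ℝ} (ht : t ∈ Icc 0 S)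
    (h0 : ∀ x, 0 ≤ ω 0 x) (y : Plane) : 0 ≤ ω t y := by
  by_cases hy : y ∈ halfPlane
  · obtain ⟨x, hx, rfl⟩ := (h.flow.bijOn t ht.1).surjOn hy
    rw [h.flow.transport x hx t ht.1]
    exact mul_nonneg (div_nonneg (le_of_lt hy) (le_of_lt hx)) (h0 x)
  · exact (h.flow.extension t ht.1 y hy).ge

end IsConfinedFlow

/-! ### Growth of the axial moment -/

section Moments

variable {a b m : ℝ} {w : Plane → ℝ}

lemma IsVorticity.integrable_mul (hw : IsVorticity a b m w) {f : Plane → ℝ} (hf : Continuous f) :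
    Integrable fun x => f x * w x := by
  obtain ⟨c, hc⟩ := (isCompact_closedBall (0 : Plane) b).exists_bound_of_continuousOn hf.continuousOn
  refine (hw.integrable.norm.const_mul c).mono'
    (hf.measurable.mul hw.measurable).aestronglyMeasurable (Eventually.of_forall fun x => ?_)
  by_cases hx : x ∈ box a b
  · rw [norm_mul]
    exact mul_le_mul_of_nonneg_right
      (hc x (mem_closedBall_zero_iff.2 (norm_lt_of_mem_box hx).le)) (norm_nonneg _)
  · simp [hw.support x hx]

lemma IsVorticity.center_apply (hw : IsVorticity a b m w) :
    center w 1 = (∫ x, w x)⁻¹ * ∫ x, x 1 * w x := by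
  have hi : Integrable fun x => w x • x := by
    refine (hw.integrable_mul continuous_norm).norm.mono'
      (hw.measurable.smul measurable_id).aestronglyMeasurable (Eventually.of_forall fun x => ?_)
    simp [norm_smul, mul_comm]
  have := (EuclideanSpace.proj (𝕜 := ℝ) (1 : Fin 2) : Plane →L[ℝ] ℝ).integral_comp_comm hi
  rw [center, PiLp.smul_apply, smul_eq_mul]
  congr 1
  refine this.symm.trans (integral_congr_ae (Eventually.of_forall fun x => ?_))
  simp [mul_comm]

lemma IsVorticity.integral_sq_sub (hw : IsVorticity a b m w) (β : ℝ) :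
    ∫ x, (x 1 - β) ^ 2 * w x =
      (∫ x, x 1 ^ 2 * w x) - 2 * β * (∫ x, x 1 * w x) + β ^ 2 * ∫ x, w x := by
  have h1 := hw.integrable_mul (continuous_coord 1)
  have h2 : Integrable fun x => x 1 ^ 2 * w x := hw.integrable_mul ((continuous_coord 1).pow 2)
  have h3 : Integrable fun x => x 1 ^ 2 * w x - 2 * β * (x 1 * w x) := h2.sub (h1.const_mul _)
  rw [← integral_const_mul, ← integral_const_mul, ← integral_sub h2 (h1.const_mul _),
    ← integral_add h3 (hw.integrable.const_mul _)]
  congr 1; ext x; ring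

lemma IsVorticity.axialMoment_eq (hw : IsVorticity a b m w) (hpos : 0 < ∫ x, w x) :
    axialMoment w = (∫ x, x 1 ^ 2 * w x) - (∫ x, x 1 * w x) ^ 2 / ∫ x, w x := by
  rw [axialMoment, hw.integral_sq_sub, hw.center_apply]
  field_simp
  ring

lemma IsVorticity.axialMoment_le (hw : IsVorticity a b m w) (hpos : 0 < ∫ x, w x) (β : ℝ) :
    axialMoment w ≤ ∫ x, (x 1 - β) ^ 2 * w x := by
  rw [hw.axialMoment_eq hpos, hw.integral_sq_sub]
  set A := ∫ x, w x
  set B := ∫ x, x 1 * w x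
  have : 0 ≤ (B - β * A) ^ 2 / A := by positivity
  have e : (B - β * A) ^ 2 / A = B ^ 2 / A - 2 * β * B + β ^ 2 * A := by field_simp; ring
  linarith

end Moments

/-- The rate of change of the axial moment, estimated with vorticity of mass `A` in the strip
`r₀ / 2 ≤ x₂ ≤ 3 r₀ / 2` and a field of size at most `C_F A`. -/
lemma abs_momentRate_le {a b m r₀ A C_F : ℝ} {w : Plane → ℝ} {f : Plane → ℝ} (ha : 0 < a)
    (hw : IsVorticity a b m w) (hr₀ : 0 < r₀) (hA : 0 < A) (hw0 : ∀ x, 0 ≤ w x)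
    (hmass : ∫ x, w x = A) (hstrip : ∀ x, w x ≠ 0 → r₀ / 2 ≤ x 1 ∧ x 1 ≤ 3 / 2 * r₀)
    (hf : Continuous f) (hfb : ∀ x, |f x| ≤ C_F * A) :
    (∫ x, 2 * x 1 * (regVel 1 0 w x + f x) * w x) -
      2 * (∫ x, x 1 * w x) * (∫ x, 1 * (regVel 1 0 w x + f x) * w x) / A ≤
      (2 * r₀ * C_F + 6 * Real.pi) * A ^ 2 := by
  have hpi := Real.pi_pos
  have iw := hw.integrable
  have i1 := hw.integrable_mul (continuous_coord 1)
  have ifw := hw.integrable_mul hf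
  have ixf : Integrable fun x => x 1 * f x * w x :=
    hw.integrable_mul ((continuous_coord 1).mul hf)
  have hCA : 0 ≤ C_F * A := (abs_nonneg _).trans (hfb 0)
  have humeas : Measurable (regVel 1 0 w) := measurable_regVel 1 0 hw.measurable
  have iu : Integrable fun x => regVel 1 0 w x * w x := by
    refine (iw.abs.const_mul (velBound a b m)).mono' (humeas.mul hw.measurable).aestronglyMeasurable
      (Eventually.of_forall fun x => ?_)
    by_cases hx : x ∈ box a b
    · rw [norm_mul]
      exact mul_le_mul_of_nonneg_right (abs_regVel_zero_le ha hw hx 1) (abs_nonneg _)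
    · simp [hw.support x hx]
  have ixu : Integrable fun x => x 1 * regVel 1 0 w x * w x := by
    refine (iu.abs.const_mul (3 / 2 * r₀)).mono'
      (((continuous_coord 1).measurable.mul humeas).mul hw.measurable).aestronglyMeasurable
      (Eventually.of_forall fun x => ?_)
    by_cases hx : w x = 0
    · simp [hx]
    · obtain ⟨l, u⟩ := hstrip x hx
      rw [mul_assoc, norm_mul, Real.norm_eq_abs, Real.norm_eq_abs]
      gcongr
      rwa [abs_of_nonneg (by linarith)]
  set B := ∫ x, x 1 * w x
  have hBl : r₀ / 2 * A ≤ B := by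
    rw [← hmass, ← integral_const_mul]
    refine integral_mono (iw.const_mul _) i1 fun x => ?_
    by_cases hx : w x = 0
    · simp [hx]
    · exact mul_le_mul_of_nonneg_right (hstrip x hx).1 (hw0 x)
  have hBu : B ≤ 3 / 2 * r₀ * A := by
    rw [← hmass, ← integral_const_mul]
    refine integral_mono i1 (iw.const_mul _) fun x => ?_
    by_cases hx : w x = 0
    · simp [hx]
    · exact mul_le_mul_of_nonneg_right (hstrip x hx).2 (hw0 x)
  set β := B / A
  have hβl : r₀ / 2 ≤ β := (le_div_iff₀ hA).2 hBl
  have hβu : β ≤ 3 / 2 * r₀ := (div_le_iff₀ hA).2 hBu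
  set U := ∫ x, regVel 1 0 w x * w x
  -- The level `r₀ / 4` is used because the support condition is a strict inequality and the strip
  -- includes `r₀ / 2`.
  have hU : |U| ≤ Real.pi / (2 * (r₀ / 4)) * A ^ 2 := by
    rw [← hmass]
    exact abs_integral_regVel_le ha (by positivity) hw hw0 fun x hx => by
      linarith [(hstrip x hx).1]
  set P := ∫ x, (x 1 - β) * f x * w x
  have hP : |P| ≤ r₀ * (C_F * A) * A := by
    have hle : ‖P‖ ≤ ∫ x, r₀ * (C_F * A) * w x :=
      norm_integral_le_of_norm_le (iw.const_mul _) (Eventually.of_forall fun x => by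
        by_cases hx : w x = 0
        · simp [hx]
        · obtain ⟨l, u⟩ := hstrip x hx
          rw [norm_mul, norm_mul, Real.norm_eq_abs, Real.norm_eq_abs, Real.norm_eq_abs,
            abs_of_nonneg (hw0 x)]
          have h1 : |x 1 - β| ≤ r₀ := abs_le.2 ⟨by linarith, by linarith⟩
          exact mul_le_mul_of_nonneg_right
            (mul_le_mul h1 (hfb x) (abs_nonneg _) hr₀.le) (hw0 x))
    rwa [integral_const_mul, hmass] at hle
  have e1 : ∫ x, 2 * x 1 * (regVel 1 0 w x + f x) * w x = 2 * ∫ x, x 1 * f x * w x := by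
    have h0 := integral_coord_mul_regVel ha hw
    have : ∀ x : Plane, 2 * x 1 * (regVel 1 0 w x + f x) * w x =
        2 * (x 1 * regVel 1 0 w x * w x) + 2 * (x 1 * f x * w x) := fun x => by ring
    simp_rw [this]
    rw [integral_add (ixu.const_mul 2) (ixf.const_mul 2), integral_const_mul, integral_const_mul,
      h0]
    ring
  have e2 : ∫ x, 1 * (regVel 1 0 w x + f x) * w x = U + ∫ x, f x * w x := by
    rw [← integral_add iu ifw]
    congr 1; ext x; ring
  have e3 : P = (∫ x, x 1 * f x * w x) - β * ∫ x, f x * w x := by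
    rw [← integral_const_mul, ← integral_sub ixf (ifw.const_mul _)]
    exact integral_congr_ae (Eventually.of_forall fun x => by ring)
  -- The self-interaction contributes only through the center, as `-2 β U`, and the external field
  -- only through its centered moment `P`.
  have e4 : (∫ x, 2 * x 1 * (regVel 1 0 w x + f x) * w x) -
      2 * B * (∫ x, 1 * (regVel 1 0 w x + f x) * w x) / A = 2 * P - 2 * β * U := by
    rw [e1, e2, e3]; simp only [β]; ring
  rw [e4]
  have hβU : |β * U| ≤ 3 / 2 * r₀ * (Real.pi / (2 * (r₀ / 4)) * A ^ 2) := by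
    rw [abs_mul, abs_of_nonneg (by linarith)]
    gcongr
  have e5 : 3 / 2 * r₀ * (Real.pi / (2 * (r₀ / 4)) * A ^ 2) = 3 * Real.pi * A ^ 2 := by
    field_simp; ring
  rw [e5] at hβU
  have := (abs_le.1 hP).2
  have := (abs_le.1 hβU).1
  nlinarith

lemma sq_mul_abs_log_le {ε : ℝ} (h0 : 0 < ε) (h1 : ε < 1) : ε ^ 2 * |Real.log ε| ≤ 1 := by
  have hlog : |Real.log ε| ≤ 1 / ε := by
    rw [abs_of_neg (Real.log_neg h0 h1), ← Real.log_inv, one_div]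
    exact (Real.log_le_self (by positivity))
  calc ε ^ 2 * |Real.log ε| ≤ ε ^ 2 * (1 / ε) := by gcongr
    _ = ε := by field_simp
    _ ≤ 1 := h1.le

/-- Growth of the axial moment up to a time `t₀` before which the vorticity stays in the strip. -/
lemma IsConfinedFlow.axialMoment_le {ε C_F L S a b m ρ : ℝ} {K : Set Plane}
    {F : ℝ → Plane → Plane} {ω : ℝ → Plane → ℝ} {φ : ℝ → Plane → Plane}
    (h : IsConfinedFlow ε C_F L S a b m ρ K F ω φ) {r₀ A t₀ : ℝ} (hr₀ : 0 < r₀) (hA : 0 < A)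
    (hAε : C_F / |Real.log ε| = C_F * A) (hmass : ∫ x, ω 0 x = A) (hpos : ∀ x, 0 ≤ ω 0 x)
    (ht₀ : t₀ ∈ Icc 0 S)
    (hstrip : ∀ s ∈ Ioo 0 t₀, ∀ x, ω s x ≠ 0 → r₀ / 2 ≤ x 1 ∧ x 1 ≤ 3 / 2 * r₀) :
    axialMoment (ω t₀) ≤ axialMoment (ω 0) + (2 * r₀ * C_F + 6 * Real.pi) * A ^ 2 * t₀ := by
  have hsub : Icc 0 t₀ ⊆ Icc 0 S := Icc_subset_Icc_right ht₀.2
  have hmassT : ∀ s ∈ Icc 0 S, ∫ x, ω s x = A := fun s hs => by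
    have := h.integral_mul_vorticity hs (f := fun _ => 1) measurable_const
    simpa only [one_mul, hmass] using this
  set q : ℝ → ℝ := fun s => ∫ x, x 1 ^ 2 * ω s x
  set c : ℝ → ℝ := fun s => ∫ x, x 1 * ω s x
  have hJ : ∀ s ∈ Icc 0 S, axialMoment (ω s) = q s - c s ^ 2 / A := fun s hs => by
    rw [(h.vorticity s hs).axialMoment_eq (by rw [hmassT s hs]; exact hA), hmassT s hs]
  have hcont : ContinuousOn (fun s => q s - c s ^ 2 / A) (Icc 0 t₀) :=
    ((h.continuousOn_moment (f := fun r => r ^ 2) (by fun_prop)).mono hsub).sub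
      ((((h.continuousOn_moment (f := fun r => r) continuous_id).mono hsub).pow 2).div_const A)
  have hder : ∀ s ∈ Ioo 0 t₀, HasDerivAt (fun s => q s - c s ^ 2 / A)
      ((∫ x, 2 * x 1 * (regVel 1 0 (ω s) x + F s x 1) * ω s x) -
      2 * (∫ x, x 1 * ω s x) * (∫ x, 1 * (regVel 1 0 (ω s) x + F s x 1) * ω s x) / A) s := by
    intro s hs
    have hsS : s ∈ Ioo 0 S := ⟨hs.1, hs.2.trans_le ht₀.2⟩
    have hq := h.hasDerivAt_moment hsS (f := fun r => r ^ 2) (f' := fun r => 2 * r)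
      (fun r => by simpa using hasDerivAt_pow 2 r) (by fun_prop)
    have hc := h.hasDerivAt_moment hsS (f := fun r => r) (f' := fun _ => 1)
      (fun r => hasDerivAt_id r) continuous_const
    refine (hq.sub ((hc.pow 2).div_const A)).congr_deriv ?_
    norm_num
  have hrate : ∀ s ∈ interior (Icc 0 t₀), deriv (fun s => q s - c s ^ 2 / A) s ≤
      (2 * r₀ * C_F + 6 * Real.pi) * A ^ 2 := by
    intro s hs
    rw [interior_Icc] at hs
    have hsS : s ∈ Icc 0 S := hsub (Ioo_subset_Icc_self hs)
    rw [(hder s hs).deriv]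
    exact abs_momentRate_le h.lower_pos (h.vorticity s hsS) hr₀ hA (h.vorticity_nonneg hsS hpos)
      (hmassT s hsS) (hstrip s hs) (h.continuous_field_coord hsS.1) fun x => by
        rw [← hAε]; exact (abs_coord_le _ 1).trans (h.field.bound s hsS.1 x)
  have hdiff : DifferentiableOn ℝ (fun s => q s - c s ^ 2 / A) (interior (Icc 0 t₀)) := by
    rw [interior_Icc]
    exact fun s hs => (hder s hs).differentiableAt.differentiableWithinAt
  have := (convex_Icc 0 t₀).image_sub_le_mul_sub_of_deriv_le hcont hdiff hrate 0
    (left_mem_Icc.2 ht₀.1) t₀ (right_mem_Icc.2 ht₀.1) ht₀.1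
  rw [hJ t₀ ht₀, hJ 0 ⟨le_rfl, ht₀.1.trans ht₀.2⟩]
  simp only [sub_zero] at this
  linarith

/-- The center minimises the second moment, so it may be replaced by `ζ₀`, where the moment is at
most `ε² A`; then `ε² |log ε| ≤ 1`. -/
lemma IsInitialDatum.axialMoment_le {a b m ε M : ℝ} {ζ₀ : Plane} {w : Plane → ℝ}
    (hd : IsInitialDatum ε M ζ₀ w) (hw : IsVorticity a b m w) (hε : 0 < ε) (hε1 : ε < 1) :
    axialMoment w ≤ 1 / |Real.log ε| ^ 2 := by
  have hl : 0 < |Real.log ε| := abs_pos.2 (Real.log_neg hε hε1).ne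
  have hmass : ∫ x, w x = 1 / |Real.log ε| := by
    rw [eq_div_iff hl.ne', mul_comm]; exact hd.intensity
  refine (hw.axialMoment_le (by rw [hmass]; positivity) (ζ₀ 1)).trans ?_
  calc ∫ x, (x 1 - ζ₀ 1) ^ 2 * w x ≤ ∫ x, ε ^ 2 * w x := by
        refine integral_mono (hw.integrable_mul
          (((continuous_coord 1).sub continuous_const).pow 2)) (hw.integrable.const_mul _)
          fun x => ?_
        by_cases hx : w x = 0
        · simp [hx]
        · have h1 := hd.support (subset_tsupport w hx)
          rw [mem_ball_iff_norm] at h1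
          have h2 : |x 1 - ζ₀ 1| ≤ ε := (abs_coord_le (x - ζ₀) 1).trans h1.le
          have h3 : (x 1 - ζ₀ 1) ^ 2 ≤ ε ^ 2 := by
            rw [← sq_abs]; gcongr
          exact mul_le_mul_of_nonneg_right h3 (hd.nonneg x)
    _ = ε ^ 2 * |Real.log ε| / |Real.log ε| ^ 2 := by
        rw [integral_const_mul, hmass]; field_simp
    _ ≤ 1 / |Real.log ε| ^ 2 := by
        gcongr; exact sq_mul_abs_log_le hε hε1

end VortexRing

end

theorem lemma2 (ζ₀ : VortexRing.Plane) (hζ₀ : 0 < ζ₀ 1) (M C_F L T : ℝ)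
    (hM : 0 < M) (hC_F : 0 < C_F) (hL : 0 < L) (hT : 0 < T) :
    ∃ C : ℝ, 0 < C ∧ ∀ ε : ℝ, 0 < ε → ε < 1 → ε < ζ₀ 1 / 2 →
      ∀ (F : ℝ → VortexRing.Plane → VortexRing.Plane) (ω : ℝ → VortexRing.Plane → ℝ),
        VortexRing.IsExternalField ε C_F L F →
        VortexRing.IsInitialDatum ε M ζ₀ (ω 0) →
        VortexRing.IsReducedSolution F ω →
        ∀ t ∈ Set.Icc 0 (VortexRing.confinementTime (ζ₀ 1) T ω),
          VortexRing.axialMoment (ω t) ≤ C / |Real.log ε| ^ 2 := by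
  have hpi := Real.pi_pos
  -- The `1` bounds the initial moment and the rest is the growth rate times `T`, in units of
  -- `1/|log ε|²`.
  refine ⟨1 + (2 * ζ₀ 1 * C_F + 6 * Real.pi) * T, by positivity, ?_⟩
  rintro ε hε hε1 hεr F ω hF hd ⟨φ, hφ⟩ t ht
  have hl : 0 < |Real.log ε| := abs_pos.2 (Real.log_neg hε hε1).ne
  have hoff : ∀ x ∉ Metric.closedBall ζ₀ ε, ω 0 x = 0 := fun x hx => by
    by_contra h0
    exact hx (Metric.ball_subset_closedBall (hd.support (subset_tsupport _ h0)))
  have hK : Metric.closedBall ζ₀ ε ⊆ VortexRing.halfPlane := fun x hx => by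
    rw [mem_closedBall_iff_norm] at hx
    have := (abs_le.1 ((VortexRing.abs_coord_le (x - ζ₀) 1).trans hx)).1
    rw [PiLp.sub_apply] at this
    show 0 < x 1
    linarith
  obtain ⟨a, b, m, ρ, h⟩ := hφ.exists_isConfinedFlow hF (isCompact_closedBall ζ₀ ε)
    ⟨ζ₀, Metric.mem_closedBall_self hε.le⟩ hT.le hK hd.measurable
    (fun x => by rw [abs_of_nonneg (hd.nonneg x)]; exact hd.bound x) hoff
  have htT : t ≤ T := ht.2.trans (Real.sSup_le (fun s hs => hs.1.2) hT.le)
  -- Only times strictly before `t` matter, so the supremum need not be attained.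
  have hstrip : ∀ s ∈ Set.Ioo 0 t, ∀ x, ω s x ≠ 0 → ζ₀ 1 / 2 ≤ x 1 ∧ x 1 ≤ 3 / 2 * ζ₀ 1 := by
    intro s hs x hx
    have hlt : s < sSup (VortexRing.confinedTimes (ζ₀ 1) T ω) := hs.2.trans_le ht.2
    have hne : (VortexRing.confinedTimes (ζ₀ 1) T ω).Nonempty := by
      by_contra hcon
      rw [Set.not_nonempty_iff_eq_empty] at hcon
      -- The supremum of the empty set is `0`, which leaves no time `s` with `0 < s` below it.
      rw [hcon, Real.sSup_empty] at hlt
      exact absurd hs.1 (not_lt.2 hlt.le)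
    obtain ⟨s', hs', hss'⟩ := exists_lt_of_lt_csSup hne hlt
    exact hs'.2 s ⟨hs.1.le, hss'.le⟩ x (subset_tsupport _ hx)
  have hmass : ∫ x, ω 0 x = 1 / |Real.log ε| := by
    rw [eq_div_iff hl.ne', mul_comm]; exact hd.intensity
  have hgrow := h.axialMoment_le hζ₀ (by positivity) (by ring) hmass hd.nonneg ⟨ht.1, htT⟩ hstrip
  have hinit := hd.axialMoment_le (h.vorticity 0 ⟨le_rfl, hT.le⟩) hε hε1
  calc VortexRing.axialMoment (ω t)
      ≤ 1 / |Real.log ε| ^ 2 + (2 * ζ₀ 1 * C_F + 6 * Real.pi) * (1 / |Real.log ε|) ^ 2 * T := by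
        refine hgrow.trans (add_le_add hinit ?_)
        gcongr
    _ = _ := by rw [div_pow, one_pow]; ring
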